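/- Let $l\ge 2$ and let $\mathfrak g=\mathfrak{so}_{2l+1}(\mathbb C)$ be the simple Lie algebra of type $B_l$, realized as the matrices skew-adjoint for the symmetric form with block matrix $\mathrm{diag}\left(2,\begin{pmatrix}0&1\\1&0\end{pmatrix}\right)$ (the second block consisting of $l\times l$ blocks). Take the Cartan subalgebra of diagonal matrices $\mathrm{diag}(0,a_1,\dots,a_l,-a_1,\dots,-a_l)$, let $\mu_i$ be the linear form sending this matrix to $a_i$, and take the positive roots $\mu_i$ $(1\le i\le l)$ and $\mu_i\pm\mu_j$ $(i<j)$. Let $\omega_1,\dots,\omega_l$ be the fundamental weights, so $\omega_i=\mu_1+\dots+\mu_i$ for $i<l$ and $\omega_l=\tfrac12(\mu_1+\dots+\mu_l)$, and let $\mathcal P_+=\sum_i\mathbb Z_{\ge0}\,\omega_i$ be the set of dominant integral weights. For $\lambda\in\mathcal P_+$ let $V_\lambda$, with action $\pi_\lambda$, be the finite-dimensional irreducible $\mathfrak g$-module of highest weight $\lambda$; thus $V_{\omega_l}$ is the spin module. For a basis $(x_i)$ of $\mathfrak g$ with dual basis $(x_i^*)$ with respect to the Killing form, put $$M_{\omega_l,\nu}(C)=\sum_i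 \pi_{\omega_l}(x_i)\otimes\pi_\nu(x_i^*)\in \mathrm{End}(V_{\omega_l}\otimes V_\nu),$$ which does not depend on the basis. It acts on each irreducible submodule of $V_{\omega_l}\otimes V_\nu$ by a scalar, called the eigenvalue on that component. 1. The $M_{\omega_l,\nu}(C)$-eigenvalues of all irreducible components (irreducible submodules) of $V_{\omega_l}\otimes V_\nu$ are pairwise distinct for every $\nu\in\mathcal P_+$ if and only if $l=2$. 2. Let $l\ge3$ and let $\nu=a_1\omega_1+\dots+a_l\omega_l\in\mathcal P_+$ satisfy $a_l=2a_{l-2}+1$. Let $\varepsilon=\tfrac12\sum_i\varepsilon_i\mu_i$ and $\eta=\tfrac12\sum_i\eta_i\mu_i$ with $\varepsilon_i,\eta_i\in\{1,-1\}$, $\varepsilon_i=\eta_i$ for $i\le l-3$, $(\varepsilon_{l-2},\varepsilon_{l-1},\varepsilon_l)=(1,-1,-1)$ and $(\eta_{l-2},\eta_{l-1},\eta_l)=(-1,1,1)$, and suppose that $\nu+\varepsilon$ and $\nu+\eta$ lie in $\mathcal P_+$ (which holds for instance if all $a_i\ge1$). Then $V_{\nu+\varepsilon}$ and $V_{\nu+\eta}$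 occur as distinct irreducible components of $V_{\omega_l}\otimes V_\nu$, and $M_{\omega_l,\nu}(C)$ has the same eigenvalue on both. -/

import Mathlib

open scoped TensorProduct

/-! ### The operator `M` on a tensor product -/

section TensorCasimir

variable (K L : Type*) [Field K] [LieRing L] [LieAlgebra K L] [Module.Finite K L]
  [LieAlgebra.IsKilling K L]
variable (V W : Type*) [AddCommGroup V] [Module K V] [LieRingModule L V] [LieModule K L V]
  [AddCommGroup W] [Module K W] [LieRingModule L W] [LieModule K L W]

/-- The operator `M_{V,W}(C) = ∑ i, π_V (x i) ⊗ π_W (x* i)` on `V ⊗ W`, where `x` is a basis of `L`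
and `x*` is the basis dual to `x` with respect to the Killing form of `L`. It does not depend on
the choice of `x`, see `tensorCasimir_eq_sum`. -/
noncomputable def tensorCasimir : V ⊗[K] W →ₗ[K] V ⊗[K] W :=
  ∑ i, TensorProduct.map (LieModule.toEnd K L V (Module.finBasis K L i))
    (LieModule.toEnd K L W (LinearMap.BilinForm.dualBasis (killingForm K L)
      (LieAlgebra.IsKilling.killingForm_nondegenerate K L) (Module.finBasis K L) i))

/-- `tensorCasimir` may be computed from any pair of Killing-dual bases. -/
theorem tensorCasimir_eq_sum {ι : Type*} [Fintype ι] [DecidableEq ι]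
    (x y : Module.Basis ι K L)
    (hxy : ∀ i j, killingForm K L (y i) (x j) = if i = j then 1 else 0) :
    tensorCasimir K L V W =
      ∑ i, TensorProduct.map (LieModule.toEnd K L V (x i)) (LieModule.toEnd K L W (y i)) := by
  have hB := LieAlgebra.IsKilling.killingForm_nondegenerate K L
  set b := Module.finBasis K L
  set d := LinearMap.BilinForm.dualBasis (killingForm K L) hB b with hd
  have h1 : ∀ i, b i = ∑ j, killingForm K L (y j) (b i) • x j := by
    intro i
    have : b i = ∑ j, x.repr (b i) j • x j := (x.sum_repr (b i)).symm
    conv_lhs => rw [this]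
    refine Finset.sum_congr rfl fun j _ => ?_
    congr 1
    conv_rhs => rw [this]
    simp only [map_sum, map_smul, hxy, smul_eq_mul, mul_ite, mul_one, mul_zero,
      Finset.sum_ite_eq, Finset.mem_univ, if_true]
  have h2 : ∀ j, y j = ∑ i, killingForm K L (y j) (b i) • d i := by
    intro j
    rw [← d.sum_repr (y j)]
    refine Finset.sum_congr rfl fun i _ => ?_
    rw [d.sum_repr, hd, LinearMap.BilinForm.dualBasis_repr_apply]
  have key : ∀ (f : L →ₗ[K] L →ₗ[K] (V ⊗[K] W →ₗ[K] V ⊗[K] W)),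
      ∑ i, f (b i) (d i) = ∑ j, f (x j) (y j) := by
    intro f
    calc ∑ i, f (b i) (d i)
        = ∑ i, ∑ j, killingForm K L (y j) (b i) • f (x j) (d i) := by
          refine Finset.sum_congr rfl fun i _ => ?_
          conv_lhs => rw [h1 i]
          simp [LinearMap.sum_apply]
      _ = ∑ j, ∑ i, killingForm K L (y j) (b i) • f (x j) (d i) := Finset.sum_comm
      _ = ∑ j, f (x j) (y j) := by
          refine Finset.sum_congr rfl fun j _ => ?_
          conv_rhs => rw [h2 j]
          simp
  exact key (LinearMap.mk₂ K
    (fun x y => TensorProduct.map (LieModule.toEnd K L V x) (LieModule.toEnd K L W y))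
    (fun _ _ _ => by rw [map_add, TensorProduct.map_add_left])
    (fun _ _ _ => by rw [map_smul, TensorProduct.map_smul_left])
    (fun _ _ _ => by rw [map_add, TensorProduct.map_add_right])
    (fun _ _ _ => by rw [map_smul, TensorProduct.map_smul_right]))

/-- Every irreducible submodule of `V ⊗ W` is acted on by `M_{V,W}(C)` through a scalar (its
`M`-eigenvalue), and distinct irreducible submodules have distinct eigenvalues. -/
def HasDistinctEigenvalues : Prop :=
  ∃ c : {N : LieSubmodule K L (V ⊗[K] W) // LieModule.IsIrreducible K L N} → K,
    (∀ N, ∀ t ∈ N.1, tensorCasimir K L V W t = c N • t) ∧ Function.Injective c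

end TensorCasimir

/-! ### The simple Lie algebra of type `B_l` -/

namespace TypeB

/-- The Lie algebra `𝔰𝔬(2l+1, ℂ)`: square complex matrices `A` of size `2l+1` that are skew-adjoint
for the symmetric bilinear form with block matrix `[2 0 0; 0 0 1; 0 1 0]`. -/
abbrev Alg (l : ℕ) := LieAlgebra.Orthogonal.typeB (Fin l) ℂ

section Killing

open Matrix

attribute [local instance 100] LieRing.ofAssociativeRing

theorem mem_iff {l : ℕ} (A : Matrix (Unit ⊕ Fin l ⊕ Fin l) (Unit ⊕ Fin l ⊕ Fin l) ℂ) :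
    A ∈ LieAlgebra.Orthogonal.typeB (Fin l) ℂ ↔
      Aᵀ * LieAlgebra.Orthogonal.JB (Fin l) ℂ = -(LieAlgebra.Orthogonal.JB (Fin l) ℂ * A) := by
  rw [LieAlgebra.Orthogonal.typeB, mem_skewAdjointMatricesLieSubalgebra,
    mem_skewAdjointMatricesSubmodule, Matrix.IsSkewAdjoint, Matrix.IsAdjointPair, mul_neg]

theorem JB_transpose (l : ℕ) :
    (LieAlgebra.Orthogonal.JB (Fin l) ℂ)ᵀ = LieAlgebra.Orthogonal.JB (Fin l) ℂ := by
  simp [LieAlgebra.Orthogonal.JB, LieAlgebra.Orthogonal.JD, Matrix.fromBlocks_transpose]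

theorem trace_eq_zero {l : ℕ} (A : Alg l) : Matrix.trace A.1 = 0 := by
  have h := (mem_iff A.1).1 A.2
  have h0 := congrFun (congrFun h (Sum.inl ())) (Sum.inl ())
  have h1 : ∀ i : Fin l, A.1 (.inr (.inl i)) (.inr (.inl i)) =
      -A.1 (.inr (.inr i)) (.inr (.inr i)) := by
    intro i
    have := congrFun (congrFun h (.inr (.inl i))) (.inr (.inr i))
    simpa [LieAlgebra.Orthogonal.JB, LieAlgebra.Orthogonal.JD, Matrix.mul_apply,
      Matrix.one_apply] using this
  have h0' : A.1 (.inl ()) (.inl ()) = 0 := by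
    simp [LieAlgebra.Orthogonal.JB, LieAlgebra.Orthogonal.JD, Matrix.mul_apply] at h0
    linear_combination (1 / 4 : ℂ) * h0
  simp [Matrix.trace, h0', h1]

/-- The skew-adjoint matrix `u (J w)ᵀ - w (J u)ᵀ`. -/
def skew {l : ℕ} (u w : Unit ⊕ Fin l ⊕ Fin l → ℂ) : Alg l :=
  ⟨vecMulVec u (LieAlgebra.Orthogonal.JB (Fin l) ℂ *ᵥ w) -
      vecMulVec w (LieAlgebra.Orthogonal.JB (Fin l) ℂ *ᵥ u), by
    rw [mem_iff]
    simp only [transpose_sub, transpose_vecMulVec, sub_mul, mul_sub, vecMulVec_mul,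
      mul_vecMulVec]
    rw [← mulVec_transpose, ← mulVec_transpose, JB_transpose, neg_sub]⟩

theorem isIrreducible_std {l : ℕ} (hl : l ≠ 0) :
    LieModule.IsIrreducible ℂ (Alg l) (Unit ⊕ Fin l ⊕ Fin l → ℂ) := by
  set J := LieAlgebra.Orthogonal.JB (Fin l) ℂ with hJ
  have hskew : ∀ u w v : Unit ⊕ Fin l ⊕ Fin l → ℂ,
      ⁅skew u w, v⁆ = (v ⬝ᵥ J *ᵥ w) • u - (v ⬝ᵥ J *ᵥ u) • w := by
    intro u w v
    change (skew u w).1 *ᵥ v = _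
    simp only [skew, sub_mulVec, vecMulVec_mulVec, ← hJ]
    rw [dotProduct_comm v, dotProduct_comm v]
    ext i
    simp [mul_comm]
  refine LieModule.IsIrreducible.mk fun N hN => ?_
  by_contra htop
  obtain ⟨v, hvN, hv⟩ : ∃ v ∈ N, v ≠ 0 := by
    by_contra! hcon
    exact hN ((LieSubmodule.eq_bot_iff N).2 hcon)
  -- every vector orthogonal to a nonzero vector of `N` is in `N`
  have hperp : ∀ v ∈ N, v ≠ 0 → ∀ u, v ⬝ᵥ J *ᵥ u = 0 → u ∈ N := by
    intro v hvN hv u hu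
    obtain ⟨w, hw⟩ : ∃ w, v ⬝ᵥ J *ᵥ w ≠ 0 := by
      by_contra! hcon
      apply hv
      ext k
      rcases k with k | k | k
      · have := hcon (Pi.single (.inl ()) 1)
        simpa [J, LieAlgebra.Orthogonal.JB, LieAlgebra.Orthogonal.JD, dotProduct] using this
      · have := hcon (Pi.single (.inr (.inr k)) 1)
        simpa [J, LieAlgebra.Orthogonal.JB, LieAlgebra.Orthogonal.JD, dotProduct,
          Matrix.one_apply] using this
      · have := hcon (Pi.single (.inr (.inl k)) 1)
        simpa [J, LieAlgebra.Orthogonal.JB, LieAlgebra.Orthogonal.JD, dotProduct,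
          Matrix.one_apply] using this
    have := N.lie_mem (x := skew u w) hvN
    rw [hskew, hu, zero_smul, sub_zero] at this
    simpa [smul_smul, hw] using N.smul_mem (v ⬝ᵥ J *ᵥ w)⁻¹ this
  -- `N` is totally isotropic
  have hiso : ∀ v ∈ N, v ⬝ᵥ J *ᵥ v = 0 := by
    intro v hvN
    by_contra hvv
    have hv : v ≠ 0 := by
      rintro rfl
      simp at hvv
    apply htop
    refine eq_top_iff.2 fun u _ => ?_
    have h1 : u - ((v ⬝ᵥ J *ᵥ u) / (v ⬝ᵥ J *ᵥ v)) • v ∈ N := by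
      refine hperp v hvN hv _ ?_
      rw [mulVec_sub, dotProduct_sub, mulVec_smul, dotProduct_smul, smul_eq_mul,
        div_mul_cancel₀ _ hvv, sub_self]
    simpa using N.add_mem h1 (N.smul_mem ((v ⬝ᵥ J *ᵥ u) / (v ⬝ᵥ J *ᵥ v)) hvN)
  have hall : ∀ u, v ⬝ᵥ J *ᵥ u = 0 → u ⬝ᵥ J *ᵥ u = 0 := fun u hu =>
    hiso u (hperp v hvN hv u hu)
  let k : Fin l := ⟨0, Nat.pos_of_ne_zero hl⟩
  have key : ∀ x p q : ℂ, (2 * v (.inl ()) * x + v (.inr (.inr k)) * p + v (.inr (.inl k)) * q = 0) →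
      x * x + p * q = 0 := by
    intro x p q h
    have := hall (Sum.elim (fun _ => x) (Sum.elim (Pi.single k p) (Pi.single k q))) ?_
    · simp [J, LieAlgebra.Orthogonal.JB, LieAlgebra.Orthogonal.JD, dotProduct, mulVec,
        Matrix.one_apply, Pi.single_apply] at this
      linear_combination (1 / 2 : ℂ) * this
    · simp [J, LieAlgebra.Orthogonal.JB, LieAlgebra.Orthogonal.JD, dotProduct, mulVec,
        Matrix.one_apply, Pi.single_apply]
      linear_combination h
  have e1 := key (v (.inr (.inr k))) (-2 * v (.inl ())) 0 (by ring)
  have e2 := key (v (.inr (.inl k))) 0 (-2 * v (.inl ())) (by ring)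
  have e1' : v (.inr (.inr k)) = 0 := by simpa using e1
  have e2' : v (.inr (.inl k)) = 0 := by simpa using e2
  have := key 0 1 1 (by rw [e1', e2']; ring)
  simp at this

/-- The Killing form of `𝔰𝔬(2l+1, ℂ)` is nondegenerate. -/
instance isKilling (l : ℕ) : LieAlgebra.IsKilling ℂ (Alg l) := by
  suffices LieAlgebra.HasTrivialRadical ℂ (Alg l) from inferInstance
  rcases eq_or_ne l 0 with rfl | hl
  · have : Subsingleton (Alg 0) := by
      refine ⟨fun A B => ?_⟩
      have h : ∀ A : Alg 0, A = 0 := by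
        intro A
        ext i j
        rcases i with i | i | i
        · rcases j with j | j | j
          · simpa [Matrix.trace] using trace_eq_zero A
          · exact j.elim0
          · exact j.elim0
        · exact i.elim0
        · exact i.elim0
      rw [h A, h B]
    infer_instance
  · have := isIrreducible_std hl
    refine LieAlgebra.hasTrivialRadical_of_isIrreducible_of_isFaithful ℂ (Alg l)
      (Unit ⊕ Fin l ⊕ Fin l → ℂ) fun A => ?_
    have : LieModule.toEnd ℂ (Alg l) (Unit ⊕ Fin l ⊕ Fin l → ℂ) A = Matrix.toLin' A.1 := by
      ext
      simp
    rw [this, Matrix.trace_toLin'_eq, trace_eq_zero]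

end Killing

/-! ### Weights

A weight of the Cartan subalgebra of diagonal matrices is given by its coordinates `ζ : Fin l → ℂ`
in the basis `μ_1, …, μ_l`, where `μ_i (diag(0, a_1, …, a_l, -a_1, …, -a_l)) = a_i`; indices in
`Fin l` are shifted by one. -/

open Matrix

/-- The element `diag(0, a_1, …, a_l, -a_1, …, -a_l)` of the Cartan subalgebra. -/
def cartan {l : ℕ} (a : Fin l → ℂ) : Alg l :=
  ⟨Matrix.diagonal (Sum.elim 0 (Sum.elim a (-a))), by
    rw [mem_iff]
    ext i j
    rcases i with i | i | i <;> rcases j with j | j | j <;>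
      simp [LieAlgebra.Orthogonal.JB, LieAlgebra.Orthogonal.JD, Matrix.one_apply] <;>
      split_ifs with h <;> simp [h]⟩

/-- The positive roots `μ_i`, `μ_i - μ_j` and `μ_i + μ_j` for `i < j`. -/
def positiveRoots (l : ℕ) : Set (Fin l → ℂ) :=
  {α | (∃ i, α = Pi.single i 1) ∨
    ∃ i j, i < j ∧ (α = Pi.single i 1 - Pi.single j 1 ∨ α = Pi.single i 1 + Pi.single j 1)}

/-- The simple roots `α_i = μ_i - μ_{i+1}` for `i < l` and `α_l = μ_l`. -/
def simpleRoot {l : ℕ} (i : Fin l) : Fin l → ℂ :=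
  fun j => if j = i then 1 else if j.val = i.val + 1 then -1 else 0

/-- The fundamental weights `ω_i = μ_1 + ⋯ + μ_i` for `i < l` and
`ω_l = (μ_1 + ⋯ + μ_l) / 2`. -/
noncomputable def fundamentalWeight {l : ℕ} (i : Fin l) : Fin l → ℂ :=
  fun j => if i.val + 1 = l then 1 / 2 else if j ≤ i then 1 else 0

/-- The defining property `2 (ω_i, α_j) / (α_j, α_j) = δ_{ij}` of the fundamental weights. -/
theorem fundamentalWeight_dotProduct_simpleRoot {l : ℕ} (i j : Fin l) :
    2 * (fundamentalWeight i ⬝ᵥ simpleRoot j) / (simpleRoot j ⬝ᵥ simpleRoot j) =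
      if i = j then 1 else 0 := by
  have hdot : ∀ f : Fin l → ℂ, f ⬝ᵥ simpleRoot j =
      f j - if h : j.val + 1 < l then f ⟨j.val + 1, h⟩ else 0 := by
    intro f
    have : ∀ k : Fin l, f k * simpleRoot j k =
        (if k = j then f j else 0) - if k.val = j.val + 1 then f k else 0 := by
      intro k
      unfold simpleRoot
      by_cases h1 : k = j
      · subst h1
        simp
      · by_cases h2 : k.val = j.val + 1 <;> simp [h1, h2]
    simp only [dotProduct, this, Finset.sum_sub_distrib, Finset.sum_ite_eq', Finset.mem_univ,
      if_true]
    congr 1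
    split_ifs with h
    · rw [Finset.sum_eq_single ⟨j.val + 1, h⟩]
      · simp
      · intro k _ hk
        rw [if_neg]
        exact fun h' => hk (Fin.ext h')
      · simp
    · refine Finset.sum_eq_zero fun k _ => if_neg ?_
      omega
  rw [hdot, hdot]
  by_cases hj : j.val + 1 < l
  · by_cases hi : i.val + 1 = l
    · have hij : i ≠ j := fun h => by subst h; omega
      simp [hj, hi, hij, fundamentalWeight]
    · have e : (simpleRoot j j - simpleRoot j ⟨j.val + 1, hj⟩ : ℂ) = 2 := by
        have : (⟨j.val + 1, hj⟩ : Fin l) ≠ j := fun h => by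
          have := congrArg Fin.val h
          simp at this
        simp [simpleRoot, this]
        norm_num
      rw [dif_pos hj, dif_pos hj, e]
      simp only [fundamentalWeight, hi, if_false, Fin.le_def]
      rcases lt_trichotomy i.val j.val with h | h | h
      · rw [if_neg (by omega), if_neg (by omega), if_neg (by rintro rfl; omega)]
        simp
      · rw [if_pos (by omega), if_neg (by omega), if_pos (Fin.ext h)]
        simp
      · rw [if_pos (by omega), if_pos (by omega), if_neg (by rintro rfl; omega)]
        simp
  · rw [dif_neg hj, dif_neg hj]
    have hjl : j.val + 1 = l := by omega
    have e : simpleRoot j j = 1 := by simp [simpleRoot]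
    rw [e]
    by_cases hi : i = j
    · subst hi
      simp [fundamentalWeight, hjl]
    · have h1 : i.val + 1 ≠ l := fun h => hi (Fin.ext (by omega))
      have h2 : ¬ j ≤ i := fun h => hi (Fin.ext (by rw [Fin.le_def] at h; omega))
      simp [fundamentalWeight, h1, h2, hi]

/-- The weight `a_1 ω_1 + ⋯ + a_l ω_l`. -/
noncomputable def weightOf {l : ℕ} (a : Fin l → ℕ) : Fin l → ℂ :=
  ∑ i, (a i : ℂ) • fundamentalWeight i

/-- Dominant integral weights: the combinations of the fundamental weights with coefficients
in `ℕ`. -/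
def IsDominantIntegral {l : ℕ} (ζ : Fin l → ℂ) : Prop :=
  ∃ b : Fin l → ℕ, ζ = weightOf b

/-- The weight `(ε_1 μ_1 + ⋯ + ε_l μ_l) / 2` attached to signs `ε_i = ±1`. -/
noncomputable def spinWeight {l : ℕ} (ε : Fin l → ℤˣ) : Fin l → ℂ :=
  fun i => ((ε i : ℤ) : ℂ) / 2

section Modules

variable {l : ℕ} (V : Type*) [AddCommGroup V] [Module ℂ V] [LieRingModule (Alg l) V]
  [LieModule ℂ (Alg l) V]

/-- `v` is a highest weight vector of weight `ζ`: it is nonzero, the Cartan subalgebra acts on it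
through `ζ`, and every root vector of a positive root annihilates it. -/
structure IsHighestWeightVector {V : Type*} [AddCommGroup V] [Module ℂ V]
    [LieRingModule (Alg l) V] (ζ : Fin l → ℂ) (v : V) : Prop where
  ne_zero : v ≠ 0
  cartan_lie : ∀ a : Fin l → ℂ, ⁅cartan a, v⁆ = (ζ ⬝ᵥ a) • v
  root_lie : ∀ α ∈ positiveRoots l, ∀ x : Alg l,
    (∀ a : Fin l → ℂ, ⁅cartan a, x⁆ = (α ⬝ᵥ a) • x) → ⁅x, v⁆ = 0

/-- `V` is (a copy of) the irreducible finite-dimensional module `V_ζ` with highest weight `ζ`. -/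
structure IsIrreducibleOfHighestWeight (ζ : Fin l → ℂ) : Prop where
  finite : Module.Finite ℂ V
  irreducible : LieModule.IsIrreducible ℂ (Alg l) V
  exists_highestWeightVector : ∃ v : V, IsHighestWeightVector ζ v

end Modules

end TypeB

/-! Let `casimir` be the Casimir operator in the normalization of the generators `gen p q`. Its
coproduct gives C = C ⊗ 1 + 1 ⊗ C + 8(2l-1) M on V ⊗ W, so on a component of highest weight ζ the
eigenvalue of M is an affine function, with nonzero slope, of `casimirScalar ζ` = 2(ζ, ζ + 2ρ). Here
ρ_i = l - i - 1/2 with i counted from 0. The coordinates of a spin weight ε all have square 1/4, so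
`casimirScalar (ν + ε)` is a term independent of ε plus 4(ν + ρ, ε). The theorem becomes a question
about which ν + ε occur and which numbers (ν + ρ, ε) coincide.

Upper bound: expand a highest weight vector of Spin ⊗ W along the weight basis of Spin. Its lowest
nonzero coefficient is killed by all raising operators, hence is a multiple of the highest weight
vector of W. So the weight is ν + ε, and it occurs at most once (`Spin.exists_leading_coeff`,
`Spin.eq_smul_of_isHighestWeightVector`). For l = 2, 2(ν + ρ) = (2a_1 + a_2 + 3, a_2 + 1) has
strictly decreasing positive entries, so (ν + ρ, ε) determines ε. For l ≥ 3, ε - η = μ_{l-2} -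
μ_{l-1} - μ_l pairs with ν + ρ to a_{l-2} - a_l/2 + 1/2, which vanishes exactly when a_l = 2a_{l-2}
+ 1.

Existence is the substantial part. Suppose a bilinear form on Spin × X, invariant under lowering
operators, is nonzero at (δ_ε, u) with u of highest weight ν. On the weight space ν + ε the Casimir
operator is its scalar plus terms ending in a lowering operator, and the form kills those terms.
Hence C minus the scalar is not surjective there, so it has a kernel, and comparison of Casimir
scalars shows that a kernel vector is a highest weight vector
(`Spin.exists_isHighestWeightVector_of_pairing`). The forms are built in `hasPairing_weightOf` from
products of creation and annihilation operators, using one fundamental weight for each block of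
minus signs in ε; dominance of ν + ε supplies exactly these weights.

Complete reducibility is never needed: a finite-dimensional module generated by a highest weight
vector is irreducible by a Casimir comparison (`isIrreducible_of_lieSpan_eq_top`). -/

namespace TypeB

open Matrix

/-! ### Matrix generators, the Killing form, and M in terms of the generators -/

section MatrixModel

variable {l : ℕ}

attribute [local instance 100] LieRing.ofAssociativeRing

/-- The index set of the standard representation of `𝔰𝔬(2l+1)`. -/
abbrev Idx (l : ℕ) := Unit ⊕ Fin l ⊕ Fin l

/-- The Gram matrix of the symmetric bilinear form. -/
abbrev gram (l : ℕ) : Matrix (Idx l) (Idx l) ℂ := LieAlgebra.Orthogonal.JB (Fin l) ℂ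

/-- The inverse of the Gram matrix. -/
noncomputable def gramInv (l : ℕ) : Matrix (Idx l) (Idx l) ℂ :=
  Matrix.fromBlocks ((1 / 2 : ℂ) • (1 : Matrix Unit Unit ℂ)) 0 0 (LieAlgebra.Orthogonal.JD (Fin l) ℂ)

theorem gramInv_mul_gram (l : ℕ) : gramInv l * gram l = 1 := by
  simp [gram, gramInv, LieAlgebra.Orthogonal.JB, LieAlgebra.Orthogonal.JD,
    Matrix.fromBlocks_multiply]

theorem gram_mul_gramInv (l : ℕ) : gram l * gramInv l = 1 :=
  mul_eq_one_comm.1 (gramInv_mul_gram l)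

theorem gramInv_transpose (l : ℕ) : (gramInv l)ᵀ = gramInv l := by
  simp [gramInv, LieAlgebra.Orthogonal.JD, Matrix.fromBlocks_transpose]

theorem transpose_mul_gram (A : Alg l) : A.1ᵀ * gram l = -(gram l * A.1) := (mem_iff A.1).1 A.2

theorem gram_mul (A : Alg l) : gram l * A.1 = -(A.1ᵀ * gram l) := by
  rw [transpose_mul_gram, neg_neg]

theorem mul_gramInv (A : Alg l) : A.1 * gramInv l = -(gramInv l * A.1ᵀ) := by
  have h := congrArg (fun X => gramInv l * X * gramInv l) (transpose_mul_gram A)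
  simp only [mul_assoc, gram_mul_gramInv, mul_one, mul_neg, neg_mul] at h
  rw [← mul_assoc, ← mul_assoc, gramInv_mul_gram, one_mul] at h
  rw [h, neg_neg]

theorem gramInv_mul_transpose_mul_gram (A : Alg l) : gramInv l * A.1ᵀ * gram l = -A.1 := by
  rw [mul_assoc, transpose_mul_gram, mul_neg, ← mul_assoc, gramInv_mul_gram, one_mul]

/-- Twice the projection of the matrix algebra onto the skew-adjoint matrices. -/
noncomputable def skewPart : Matrix (Idx l) (Idx l) ℂ →ₗ[ℂ] Alg l where
  toFun X := ⟨X - gramInv l * Xᵀ * gram l, by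
    rw [mem_iff]
    simp only [transpose_sub, transpose_mul, gramInv_transpose, JB_transpose, transpose_transpose,
      sub_mul, mul_sub]
    rw [mul_assoc, mul_assoc _ _ (LieAlgebra.Orthogonal.JB (Fin l) ℂ), gramInv_mul_gram, mul_one,
      mul_assoc (gramInv l), ← mul_assoc _ (gramInv l), gram_mul_gramInv, one_mul, neg_sub]⟩
  map_add' X Y := by
    ext1
    change X + Y - _ = (X - _) + (Y - _)
    simp only [transpose_add, mul_add, add_mul]
    abel
  map_smul' c X := by
    ext1
    simp [smul_sub]

theorem skewPart_val (X : Matrix (Idx l) (Idx l) ℂ) :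
    (skewPart X).1 = X - gramInv l * Xᵀ * gram l := rfl

theorem skewPart_coe (A : Alg l) : skewPart A.1 = (2 : ℂ) • A := by
  ext1
  rw [skewPart_val, gramInv_mul_transpose_mul_gram, sub_neg_eq_add, ← two_smul ℂ]
  rfl

theorem coe_lie (A B : Alg l) : (⁅A, B⁆ : Alg l).1 = A.1 * B.1 - B.1 * A.1 := rfl

theorem lie_skewPart (A : Alg l) (X : Matrix (Idx l) (Idx l) ℂ) :
    ⁅A, skewPart X⁆ = skewPart (A.1 * X - X * A.1) := by
  ext1
  rw [coe_lie, skewPart_val, skewPart_val]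
  have h1 : A.1 * (gramInv l * Xᵀ * gram l) = -(gramInv l * (X * A.1)ᵀ * gram l) := by
    rw [← mul_assoc, ← mul_assoc, mul_gramInv, transpose_mul]
    simp [mul_assoc]
  have h2 : gramInv l * Xᵀ * gram l * A.1 = -(gramInv l * (A.1 * X)ᵀ * gram l) := by
    rw [mul_assoc _ (gram l), gram_mul, transpose_mul]
    simp [mul_assoc]
  rw [mul_sub, sub_mul, h1, h2, transpose_sub, mul_sub, sub_mul]
  abel

/-- The elements `E_{pq} - J⁻¹ E_{qp} J` spanning `𝔰𝔬(2l+1)`. -/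
noncomputable def gen (p q : Idx l) : Alg l := skewPart (Matrix.single p q 1)

theorem skewPart_eq_sum (X : Matrix (Idx l) (Idx l) ℂ) :
    skewPart X = ∑ p, ∑ q, X p q • gen p q := by
  conv_lhs => rw [matrix_eq_sum_single X]
  simp only [map_sum, gen, ← map_smul, smul_single, smul_eq_mul, mul_one]

/-- `skewPart` doubles a skew-adjoint matrix, whence the factor 1/2. The generators are redundant:
up to a scalar, `gen p q` and `gen (bar q) (bar p)` agree. -/
theorem eq_sum_gen (A : Alg l) : A = (1 / 2 : ℂ) • ∑ p, ∑ q, A.1 p q • gen p q := by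
  rw [← skewPart_eq_sum, skewPart_coe, smul_smul]
  norm_num

theorem gen_apply (p q r s : Idx l) :
    (gen p q).1 r s = (if p = r ∧ q = s then 1 else 0) - gramInv l r q * gram l p s := by
  rw [gen, skewPart_val, transpose_single, Matrix.sub_apply, single_apply, mul_assoc,
    single_mul_eq_updateRow_zero, mul_apply]
  simp [updateRow_apply]

theorem lie_gen (A : Alg l) (p q : Idx l) :
    ⁅A, gen p q⁆ = ∑ r, A.1 r p • gen r q - ∑ r, A.1 q r • gen p r := by
  rw [gen, lie_skewPart, map_sub, skewPart_eq_sum, skewPart_eq_sum]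
  congr 1
  · refine Finset.sum_congr rfl fun r _ => ?_
    rw [Finset.sum_eq_single q]
    · simp
    · intro s _ hs
      simp [mul_single_apply_of_ne _ _ _ _ _ hs]
    · simp
  · rw [Finset.sum_eq_single p]
    · simp
    · intro s _ hs
      simp [single_mul_apply_of_ne _ _ _ _ _ hs]
    · simp

theorem trace_matrix_end (T : Module.End ℂ (Matrix (Idx l) (Idx l) ℂ)) :
    LinearMap.trace ℂ _ T = ∑ p, ∑ q, T (Matrix.single p q 1) p q := by
  rw [LinearMap.trace_eq_matrix_trace ℂ (Matrix.stdBasis ℂ (Idx l) (Idx l)), Matrix.trace,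
    Fintype.sum_prod_type]
  refine Finset.sum_congr rfl fun p _ => Finset.sum_congr rfl fun q _ => ?_
  rw [diag_apply, LinearMap.toMatrix_apply, Matrix.stdBasis_eq_single]
  rfl

/-- The left side is the trace of X ↦ P (skewPart X) Q on all matrices, the shape of each term in
the expansion of ad A ∘ ad B. -/
theorem sum_mul_skewPart_mul (P Q : Matrix (Idx l) (Idx l) ℂ) :
    ∑ p, ∑ q, (P * (gen p q).1 * Q : Matrix (Idx l) (Idx l) ℂ) p q = trace P * trace Q -
      trace (P * gramInv l * Qᵀ * gram l) := by
  have key : ∀ p q, (P * (gen p q).1 * Q : Matrix (Idx l) (Idx l) ℂ) p q = P p p * Q q q -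
      (P * gramInv l) p q * (gram l * Q) p q := by
    intro p q
    rw [gen, skewPart_val, transpose_single, mul_sub, sub_mul, Matrix.sub_apply]
    congr 1
    · rw [mul_assoc, single_mul_eq_updateRow_zero, mul_apply]
      simp [updateRow_apply]
    · rw [mul_assoc, mul_assoc (gramInv l * _), mul_assoc (gramInv l), ← mul_assoc P,
        single_mul_eq_updateRow_zero, mul_apply]
      simp [updateRow_apply]
  simp only [key, Finset.sum_sub_distrib]
  congr 1
  · rw [trace, trace, Finset.sum_mul_sum]
    rfl
  · have : P * gramInv l * Qᵀ * gram l = P * gramInv l * (gram l * Q)ᵀ := by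
      rw [transpose_mul, JB_transpose, mul_assoc]
    rw [this, trace]
    simp only [diag_apply, mul_apply (M := P * gramInv l), transpose_apply]

theorem trace_mul_gen (A : Alg l) (p q : Idx l) : trace (A.1 * (gen p q).1) = 2 * A.1 q p := by
  rw [gen, skewPart_val, mul_sub, transpose_single, trace_sub, ← mul_assoc, ← mul_assoc,
    mul_gramInv, trace_mul_comm _ (gram l)]
  simp only [neg_mul, mul_neg, trace_neg]
  rw [← mul_assoc, ← mul_assoc, gram_mul_gramInv, one_mul, trace_mul_single, trace_mul_single]
  simp
  ring

/-- The operator `X ↦ A X - X A` on matrices. -/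
def commutatorEnd (A : Matrix (Idx l) (Idx l) ℂ) : Module.End ℂ (Matrix (Idx l) (Idx l) ℂ) :=
  LinearMap.mulLeft ℂ A - LinearMap.mulRight ℂ A

theorem commutatorEnd_apply (A X : Matrix (Idx l) (Idx l) ℂ) :
    commutatorEnd A X = A * X - X * A := rfl

/-- Half of `skewPart` projects matrices onto the Lie algebra, so ad A ∘ ad B is the compression of
a product of matrix commutators. Cyclicity moves the trace to the full matrix space, where it is a
sum over matrix units. -/
theorem killingForm_eq (A B : Alg l) :
    killingForm ℂ (Alg l) A B = (2 * l - 1) * trace (A.1 * B.1) := by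
  have h1 : LieAlgebra.ad ℂ (Alg l) A ∘ₗ LieAlgebra.ad ℂ (Alg l) B = (1 / 2 : ℂ) •
      (skewPart ∘ₗ ((commutatorEnd A.1 ∘ₗ commutatorEnd B.1) ∘ₗ
        (LieAlgebra.Orthogonal.typeB (Fin l) ℂ).toSubmodule.subtype)) := by
    ext1 z
    have hz : z = (1 / 2 : ℂ) • skewPart z.1 := by
      rw [skewPart_coe, smul_smul]
      norm_num
    conv_lhs => rw [hz]
    simp only [map_smul, LinearMap.smul_apply, LinearMap.comp_apply, LieAlgebra.ad_apply,
      lie_skewPart, commutatorEnd_apply]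
    rfl
  have h2 : killingForm ℂ (Alg l) A B =
      LinearMap.trace ℂ _ (LieAlgebra.ad ℂ (Alg l) A ∘ₗ LieAlgebra.ad ℂ (Alg l) B) := rfl
  rw [h2, h1, map_smul, LinearMap.trace_comp_comm', trace_matrix_end]
  have h3 : ∀ p q, (((commutatorEnd A.1 ∘ₗ commutatorEnd B.1) ∘ₗ
      (LieAlgebra.Orthogonal.typeB (Fin l) ℂ).toSubmodule.subtype) ∘ₗ skewPart)
        (Matrix.single p q 1) p q =
      ((A.1 * B.1) * (gen p q).1 * 1 : Matrix (Idx l) (Idx l) ℂ) p q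
        - (A.1 * (gen p q).1 * B.1 : Matrix (Idx l) (Idx l) ℂ) p q
        - (B.1 * (gen p q).1 * A.1 : Matrix (Idx l) (Idx l) ℂ) p q
        + (1 * (gen p q).1 * (B.1 * A.1) : Matrix (Idx l) (Idx l) ℂ) p q := by
    intro p q
    change (commutatorEnd A.1 (commutatorEnd B.1 (gen p q).1)) p q = _
    simp only [commutatorEnd_apply, mul_sub, sub_mul, Matrix.sub_apply, mul_one, one_mul, mul_assoc]
    ring
  have e1 : trace (A.1 * gramInv l * B.1ᵀ * gram l) = - trace (A.1 * B.1) := by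
    rw [mul_assoc, mul_assoc, ← mul_assoc (gramInv l), gramInv_mul_transpose_mul_gram, mul_neg,
      trace_neg]
  have e2 : trace (B.1 * gramInv l * A.1ᵀ * gram l) = - trace (A.1 * B.1) := by
    rw [mul_assoc, mul_assoc, ← mul_assoc (gramInv l), gramInv_mul_transpose_mul_gram, mul_neg,
      trace_neg, trace_mul_comm]
  have e3 : trace (A.1 * B.1 * gramInv l * 1ᵀ * gram l) = trace (A.1 * B.1) := by
    rw [transpose_one, mul_one, mul_assoc, gramInv_mul_gram, mul_one]
  have e4 : trace (1 * gramInv l * (B.1 * A.1)ᵀ * gram l) = trace (A.1 * B.1) := by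
    rw [one_mul, transpose_mul, mul_assoc, mul_assoc, transpose_mul_gram, mul_neg,
      ← mul_assoc (A.1ᵀ), transpose_mul_gram, neg_mul, neg_neg, ← mul_assoc, ← mul_assoc,
      gramInv_mul_gram, one_mul]
  simp only [h3, Finset.sum_add_distrib, Finset.sum_sub_distrib, sum_mul_skewPart_mul]
  rw [e1, e2, e3, e4, trace_eq_zero, trace_mul_comm B.1 A.1, trace_one, smul_eq_mul]
  simp
  ring

/-- The Killing form with `gen p q` reads off 2(2l-1) times the entry (q, p), so the families `gen p
q` and `gen q p` act as dual frames. The redundancy of the generators contributes the remaining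
factor 2. -/
theorem tensorCasimir_eq (V W : Type*) [AddCommGroup V] [Module ℂ V] [LieRingModule (Alg l) V]
    [LieModule ℂ (Alg l) V] [AddCommGroup W] [Module ℂ W] [LieRingModule (Alg l) W]
    [LieModule ℂ (Alg l) W] :
    ((4 * (2 * l - 1) : ℂ)) • tensorCasimir ℂ (Alg l) V W =
      ∑ p : Idx l, ∑ q : Idx l, TensorProduct.map (LieModule.toEnd ℂ (Alg l) V (gen p q))
        (LieModule.toEnd ℂ (Alg l) W (gen q p)) := by
  set b := Module.finBasis ℂ (Alg l)
  set d := LinearMap.BilinForm.dualBasis (killingForm ℂ (Alg l))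
    (LieAlgebra.IsKilling.killingForm_nondegenerate ℂ (Alg l)) b with hd
  let f : Alg l →ₗ[ℂ] Alg l →ₗ[ℂ] (V ⊗[ℂ] W →ₗ[ℂ] V ⊗[ℂ] W) := LinearMap.mk₂ ℂ
    (fun x y => TensorProduct.map (LieModule.toEnd ℂ (Alg l) V x) (LieModule.toEnd ℂ (Alg l) W y))
    (fun _ _ _ => by rw [map_add, TensorProduct.map_add_left])
    (fun _ _ _ => by rw [map_smul, TensorProduct.map_smul_left])
    (fun _ _ _ => by rw [map_add, TensorProduct.map_add_right])
    (fun _ _ _ => by rw [map_smul, TensorProduct.map_smul_right])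
  change (4 * (2 * l - 1) : ℂ) • ∑ i, f (b i) (d i) = ∑ p, ∑ q, f (gen p q) (gen q p)
  have h1 : ∀ z : Alg l, (4 * (2 * l - 1) : ℂ) • z =
      ∑ p, ∑ q, killingForm ℂ (Alg l) z (gen p q) • gen q p := by
    intro z
    conv_lhs => rw [eq_sum_gen z]
    rw [Finset.sum_comm, smul_smul, Finset.smul_sum]
    refine Finset.sum_congr rfl fun q _ => ?_
    rw [Finset.smul_sum]
    refine Finset.sum_congr rfl fun p _ => ?_
    rw [killingForm_eq, trace_mul_gen, smul_smul]
    congr 1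
    ring
  have h2 : ∀ y : Alg l, ∑ i, killingForm ℂ (Alg l) (d i) y • b i = y := by
    intro y
    conv_rhs => rw [← b.sum_repr y]
    refine Finset.sum_congr rfl fun i _ => ?_
    congr 1
    conv_lhs => rw [← b.sum_repr y]
    simp only [hd, map_sum, map_smul, LinearMap.BilinForm.apply_dualBasis_left, smul_eq_mul,
      mul_ite, mul_one, mul_zero, Finset.sum_ite_eq', Finset.mem_univ, if_true]
  calc (4 * (2 * l - 1) : ℂ) • ∑ i, f (b i) (d i)
      = ∑ i, ∑ p, ∑ q, killingForm ℂ (Alg l) (d i) (gen p q) • f (b i) (gen q p) := by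
        rw [Finset.smul_sum]
        refine Finset.sum_congr rfl fun i _ => ?_
        rw [← map_smul, h1]
        simp only [map_sum, map_smul]
    _ = ∑ p, ∑ q, ∑ i, killingForm ℂ (Alg l) (d i) (gen p q) • f (b i) (gen q p) := by
        rw [Finset.sum_comm]
        refine Finset.sum_congr rfl fun p _ => ?_
        rw [Finset.sum_comm]
    _ = _ := by
        refine Finset.sum_congr rfl fun p _ => Finset.sum_congr rfl fun q _ => ?_
        conv_rhs => rw [← h2 (gen p q)]
        simp [LinearMap.sum_apply]

end MatrixModel

end TypeB

namespace TypeB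

open Matrix

/-! ### Weights of the standard representation and root vectors -/

section Weights

variable {l : ℕ}

/-- The weights of the standard basis vectors of the standard representation. -/
def wt : Idx l → Fin l → ℂ :=
  Sum.elim 0 (Sum.elim (fun i => Pi.single i 1) (fun i => -Pi.single i 1))

/-- The involution of the index set pairing opposite weights. -/
def bar : Idx l → Idx l := Sum.elim Sum.inl (Sum.elim (Sum.inr ∘ Sum.inr) (Sum.inr ∘ Sum.inl))

/-- A height function ordering the weights of the standard representation. -/
def ht : Idx l → ℤ := Sum.elim 0 (Sum.elim (fun i => l - i.val) (fun i => -(l - i.val)))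

@[simp] theorem wt_zero (u : Unit) : wt (l := l) (.inl u) = 0 := rfl
@[simp] theorem wt_pos (i : Fin l) : wt (.inr (.inl i)) = Pi.single i 1 := rfl
@[simp] theorem wt_neg (i : Fin l) : wt (.inr (.inr i)) = -Pi.single i 1 := rfl
@[simp] theorem ht_zero (u : Unit) : ht (l := l) (.inl u) = 0 := rfl
@[simp] theorem ht_pos (i : Fin l) : ht (.inr (.inl i)) = l - i.val := rfl
@[simp] theorem ht_neg (i : Fin l) : ht (.inr (.inr i)) = -(l - i.val) := rfl
@[simp] theorem bar_zero (u : Unit) : bar (l := l) (.inl u) = .inl u := rfl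
@[simp] theorem bar_pos (i : Fin l) : bar (.inr (.inl i)) = .inr (.inr i) := rfl
@[simp] theorem bar_neg (i : Fin l) : bar (.inr (.inr i)) = .inr (.inl i) := rfl

/-- The height as a dominant regular coweight. -/
def htCoweight (l : ℕ) : Fin l → ℂ := fun i => l - i.val

theorem wt_dotProduct_htCoweight (p : Idx l) : wt p ⬝ᵥ htCoweight l = (ht p : ℂ) := by
  rcases p with p | p | p <;> simp [htCoweight]

theorem ht_injective : Function.Injective (ht (l := l)) := by
  intro p q h
  rcases p with p | p | p <;> rcases q with q | q | q <;> simp at h ⊢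
  all_goals omega

theorem cartan_val (a : Fin l → ℂ) : (cartan a).1 = diagonal (fun p => wt p ⬝ᵥ a) := by
  change diagonal (Sum.elim 0 (Sum.elim a (-a))) = _
  refine congrArg diagonal (funext fun p => ?_)
  rcases p with p | p | p <;> simp

theorem lie_cartan_gen (a : Fin l → ℂ) (p q : Idx l) :
    ⁅cartan a, gen p q⁆ = ((wt p - wt q) ⬝ᵥ a) • gen p q := by
  rw [lie_gen, cartan_val]
  simp only [diagonal_apply, ite_smul, zero_smul, Finset.sum_ite_eq, Finset.sum_ite_eq',
    Finset.mem_univ, if_true, sub_dotProduct, sub_smul]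

theorem gen_bar (p : Idx l) (hp : p ≠ .inl ()) : gen p (bar p) = 0 := by
  ext r s
  rw [gen_apply]
  rcases p with p | p | p
  · exact absurd rfl hp
  all_goals
    rcases r with r | r | r <;> rcases s with s | s | s <;>
    simp [gramInv, gram, LieAlgebra.Orthogonal.JB, LieAlgebra.Orthogonal.JD, Matrix.one_apply]
  all_goals grind

theorem gen_diag (p : Idx l) : gen p p = cartan (wt p) := by
  ext r s
  rw [gen_apply]
  rcases p with p | p | p <;> rcases r with r | r | r <;> rcases s with s | s | s <;>
    simp [cartan, gramInv, gram, LieAlgebra.Orthogonal.JB, LieAlgebra.Orthogonal.JD,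
      Matrix.one_apply, diagonal_apply, Pi.single_apply]
  all_goals grind

theorem gram_eq_zero {p q : Idx l} (h : q ≠ bar p) : gram l p q = 0 := by
  rcases p with p | p | p <;> rcases q with q | q | q <;>
    simp [gram, LieAlgebra.Orthogonal.JB, LieAlgebra.Orthogonal.JD, Matrix.one_apply] at h ⊢
  all_goals grind

theorem gramInv_eq_zero {p q : Idx l} (h : q ≠ bar p) : gramInv l p q = 0 := by
  rcases p with p | p | p <;> rcases q with q | q | q <;>
    simp [gramInv, LieAlgebra.Orthogonal.JD, Matrix.one_apply] at h ⊢
  all_goals grind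

/-- For q ≠ bar p the form entries at (p, q) vanish, which removes all correction terms and leaves
`gen p p - gen q q`. -/
theorem lie_gen_gen_swap {p q : Idx l} (h : q ≠ bar p) :
    ⁅gen p q, gen q p⁆ = cartan (wt p) - cartan (wt q) := by
  rw [lie_gen, ← gen_diag, ← gen_diag]
  simp only [gen_apply, gram_eq_zero h, gramInv_eq_zero h, mul_zero, zero_mul, sub_zero]
  simp [ite_smul]

theorem wt_sub_mem_positiveRoots {p q : Idx l} (h : ht q < ht p) (hb : q ≠ bar p) :
    wt p - wt q ∈ positiveRoots l := by
  rcases p with p | p | p <;> rcases q with q | q | q <;> simp at h hb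
  · have := q.isLt; omega
  · exact Or.inl ⟨q, by simp⟩
  · exact Or.inl ⟨p, by simp⟩
  · exact Or.inr ⟨p, q, Fin.lt_def.2 (by omega), Or.inl (by simp)⟩
  · rcases lt_or_gt_of_ne hb with h' | h'
    · exact Or.inr ⟨q, p, h', Or.inr (by simp [add_comm])⟩
    · exact Or.inr ⟨p, q, h', Or.inr (by simp)⟩
  · have := p.isLt; omega
  · have := p.isLt; have := q.isLt; omega
  · exact Or.inr ⟨q, p, Fin.lt_def.2 (by omega), Or.inl (by simp; abel)⟩

theorem ht_lt_of_positiveRoot {p q : Idx l} {α : Fin l → ℂ} (hα : α ∈ positiveRoots l)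
    (h : ∀ a, (wt p - wt q) ⬝ᵥ a = α ⬝ᵥ a) : ht q < ht p := by
  have h1 := h (htCoweight l)
  rw [sub_dotProduct, wt_dotProduct_htCoweight, wt_dotProduct_htCoweight] at h1
  have hc : ∀ k : Fin l, htCoweight l k = ((l - k.val : ℤ) : ℂ) := fun k => by simp [htCoweight]
  rcases hα with ⟨i, rfl⟩ | ⟨i, j, hij, rfl | rfl⟩
  · rw [single_one_dotProduct, hc] at h1
    have : ht p - ht q = l - i.val := by exact_mod_cast h1
    omega
  · rw [sub_dotProduct, single_one_dotProduct, single_one_dotProduct, hc, hc] at h1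
    have : ht p - ht q = (l - i.val) - (l - j.val) := by exact_mod_cast h1
    have := Fin.lt_def.1 hij
    omega
  · rw [add_dotProduct, single_one_dotProduct, single_one_dotProduct, hc, hc] at h1
    have : ht p - ht q = (l - i.val) + (l - j.val) := by exact_mod_cast h1
    omega

theorem wt_sub_dotProduct_of_entry_ne_zero {α : Fin l → ℂ} {x : Alg l}
    (hx : ∀ a : Fin l → ℂ, ⁅cartan a, x⁆ = (α ⬝ᵥ a) • x) {p q : Idx l} (hpq : x.1 p q ≠ 0)
    (a : Fin l → ℂ) : (wt p - wt q) ⬝ᵥ a = α ⬝ᵥ a := by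
  have h1 := congrArg (fun y : Alg l => y.1 p q) (hx a)
  simp only [coe_lie, cartan_val] at h1
  change (diagonal (fun p => wt p ⬝ᵥ a) * x.1 - x.1 * diagonal (fun p => wt p ⬝ᵥ a)) p q =
    (α ⬝ᵥ a) * x.1 p q at h1
  rw [Matrix.sub_apply, diagonal_mul, mul_diagonal] at h1
  rw [sub_dotProduct]
  apply mul_right_cancel₀ hpq
  linear_combination h1

end Weights

/-! ### Weight spaces and the Casimir operator -/

section Modules

variable {l : ℕ} {M : Type*} [AddCommGroup M] [Module ℂ M] [LieRingModule (Alg l) M]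
  [LieModule ℂ (Alg l) M]

variable (M) in
/-- The subspace of vectors on which the Cartan subalgebra acts through `ζ`. -/
def weightSub (ζ : Fin l → ℂ) : Submodule ℂ M where
  carrier := {m | ∀ a : Fin l → ℂ, ⁅cartan a, m⁆ = (ζ ⬝ᵥ a) • m}
  add_mem' := fun hx hy a => by rw [lie_add, hx a, hy a, smul_add]
  zero_mem' := fun a => by simp
  smul_mem' := fun c x hx a => by rw [lie_smul, hx a, smul_comm]

theorem mem_weightSub {ζ : Fin l → ℂ} {m : M} :
    m ∈ weightSub M ζ ↔ ∀ a : Fin l → ℂ, ⁅cartan a, m⁆ = (ζ ⬝ᵥ a) • m := Iff.rfl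

theorem gen_lie_mem_weightSub {ζ : Fin l → ℂ} {m : M} (hm : m ∈ weightSub M ζ) (p q : Idx l) :
    ⁅gen p q, m⁆ ∈ weightSub M (ζ + (wt p - wt q)) := by
  intro a
  rw [leibniz_lie, lie_cartan_gen, hm a, smul_lie, lie_smul, add_dotProduct, add_smul, add_comm]

/-- Every positive root vector is a combination of the `gen p q` at its nonzero entries, and such
entries have weight difference equal to the root, hence raise the height. Conversely `gen p q` with
decreasing height is a positive root vector or zero. -/
theorem isHighestWeightVector_iff {ζ : Fin l → ℂ} {v : M} :
    IsHighestWeightVector ζ v ↔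
      v ≠ 0 ∧ v ∈ weightSub M ζ ∧ ∀ p q : Idx l, ht q < ht p → ⁅gen p q, v⁆ = 0 := by
  constructor
  · intro h
    refine ⟨h.ne_zero, h.cartan_lie, fun p q hpq => ?_⟩
    by_cases hb : q = bar p
    · subst hb
      rw [gen_bar p, zero_lie]
      rintro rfl
      simp at hpq
    · exact h.root_lie _ (wt_sub_mem_positiveRoots hpq hb) _ fun a => lie_cartan_gen a p q
  · rintro ⟨h0, h1, h2⟩
    refine ⟨h0, h1, fun α hα x hx => ?_⟩
    rw [eq_sum_gen x, smul_lie, sum_lie, Finset.sum_eq_zero, smul_zero]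
    intro p _
    rw [sum_lie]
    refine Finset.sum_eq_zero fun q _ => ?_
    by_cases hpq : x.1 p q = 0
    · rw [hpq, zero_smul, zero_lie]
    · rw [smul_lie, h2 p q (ht_lt_of_positiveRoot hα (wt_sub_dotProduct_of_entry_ne_zero hx hpq)), smul_zero]

variable (M) in
/-- The Casimir operator, normalized by the generators `gen p q`. -/
noncomputable def casimir (l : ℕ) (M : Type*) [AddCommGroup M] [Module ℂ M]
    [LieRingModule (Alg l) M] [LieModule ℂ (Alg l) M] : Module.End ℂ M :=
  ∑ p : Idx l, ∑ q : Idx l, LieModule.toEnd ℂ (Alg l) M (gen p q) ∘ₗ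
    LieModule.toEnd ℂ (Alg l) M (gen q p)

theorem casimir_apply (m : M) :
    casimir l M m = ∑ p : Idx l, ∑ q : Idx l, ⁅gen p q, ⁅gen q p, m⁆⁆ := by
  simp [casimir, LinearMap.sum_apply]

/-- Moving A through the double sum produces four sums, which cancel in pairs after the summation
indices are renamed. -/
theorem casimir_lie (A : Alg l) (m : M) : casimir l M ⁅A, m⁆ = ⁅A, casimir l M m⁆ := by
  have h : ⁅A, casimir l M m⁆ - casimir l M ⁅A, m⁆ =
      ∑ p : Idx l, ∑ q : Idx l, (⁅⁅A, gen p q⁆, ⁅gen q p, m⁆⁆ + ⁅gen p q, ⁅⁅A, gen q p⁆, m⁆⁆) := by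
    simp only [casimir_apply, lie_sum, ← Finset.sum_sub_distrib]
    refine Finset.sum_congr rfl fun p _ => Finset.sum_congr rfl fun q _ => ?_
    rw [leibniz_lie A, leibniz_lie A (gen q p), lie_add]
    abel
  rw [eq_comm, ← sub_eq_zero, h]
  simp only [lie_gen, sub_lie, lie_sub, sum_lie, lie_sum, smul_lie, lie_smul,
    Finset.sum_add_distrib, Finset.sum_sub_distrib]
  have e1 : ∑ p : Idx l, ∑ q : Idx l, ∑ r : Idx l, A.1 r p • ⁅gen r q, ⁅gen q p, m⁆⁆ =
      ∑ p : Idx l, ∑ q : Idx l, ∑ r : Idx l, A.1 p r • ⁅gen p q, ⁅gen q r, m⁆⁆ := by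
    rw [Finset.sum_comm]
    conv_rhs => rw [Finset.sum_comm]
    refine Finset.sum_congr rfl fun q _ => ?_
    rw [Finset.sum_comm]
  have e2 : ∑ p : Idx l, ∑ q : Idx l, ∑ r : Idx l, A.1 q r • ⁅gen p r, ⁅gen q p, m⁆⁆ =
      ∑ p : Idx l, ∑ q : Idx l, ∑ r : Idx l, A.1 r q • ⁅gen p q, ⁅gen r p, m⁆⁆ := by
    refine Finset.sum_congr rfl fun p _ => ?_
    rw [Finset.sum_comm]
  rw [e1, e2]
  abel

/-- The eigenvalue of the Casimir operator on a highest weight vector. -/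
noncomputable def casimirScalar (ζ : Fin l → ℂ) : ℂ :=
  ∑ i, 2 * ζ i * (ζ i + 2 * (l - i.val - 1 / 2))

/-- The first sum is 2(ζ, ζ). The pairs in the second run twice through the positive roots, so it
equals 2(ζ, 2ρ). -/
theorem sum_heights_eq_casimirScalar (ζ : Fin l → ℂ) :
    ∑ p : Idx l, (ζ ⬝ᵥ wt p) ^ 2 + ∑ p : Idx l, ∑ q : Idx l,
      (if ht q < ht p then (if q = bar p then 0 else ζ ⬝ᵥ (wt p - wt q)) else 0) =
    casimirScalar ζ := by
  have h1 : ∀ i : Fin l, (0 : ℤ) < l - i.val := fun i => by omega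
  have h2 : ∀ i : Fin l, ¬ (l - i.val : ℤ) < 0 := fun i => by omega
  have h3 : ∀ i j : Fin l, (l - i.val : ℤ) < l - j.val ↔ j < i := fun i j => by
    rw [Fin.lt_def]; omega
  have h4 : ∀ i j : Fin l, -(l - i.val : ℤ) < l - j.val := fun i j => by omega
  have h5 : ∀ i j : Fin l, ¬ (l - i.val : ℤ) < -(l - j.val) := fun i j => by omega
  have h6 : ∀ i j : Fin l, -(l - i.val : ℤ) < -(l - j.val) ↔ i < j := fun i j => by
    rw [Fin.lt_def]; omega
  have h7 : ∀ i : Fin l, -(l - i.val : ℤ) < 0 := fun i => by omega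
  have h8 : ∀ i : Fin l, ¬ (0 : ℤ) < -(l - i.val) := fun i => by omega
  simp only [Fintype.sum_sum_type, Finset.univ_unique, Finset.sum_singleton, wt_zero, wt_pos,
    wt_neg, ht_zero, ht_pos, ht_neg, bar_zero, bar_pos, bar_neg, h1, h2, h3, h4, h5, h6, h7, h8,
    dotProduct_zero, dotProduct_neg, dotProduct_sub, dotProduct_single_one, if_true, if_false,
    reduceCtorEq, Sum.inr.injEq, Sum.inl.injEq, lt_irrefl, Finset.sum_const_zero]
  have hgt : ∀ i : Fin l, (Finset.univ.filter fun j : Fin l => i < j).card = l - 1 - i.val := by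
    intro i
    rw [← Fin.card_Ioi]
    congr 1
    ext j
    simp
  have hlt : ∀ i : Fin l, (Finset.univ.filter fun j : Fin l => j < i).card = i.val := by
    intro i
    rw [← Fin.card_Iio]
    congr 1
    ext j
    simp
  have e1 : ∀ f : Fin l → ℂ, ∑ i : Fin l, ∑ j : Fin l, (if i < j then f i else 0) =
      ∑ i : Fin l, (l - 1 - i.val) * f i := by
    intro f
    refine Finset.sum_congr rfl fun i _ => ?_
    have hc : ((l - 1 - i.val : ℕ) : ℂ) = l - 1 - i.val := by
      rw [Nat.sub_sub, Nat.cast_sub (by omega)]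
      push_cast
      ring
    rw [← Finset.sum_filter, Finset.sum_const, hgt, nsmul_eq_mul, hc]
  have e2 : ∀ f : Fin l → ℂ, ∑ i : Fin l, ∑ j : Fin l, (if i < j then f j else 0) =
      ∑ i : Fin l, i.val * f i := by
    intro f
    rw [Finset.sum_comm]
    refine Finset.sum_congr rfl fun i _ => ?_
    rw [← Finset.sum_filter, Finset.sum_const, hlt, nsmul_eq_mul]
  have e3 : ∑ i : Fin l, ∑ j : Fin l, (if i < j then ζ i - ζ j else 0) =
      ∑ i : Fin l, (l - 1 - 2 * i.val) * ζ i := by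
    have : ∀ i j : Fin l, (if i < j then ζ i - ζ j else 0) =
        (if i < j then ζ i else 0) - (if i < j then ζ j else 0) := by
      intro i j
      split_ifs <;> simp
    simp only [this, Finset.sum_sub_distrib, e1, e2]
    rw [← Finset.sum_sub_distrib]
    exact Finset.sum_congr rfl fun i _ => by ring
  have e4 : ∑ i : Fin l, ∑ j : Fin l, (if j < i then -ζ i - -ζ j else 0) =
      ∑ i : Fin l, (l - 1 - 2 * i.val) * ζ i := by
    rw [← e3, Finset.sum_comm]
    refine Finset.sum_congr rfl fun i _ => Finset.sum_congr rfl fun j _ => ?_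
    split_ifs <;> ring
  have e5 : ∑ i : Fin l, ∑ j : Fin l, (if j = i then 0 else ζ i - -ζ j) =
      ∑ i : Fin l, 2 * (l - 1) * ζ i := by
    have : ∀ i j : Fin l, (if j = i then 0 else ζ i - -ζ j) =
        ζ i + ζ j - (if j = i then 2 * ζ i else 0) := by
      intro i j
      split_ifs with h
      · rw [h]; ring
      · ring
    simp only [this, Finset.sum_sub_distrib, Finset.sum_add_distrib, Finset.sum_ite_eq',
      Finset.mem_univ, if_true, Finset.sum_const, Finset.card_univ, Fintype.card_fin,
      nsmul_eq_mul, ← Finset.mul_sum]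
    ring
  simp only [Finset.sum_add_distrib, zero_add, e3, e4, e5, casimirScalar]
  simp only [← Finset.sum_add_distrib, zero_pow two_ne_zero, zero_add]
  exact Finset.sum_congr rfl fun i _ => by ring

/-- Normal ordering: each raising operator is moved to the right of its lowering partner, and the
commutators, which lie in the Cartan subalgebra, contribute the 2ρ shift. -/
theorem casimir_of_mem_weightSub {ζ : Fin l → ℂ} {m : M} (hm : m ∈ weightSub M ζ) :
    casimir l M m = casimirScalar ζ • m + ∑ p : Idx l, ∑ q : Idx l,
      (if ht q < ht p then (2 : ℂ) • ⁅gen q p, ⁅gen p q, m⁆⁆ else 0) := by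
  set f : Idx l → Idx l → M := fun p q => ⁅gen p q, ⁅gen q p, m⁆⁆ with hf
  have hsplit : ∀ p q, f p q = (if p = q then f p q else 0) + (if ht q < ht p then f p q else 0) +
      (if ht p < ht q then f p q else 0) := by
    intro p q
    rcases lt_trichotomy (ht p) (ht q) with h | h | h
    · have : p ≠ q := fun e => by simp [e] at h
      simp [h, h.not_gt, this]
    · have : p = q := ht_injective h
      simp [this]
    · have : p ≠ q := fun e => by simp [e] at h
      simp [h, h.not_gt, this]
  have hdiag : ∀ p, f p p = (ζ ⬝ᵥ wt p) ^ 2 • m := by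
    intro p
    rw [hf]
    simp only [gen_diag, hm (wt p), lie_smul, smul_smul, sq]
  have hswap : ∀ p q, ht q < ht p → f p q = f q p +
      (if q = bar p then 0 else ζ ⬝ᵥ (wt p - wt q)) • m := by
    intro p q hpq
    simp only [hf]
    rw [leibniz_lie (gen p q)]
    split_ifs with hb
    · subst hb
      rw [gen_bar p (by rintro rfl; simp at hpq)]
      simp
    · rw [lie_gen_gen_swap hb, sub_lie, hm, hm, ← sub_smul, dotProduct_sub, add_comm]
  have h3 : ∑ p, ∑ q, (if ht p < ht q then f p q else 0) =
      ∑ p, ∑ q, (if ht q < ht p then f q p else 0) := Finset.sum_comm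
  rw [casimir_apply]
  change ∑ p, ∑ q, f p q = _ + ∑ p, ∑ q, if ht q < ht p then (2 : ℂ) • f q p else 0
  rw [← sum_heights_eq_casimirScalar, add_smul, Finset.sum_smul, Finset.sum_smul, add_assoc]
  calc ∑ p, ∑ q, f p q = ∑ p, f p p + (∑ p, ∑ q, (if ht q < ht p then f p q else 0) +
        ∑ p, ∑ q, (if ht p < ht q then f p q else 0)) := by
        conv_lhs => enter [2, p, 2, q]; rw [hsplit p q]
        simp only [Finset.sum_add_distrib, Finset.sum_ite_eq, Finset.mem_univ, if_true, add_assoc]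
    _ = _ := by
        rw [h3]
        refine congrArg₂ (· + ·) (Finset.sum_congr rfl fun p _ => hdiag p) ?_
        · rw [← Finset.sum_add_distrib, ← Finset.sum_add_distrib]
          refine Finset.sum_congr rfl fun p _ => ?_
          rw [Finset.sum_smul, ← Finset.sum_add_distrib, ← Finset.sum_add_distrib]
          refine Finset.sum_congr rfl fun q _ => ?_
          by_cases hpq : ht q < ht p
          · simp only [hpq, if_true]
            rw [hswap p q hpq, two_smul]
            abel
          · simp [hpq]

end Modules

end TypeB

namespace TypeB

open Matrix

/-! ### Real coweights that order the weights -/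

section Pairing

variable {l : ℕ}

/-- The real part of the pairing of a weight with a real coweight. -/
def rePair (g : Fin l → ℝ) (ζ : Fin l → ℂ) : ℝ := ∑ i, g i * (ζ i).re

theorem rePair_eq_re (g : Fin l → ℝ) (ζ : Fin l → ℂ) :
    rePair g ζ = (ζ ⬝ᵥ fun i => (g i : ℂ)).re := by
  simp [rePair, dotProduct, Complex.re_sum, mul_comm]

theorem rePair_add (g : Fin l → ℝ) (ζ η : Fin l → ℂ) :
    rePair g (ζ + η) = rePair g ζ + rePair g η := by
  simp [rePair, mul_add, Finset.sum_add_distrib]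

theorem rePair_neg (g : Fin l → ℝ) (ζ : Fin l → ℂ) : rePair g (-ζ) = -rePair g ζ := by
  simp [rePair]

/-- Real coweights that are positive on the positive roots. -/
def IsRegularDominant (g : Fin l → ℝ) : Prop := ∀ α ∈ positiveRoots l, 0 < rePair g α

theorem rePair_single (g : Fin l → ℝ) (i : Fin l) : rePair g (Pi.single i 1) = g i := by
  rw [rePair, Finset.sum_eq_single i]
  · simp
  · intro j _ hj
    simp [hj]
  · simp

theorem isRegularDominant_of_lt {g : Fin l → ℝ} (h0 : ∀ i, 0 < g i)
    (h1 : ∀ i j, i < j → g j < g i) : IsRegularDominant g := by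
  rintro α (⟨i, rfl⟩ | ⟨i, j, hij, rfl | rfl⟩)
  · rw [rePair_single]; exact h0 i
  · rw [sub_eq_add_neg, rePair_add, rePair_neg, rePair_single, rePair_single]
    linarith [h1 i j hij]
  · rw [rePair_add, rePair_single, rePair_single]
    linarith [h0 i, h0 j]

theorem exists_isRegularDominant (l : ℕ) : ∃ g : Fin l → ℝ, IsRegularDominant g := by
  refine ⟨fun i => l - i.val, isRegularDominant_of_lt (fun i => ?_) (fun i j hij => ?_)⟩
  · have := i.isLt
    rify at this
    linarith
  · have := Fin.lt_def.1 hij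
    rify at this
    linarith

end Pairing

/-! ### Highest weight theory for finite-dimensional modules -/

section HighestWeight

variable {l : ℕ} {M : Type*} [AddCommGroup M] [Module ℂ M] [LieRingModule (Alg l) M]
  [LieModule ℂ (Alg l) M]

theorem cartan_eq_sum (a : Fin l → ℂ) : cartan a = ∑ i, a i • cartan (Pi.single i 1) := by
  have hadd : ∀ a b : Fin l → ℂ, cartan (a + b) = cartan a + cartan b := by
    intro a b
    ext1
    change (cartan (a + b)).1 = (cartan a).1 + (cartan b).1
    simp only [cartan_val, diagonal_add, dotProduct_add]
  have hsmul : ∀ (c : ℂ) (a : Fin l → ℂ), cartan (c • a) = c • cartan a := by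
    intro c a
    ext1
    change (cartan (c • a)).1 = c • (cartan a).1
    rw [cartan_val, cartan_val, ← diagonal_smul]
    congr 1
    ext p
    simp
  let f : (Fin l → ℂ) →ₗ[ℂ] Alg l := ⟨⟨cartan, hadd⟩, hsmul⟩
  change f a = ∑ i, a i • f (Pi.single i 1)
  simp only [← map_smul, ← map_sum]
  congr 1
  ext j
  simp [Finset.sum_apply, Pi.single_apply]

theorem lie_cartan_cartan (a b : Fin l → ℂ) : ⁅cartan a, cartan b⁆ = 0 := by
  ext1
  rw [coe_lie, cartan_val, cartan_val, diagonal_mul_diagonal, diagonal_mul_diagonal]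
  simp [mul_comm]

omit [Module ℂ M] [LieModule ℂ (Alg l) M] in
theorem lie_cartan_comm (a b : Fin l → ℂ) (m : M) :
    ⁅cartan a, ⁅cartan b, m⁆⁆ = ⁅cartan b, ⁅cartan a, m⁆⁆ := by
  rw [leibniz_lie, lie_cartan_cartan, zero_lie, zero_add]

/-- One coordinate direction at a time, N is cut down to an eigenspace; since the Cartan subalgebra
acts by commuting operators, each eigenspace remains stable. -/
theorem exists_weight_vector [Module.Finite ℂ M] (N : Submodule ℂ M) (hN : N ≠ ⊥)
    (hst : ∀ a, ∀ m ∈ N, ⁅(cartan a : Alg l), m⁆ ∈ N) :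
    ∃ ζ : Fin l → ℂ, ∃ m ∈ N, m ≠ 0 ∧ m ∈ weightSub M ζ := by
  have key : ∀ s : Finset (Fin l), ∃ ζ : Fin l → ℂ, ∃ N' : Submodule ℂ M, N' ≤ N ∧ N' ≠ ⊥ ∧
      (∀ a, ∀ m ∈ N', ⁅(cartan a : Alg l), m⁆ ∈ N') ∧
      ∀ i ∈ s, ∀ m ∈ N', ⁅(cartan (Pi.single i 1) : Alg l), m⁆ = ζ i • m := by
    intro s
    induction s using Finset.induction_on with
    | empty => exact ⟨0, N, le_rfl, hN, hst, by simp⟩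
    | insert i s hi ih =>
      obtain ⟨ζ, N', h1, h2, h3, h4⟩ := ih
      let T : Module.End ℂ N' :=
        (LieModule.toEnd ℂ (Alg l) M (cartan (Pi.single i 1))).restrict (h3 _)
      have : Nontrivial N' := Submodule.nontrivial_iff_ne_bot.2 h2
      obtain ⟨c, hc⟩ := Module.End.exists_eigenvalue T
      obtain ⟨v, hv⟩ := hc.exists_hasEigenvector
      have hv1 : ⁅(cartan (Pi.single i 1) : Alg l), v.1⁆ = c • v.1 :=
        congrArg Subtype.val hv.apply_eq_smul
      refine ⟨Function.update ζ i c,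
        N' ⊓ LinearMap.ker (LieModule.toEnd ℂ (Alg l) M (cartan (Pi.single i 1)) - c • 1),
        inf_le_left.trans h1, ?_, ?_, ?_⟩
      · intro hbot
        apply hv.2
        have : v.1 ∈ (⊥ : Submodule ℂ M) := by
          rw [← hbot]
          refine ⟨v.2, ?_⟩
          simp [hv1]
        exact Subtype.ext (by simpa using this)
      · rintro a m ⟨hm1, hm2⟩
        refine ⟨h3 a m hm1, ?_⟩
        simp only [SetLike.mem_coe, LinearMap.mem_ker, LinearMap.sub_apply,
          LieModule.toEnd_apply_apply, LinearMap.smul_apply, Module.End.one_apply,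
          sub_eq_zero] at hm2 ⊢
        rw [lie_cartan_comm, hm2, lie_smul]
      · rintro j hj m ⟨hm1, hm2⟩
        simp only [SetLike.mem_coe, LinearMap.mem_ker, LinearMap.sub_apply,
          LieModule.toEnd_apply_apply, LinearMap.smul_apply, Module.End.one_apply,
          sub_eq_zero] at hm2
        by_cases hji : j = i
        · subst hji
          simpa using hm2
        · rw [Function.update_of_ne hji]
          exact h4 j ((Finset.mem_insert.1 hj).resolve_left hji) m hm1
  obtain ⟨ζ, N', h1, h2, -, h4⟩ := key Finset.univ
  obtain ⟨m, hm, hm0⟩ := Submodule.exists_mem_ne_zero_of_ne_bot h2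
  refine ⟨ζ, m, h1 hm, hm0, fun a => ?_⟩
  rw [cartan_eq_sum, sum_lie, dotProduct, Finset.sum_smul]
  refine Finset.sum_congr rfl fun i _ => ?_
  rw [smul_lie, h4 i (Finset.mem_univ i) m hm, smul_smul, mul_comm]

theorem rePair_wt_sub_pos {g : Fin l → ℝ} (hg : IsRegularDominant g) {p q : Idx l}
    (h : ht q < ht p) (h0 : gen p q ≠ 0) : 0 < rePair g (wt p - wt q) := by
  refine hg _ (wt_sub_mem_positiveRoots h ?_)
  rintro rfl
  refine h0 (gen_bar p ?_)
  rintro rfl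
  simp at h

theorem mem_eigenspace_of_mem_weightSub {ζ : Fin l → ℂ} {m : M} (hm : m ∈ weightSub M ζ)
    (a : Fin l → ℂ) : m ∈ (LieModule.toEnd ℂ (Alg l) M (cartan a)).eigenspace (ζ ⬝ᵥ a) := by
  rw [Module.End.mem_eigenspace_iff]
  exact hm a

/-- The values of g on weights of N are real parts of eigenvalues of a single Cartan element, so
there are finitely many. A weight vector at the maximal value is killed by raising operators, since
these strictly increase the value. -/
theorem exists_highestWeightVector_ge [Module.Finite ℂ M] {g : Fin l → ℝ}
    (hg : IsRegularDominant g) (N : Submodule ℂ M)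
    (hst : ∀ p q : Idx l, ht q < ht p → ∀ m ∈ N, ⁅gen p q, m⁆ ∈ N) {ζ : Fin l → ℂ} {y : M}
    (hyN : y ∈ N) (hy0 : y ≠ 0) (hy : y ∈ weightSub M ζ) :
    ∃ ζ' : Fin l → ℂ, ∃ x ∈ N, IsHighestWeightVector ζ' x ∧ rePair g ζ ≤ rePair g ζ' := by
  let S : Set ℝ := {r | ∃ ζ' : Fin l → ℂ, ∃ x ∈ N, x ≠ 0 ∧ x ∈ weightSub M ζ' ∧ rePair g ζ' = r}
  have hfin : S.Finite := by
    refine ((Module.End.finite_hasEigenvalue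
      (LieModule.toEnd ℂ (Alg l) M (cartan fun i => (g i : ℂ)))).image Complex.re).subset ?_
    rintro r ⟨ζ', x, -, hx0, hx, rfl⟩
    exact ⟨_, Module.End.hasEigenvalue_of_hasEigenvector
      ⟨mem_eigenspace_of_mem_weightSub hx _, hx0⟩, (rePair_eq_re g ζ').symm⟩
  obtain ⟨r, ⟨ζ', x, hxN, hx0, hx, rfl⟩, hmax⟩ :=
    Set.exists_max_image S id hfin ⟨_, ζ, y, hyN, hy0, hy, rfl⟩
  refine ⟨ζ', x, hxN, isHighestWeightVector_iff.2 ⟨hx0, hx, fun p q hpq => ?_⟩,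
    hmax _ ⟨ζ, y, hyN, hy0, hy, rfl⟩⟩
  by_contra hne
  have h0 : gen p q ≠ 0 := by
    intro h
    rw [h, zero_lie] at hne
    exact hne rfl
  have h1 := hmax _ ⟨_, _, hst p q hpq x hxN, hne, gen_lie_mem_weightSub hx p q, rfl⟩
  have h2 := rePair_wt_sub_pos hg hpq h0
  rw [id, id, rePair_add] at h1
  linarith

theorem exists_highestWeightVector [Module.Finite ℂ M] (N : LieSubmodule ℂ (Alg l) M)
    (hN : N ≠ ⊥) : ∃ ζ : Fin l → ℂ, ∃ x ∈ N, IsHighestWeightVector ζ x := by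
  obtain ⟨g, hg⟩ := exists_isRegularDominant l
  obtain ⟨ζ, y, hyN, hy0, hy⟩ := exists_weight_vector (N : Submodule ℂ M) (by simpa using hN)
    fun a m hm => N.lie_mem hm
  obtain ⟨ζ', x, hx, h, -⟩ := exists_highestWeightVector_ge hg (N : Submodule ℂ M)
    (fun p q _ m hm => N.lie_mem hm) hyN hy0 hy
  exact ⟨ζ', x, hx, h⟩

/-- The vectors obtained from `u` by applying lowering generators. -/
inductive IsLowered (u : M) : M → Prop
  | base : IsLowered u u
  | step {m : M} (p q : Idx l) (h : ht p < ht q) (hm : IsLowered u m) : IsLowered u ⁅gen p q, m⁆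

theorem lie_mem_of_gen_lie_mem (T : Submodule ℂ M) {m : M}
    (h : ∀ p q : Idx l, ⁅gen p q, m⁆ ∈ T) (A : Alg l) : ⁅A, m⁆ ∈ T := by
  rw [eq_sum_gen A, smul_lie, sum_lie]
  refine T.smul_mem _ (T.sum_mem fun p _ => ?_)
  rw [sum_lie]
  refine T.sum_mem fun q _ => ?_
  rw [smul_lie]
  exact T.smul_mem _ (h p q)

/-- This takes the place of the Poincaré–Birkhoff–Witt theorem. The span is stable under every A by
induction on the number of lowering steps: A moves past the last one at the cost of a bracket acting
on a shorter word. -/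
theorem mem_span_isLowered {ζ : Fin l → ℂ} {u : M} (hu : IsHighestWeightVector ζ u) {x : M}
    (hx : x ∈ LieSubmodule.lieSpan ℂ (Alg l) {u}) :
    x ∈ Submodule.span ℂ {m | IsLowered (l := l) u m} := by
  obtain ⟨-, hw, hr⟩ := isHighestWeightVector_iff.1 hu
  set T := Submodule.span ℂ {m | IsLowered (l := l) u m} with hT
  have hlow : ∀ p q : Idx l, ht p < ht q → ∀ m ∈ T, ⁅gen p q, m⁆ ∈ T := by
    intro p q hpq m hm
    induction hm using Submodule.span_induction with
    | mem m hm => exact Submodule.subset_span (IsLowered.step p q hpq hm)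
    | zero => simp
    | add x y _ _ hx hy => rw [lie_add]; exact T.add_mem hx hy
    | smul c x _ hx => rw [lie_smul]; exact T.smul_mem c hx
  have hall : ∀ m, IsLowered (l := l) u m → ∀ p q : Idx l, ⁅gen p q, m⁆ ∈ T := by
    intro m hm
    induction hm with
    | base =>
      intro p q
      rcases lt_trichotomy (ht p) (ht q) with h | h | h
      · exact hlow p q h u (Submodule.subset_span .base)
      · obtain rfl := ht_injective h
        rw [gen_diag, hw]
        exact T.smul_mem _ (Submodule.subset_span .base)
      · rw [hr p q h]
        exact T.zero_mem
    | step r s hrs hm ih =>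
      intro p q
      rw [leibniz_lie]
      exact T.add_mem (lie_mem_of_gen_lie_mem T ih _) (hlow r s hrs _ (ih p q))
  let N : LieSubmodule ℂ (Alg l) M :=
    { T with
      lie_mem := by
        intro A m hm
        change m ∈ T at hm
        change ⁅A, m⁆ ∈ T
        induction hm using Submodule.span_induction with
        | mem m hm => exact lie_mem_of_gen_lie_mem T (hall m hm) A
        | zero => simp
        | add x y _ _ hx hy => rw [lie_add]; exact T.add_mem hx hy
        | smul c x _ hx => rw [lie_smul]; exact T.smul_mem c hx }
  have : LieSubmodule.lieSpan ℂ (Alg l) {u} ≤ N := by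
    rw [LieSubmodule.lieSpan_le, Set.singleton_subset_iff]
    exact Submodule.subset_span (s := {m | IsLowered (l := l) u m}) .base
  exact this hx

theorem IsLowered.mem_weightSub {g : Fin l → ℝ} (hg : IsRegularDominant g) {ζ : Fin l → ℂ} {u : M}
    (hu : u ∈ weightSub M ζ) {m : M} (hm : IsLowered (l := l) u m) :
    m = u ∨ m = 0 ∨ ∃ ζ' : Fin l → ℂ, m ∈ weightSub M ζ' ∧ rePair g ζ' < rePair g ζ := by
  induction hm with
  | base => exact Or.inl rfl
  | step p q hpq hm ih =>
    by_cases hb : p = bar q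
    · right; left
      have hq : q = bar p := by
        subst hb
        rcases q with q | q | q <;> rfl
      subst hq
      rw [gen_bar p, zero_lie]
      rintro rfl
      simp at hpq
    · have h1 := hg _ (wt_sub_mem_positiveRoots hpq hb)
      have h2 : rePair g (wt p - wt q) = -rePair g (wt q - wt p) := by
        rw [← rePair_neg, neg_sub]
      have h3 : ∀ ζ', rePair g ζ' ≤ rePair g ζ → rePair g (ζ' + (wt p - wt q)) < rePair g ζ := by
        intro ζ' h
        rw [rePair_add, h2]
        linarith
      rcases ih with rfl | rfl | ⟨ζ', hm', hlt⟩
      · exact Or.inr (Or.inr ⟨_, gen_lie_mem_weightSub hu p q, h3 _ le_rfl⟩)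
      · exact Or.inr (Or.inl (lie_zero _))
      · exact Or.inr (Or.inr ⟨_, gen_lie_mem_weightSub hm' p q, h3 _ hlt.le⟩)

theorem disjoint_eigenspace_iSup (f : Module.End ℂ M) {Λ : Set ℂ} {μ : ℂ} (hμ : μ ∉ Λ) :
    Disjoint (f.eigenspace μ) (⨆ ν ∈ Λ, f.eigenspace ν) := by
  refine (f.eigenspaces_iSupIndep μ).mono_right (iSup₂_le fun ν hν => ?_)
  exact le_iSup₂_of_le ν (fun h => hμ (h ▸ hν)) le_rfl

/-- Lowering strictly decreases the value of g, so the cyclic module is the line of u plus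
eigenspaces of the Cartan element g whose eigenvalues have smaller real part. Independence of
eigenspaces then locates x. -/
theorem eq_smul_or_rePair_lt {g : Fin l → ℝ} (hg : IsRegularDominant g) {ζ ζ' : Fin l → ℂ}
    {u x : M} (hu : IsHighestWeightVector ζ u) (hx : x ∈ LieSubmodule.lieSpan ℂ (Alg l) {u})
    (hx0 : x ≠ 0) (hxw : x ∈ weightSub M ζ') :
    (∃ c : ℂ, x = c • u) ∨ rePair g ζ' < rePair g ζ := by
  have huw : u ∈ weightSub M ζ := hu.cartan_lie
  set f := LieModule.toEnd ℂ (Alg l) M (cartan fun i => (g i : ℂ)) with hf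
  set Λ : Set ℂ := {μ | μ.re < rePair g ζ} with hΛ
  have hdec : x ∈ Submodule.span ℂ {u} ⊔ ⨆ μ ∈ Λ, f.eigenspace μ := by
    refine Submodule.span_le.2 ?_ (mem_span_isLowered hu hx)
    intro m hm
    rcases IsLowered.mem_weightSub hg huw hm with rfl | rfl | ⟨η, hm', hlt⟩
    · exact Submodule.mem_sup_left (Submodule.mem_span_singleton_self _)
    · exact Submodule.zero_mem _
    · refine Submodule.mem_sup_right ?_
      refine Submodule.mem_iSup_of_mem _ (Submodule.mem_iSup_of_mem ?_
        (mem_eigenspace_of_mem_weightSub hm' _))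
      rw [hΛ, Set.mem_ofPred_eq, ← rePair_eq_re]
      exact hlt
  obtain ⟨_, hy, z, hz, rfl⟩ := Submodule.mem_sup.1 hdec
  obtain ⟨c, rfl⟩ := Submodule.mem_span_singleton.1 hy
  rw [or_iff_not_imp_right]
  intro hnot
  have hxe := mem_eigenspace_of_mem_weightSub hxw fun i => (g i : ℂ)
  have hue := mem_eigenspace_of_mem_weightSub huw fun i => (g i : ℂ)
  have hnotΛ : (ζ' ⬝ᵥ fun i => (g i : ℂ)) ∉ Λ := by
    rw [hΛ, Set.mem_ofPred_eq, ← rePair_eq_re]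
    exact hnot
  by_cases heq : (ζ' ⬝ᵥ fun i => (g i : ℂ)) = ζ ⬝ᵥ fun i => (g i : ℂ)
  · refine ⟨c, ?_⟩
    rw [heq] at hxe hnotΛ
    have hze : z ∈ f.eigenspace (ζ ⬝ᵥ fun i => (g i : ℂ)) := by
      have := Submodule.sub_mem _ hxe (Submodule.smul_mem _ c hue)
      rwa [add_sub_cancel_left] at this
    rw [Submodule.disjoint_def.1 (disjoint_eigenspace_iSup f hnotΛ) z hze hz, add_zero]
  · exfalso
    apply hx0
    -- If the eigenvalue of x is neither that of u nor one of the smaller ones, then x lies in an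
    -- eigenspace independent of the whole decomposition and is zero.
    have hnot' : (ζ' ⬝ᵥ fun i => (g i : ℂ)) ∉ insert (ζ ⬝ᵥ fun i => (g i : ℂ)) Λ := by
      rw [Set.mem_insert_iff]
      exact not_or.2 ⟨heq, hnotΛ⟩
    refine Submodule.disjoint_def.1 (disjoint_eigenspace_iSup f hnot') _ hxe ?_
    rw [iSup_insert]
    exact Submodule.add_mem _ (Submodule.mem_sup_left (Submodule.smul_mem _ c hue))
      (Submodule.mem_sup_right hz)

theorem weight_unique {ζ ζ' : Fin l → ℂ} {x : M} (hx0 : x ≠ 0) (h : x ∈ weightSub M ζ)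
    (h' : x ∈ weightSub M ζ') : ζ = ζ' := by
  ext i
  have := (h (Pi.single i 1)).symm.trans (h' (Pi.single i 1))
  rw [dotProduct_single_one, dotProduct_single_one] at this
  exact smul_left_injective ℂ hx0 this

/-- Each of the two vectors generates the irreducible module, and the strict alternative of
`eq_smul_or_rePair_lt` cannot hold in both directions. -/
theorem highestWeight_eq_and_eq_smul [LieModule.IsIrreducible ℂ (Alg l) M] {ζ ζ' : Fin l → ℂ}
    {u x : M} (hu : IsHighestWeightVector ζ u) (hx : IsHighestWeightVector ζ' x) :
    ζ' = ζ ∧ ∃ c : ℂ, x = c • u := by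
  obtain ⟨g, hg⟩ := exists_isRegularDominant l
  have htop : ∀ y : M, y ≠ 0 → LieSubmodule.lieSpan ℂ (Alg l) {y} = ⊤ := by
    intro y hy
    refine (IsSimpleOrder.eq_bot_or_eq_top _).resolve_left fun h => hy ?_
    rw [LieSubmodule.lieSpan_eq_bot_iff] at h
    exact h y rfl
  have h1 := eq_smul_or_rePair_lt hg hu (htop u hu.ne_zero ▸ LieSubmodule.mem_top x) hx.ne_zero
    hx.cartan_lie
  have h2 := eq_smul_or_rePair_lt hg hx (htop x hx.ne_zero ▸ LieSubmodule.mem_top u) hu.ne_zero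
    hu.cartan_lie
  have hc : ∃ c : ℂ, x = c • u := by
    rcases h1 with h1 | h1
    · exact h1
    · rcases h2 with ⟨c, hc⟩ | h2
      · have hc0 : c ≠ 0 := by
          rintro rfl
          exact hu.ne_zero (by rw [hc, zero_smul])
        exact ⟨c⁻¹, by rw [hc, smul_smul, inv_mul_cancel₀ hc0, one_smul]⟩
      · exact absurd h1 h2.not_gt
  refine ⟨?_, hc⟩
  obtain ⟨c, rfl⟩ := hc
  exact weight_unique hx.ne_zero hx.cartan_lie
    ((weightSub M ζ).smul_mem c (hu.cartan_lie : u ∈ weightSub M ζ))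

/-- Integrality for the sl₂-triple of the root wt p - wt q, whose squared length N fixes the
rescaling by 2 / N. -/
theorem exists_nat_of_isHighestWeightVector [Module.Finite ℂ M] {ζ : Fin l → ℂ} {u : M}
    (hu : IsHighestWeightVector ζ u) {p q : Idx l} (hpq : ht q < ht p) (hb : q ≠ bar p)
    {N : ℂ} (hN : (wt p - wt q) ⬝ᵥ (wt p - wt q) = N) (hN0 : N ≠ 0) :
    ∃ n : ℕ, ζ ⬝ᵥ (wt p - wt q) = N / 2 * n := by
  obtain ⟨h0, hw, hr⟩ := isHighestWeightVector_iff.1 hu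
  set h := cartan (wt p) - cartan (wt q) with hh
  have hlie : ∀ r s : Idx l, ⁅h, gen r s⁆ = ((wt r - wt s) ⬝ᵥ (wt p - wt q)) • gen r s := by
    intro r s
    rw [hh, sub_lie, lie_cartan_gen, lie_cartan_gen, ← sub_smul, ← dotProduct_sub]
  have hlie' : ⁅h, gen q p⁆ = -(N • gen q p) := by
    rw [hlie, ← hN, ← neg_smul, ← neg_dotProduct, neg_sub]
  have hhu : ⁅h, u⁆ = (ζ ⬝ᵥ (wt p - wt q)) • u := by
    rw [hh, sub_lie, hw, hw, ← sub_smul, ← dotProduct_sub]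
  have t : IsSl2Triple ((2 / N) • h) (gen p q) ((2 / N) • gen q p) := by
    refine ⟨fun hz => ?_, ?_, ?_, ?_⟩
    · have h1 : h = 0 := (smul_eq_zero.1 hz).resolve_left (div_ne_zero two_ne_zero hN0)
      have h2 : ∀ r : Idx l, wt r ⬝ᵥ wt p - wt r ⬝ᵥ wt q = 0 := by
        intro r
        have := congrArg (fun A : Alg l => A.1 r r) h1
        simp only [hh] at this
        change (cartan (wt p)).1 r r - (cartan (wt q)).1 r r = 0 at this
        simpa only [cartan_val, diagonal_apply_eq] using this
      apply hN0
      rw [← hN, sub_dotProduct, dotProduct_sub, dotProduct_sub, h2, h2, sub_zero]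
    · rw [lie_smul, lie_gen_gen_swap hb]
    · rw [smul_lie, hlie, hN, smul_smul, div_mul_cancel₀ _ hN0, two_smul, two_smul]
    · rw [smul_lie, lie_smul, hlie', smul_neg, smul_neg, two_smul, ← two_smul ℂ, smul_smul,
        smul_smul, smul_smul]
      congr 2
      field_simp
  have hP : IsSl2Triple.HasPrimitiveVectorWith t u (2 / N * (ζ ⬝ᵥ (wt p - wt q))) :=
    ⟨h0, by rw [smul_lie, hhu, smul_smul], hr p q hpq⟩
  obtain ⟨n, hn⟩ := hP.exists_nat
  refine ⟨n, ?_⟩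
  rw [← hn]
  field_simp

/-- Real dominant weights. -/
structure IsRealDominant (ζ : Fin l → ℂ) : Prop where
  im_eq_zero : ∀ i, (ζ i).im = 0
  nonneg : ∀ i, 0 ≤ (ζ i).re
  antitone : ∀ i j, i < j → (ζ j).re ≤ (ζ i).re

theorem IsHighestWeightVector.isRealDominant [Module.Finite ℂ M] {ζ : Fin l → ℂ} {u : M}
    (hu : IsHighestWeightVector ζ u) : IsRealDominant ζ := by
  have h1 : ∀ i, ∃ n : ℕ, ζ i = 1 / 2 * n := by
    intro i
    have := exists_nat_of_isHighestWeightVector hu (p := .inr (.inl i)) (q := .inl ())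
      (by simp) (by simp) (N := 1) (by simp) one_ne_zero
    simpa using this
  have h2 : ∀ i j, i < j → ∃ n : ℕ, ζ i - ζ j = n := by
    intro i j hij
    have := exists_nat_of_isHighestWeightVector hu (p := .inr (.inl i)) (q := .inr (.inl j))
      (by simpa using hij) (by simp) (N := 2)
      (by simp [hij.ne, hij.ne']; norm_num) two_ne_zero
    simpa [dotProduct_sub] using this
  refine ⟨fun i => ?_, fun i => ?_, fun i j hij => ?_⟩
  · obtain ⟨n, hn⟩ := h1 i
    simp [hn]
  · obtain ⟨n, hn⟩ := h1 i
    simp [hn]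
  · obtain ⟨n, hn⟩ := h2 i j hij
    have := congrArg Complex.re hn
    rw [Complex.sub_re, Complex.natCast_re] at this
    have : (0 : ℝ) ≤ n := n.cast_nonneg
    linarith

/-- The Lie submodule on which the Casimir operator acts by `c`. -/
noncomputable def casimirEigen (l : ℕ) (M : Type*) [AddCommGroup M] [Module ℂ M]
    [LieRingModule (Alg l) M] [LieModule ℂ (Alg l) M] (c : ℂ) : LieSubmodule ℂ (Alg l) M :=
  { (casimir l M).eigenspace c with
    lie_mem := by
      intro A m hm
      change m ∈ (casimir l M).eigenspace c at hm
      change ⁅A, m⁆ ∈ (casimir l M).eigenspace c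
      rw [Module.End.mem_eigenspace_iff] at hm ⊢
      rw [casimir_lie, hm, lie_smul] }

theorem mem_casimirEigen {c : ℂ} {m : M} : m ∈ casimirEigen l M c ↔ casimir l M m = c • m :=
  Module.End.mem_eigenspace_iff

theorem IsHighestWeightVector.mem_casimirEigen {ζ : Fin l → ℂ} {u : M}
    (hu : IsHighestWeightVector ζ u) : u ∈ casimirEigen l M (casimirScalar ζ) := by
  obtain ⟨-, hw, hr⟩ := isHighestWeightVector_iff.1 hu
  rw [TypeB.mem_casimirEigen, casimir_of_mem_weightSub hw, Finset.sum_eq_zero, add_zero]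
  refine fun p _ => Finset.sum_eq_zero fun q _ => ?_
  split_ifs with h
  · rw [hr p q h, lie_zero, smul_zero]
  · rfl

/-- The Casimir operator is a scalar on a cyclic module. A submodule contains a highest weight
vector, of weight ζ say, and equality of scalars reads (ζ - ν, ζ + ν + 2ρ) = 0. As ζ + ν + 2ρ is
regular dominant, ζ cannot lie strictly below ν, so the submodule contains u. -/
theorem isIrreducible_of_lieSpan_eq_top [Module.Finite ℂ M] {ν : Fin l → ℂ} {u : M}
    (hu : IsHighestWeightVector ν u) (htop : LieSubmodule.lieSpan ℂ (Alg l) {u} = ⊤) :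
    LieModule.IsIrreducible ℂ (Alg l) M := by
  have : Nontrivial M := ⟨u, 0, hu.ne_zero⟩
  refine LieModule.IsIrreducible.mk fun N hN => ?_
  obtain ⟨ζ, x, hxN, hx⟩ := exists_highestWeightVector N hN
  have hcas : casimirEigen l M (casimirScalar ν) = ⊤ := by
    rw [eq_top_iff, ← htop, LieSubmodule.lieSpan_le, Set.singleton_subset_iff]
    exact hu.mem_casimirEigen
  have hc : casimirScalar ζ = casimirScalar ν := by
    have h1 := mem_casimirEigen.1 hx.mem_casimirEigen
    have h2 := mem_casimirEigen.1 (hcas ▸ LieSubmodule.mem_top x)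
    exact smul_left_injective ℂ hx.ne_zero (h1.symm.trans h2)
  have hζ := hx.isRealDominant
  have hν := hu.isRealDominant
  -- The coweight ν + ζ + 2ρ, for which equality of the Casimir scalars says that ζ and ν have the
  -- same value.
  set g : Fin l → ℝ := fun i => (ν i).re + (ζ i).re + 2 * (l - i.val - 1 / 2) with hgdef
  have hρ : ∀ i : Fin l, (i.val : ℝ) + 1 ≤ l := fun i => by exact_mod_cast i.isLt
  have hg : IsRegularDominant g := by
    refine isRegularDominant_of_lt (fun i => ?_) (fun i j hij => ?_)
    · have := hρ i
      have := hζ.nonneg i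
      have := hν.nonneg i
      simp only [hgdef]
      linarith
    · have h1 := hζ.antitone i j hij
      have h2 := hν.antitone i j hij
      have h3 : (i.val : ℝ) < j.val := by exact_mod_cast hij
      simp only [hgdef]
      linarith
  have hpair : rePair g ζ = rePair g ν := by
    have hreal : ∀ ξ : Fin l → ℂ, IsRealDominant ξ → (casimirScalar ξ).re =
        ∑ i : Fin l, 2 * (ξ i).re * ((ξ i).re + 2 * (l - i.val - 1 / 2)) := by
      intro ξ hξ
      rw [casimirScalar, Complex.re_sum]
      refine Finset.sum_congr rfl fun i _ => ?_
      have : ξ i = ((ξ i).re : ℂ) := Complex.ext rfl (by simp [hξ.im_eq_zero i])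
      have h2 : 2 * ξ i * (ξ i + 2 * (l - i.val - 1 / 2)) =
          ((2 * (ξ i).re * ((ξ i).re + 2 * (l - i.val - 1 / 2)) : ℝ) : ℂ) := by
        rw [this]
        push_cast
        rw [Complex.ofReal_re]
      rw [h2, Complex.ofReal_re]
    have h1 := congrArg Complex.re hc
    rw [hreal ζ hζ, hreal ν hν, ← sub_eq_zero, ← Finset.sum_sub_distrib] at h1
    rw [← sub_eq_zero, rePair, rePair, ← Finset.sum_sub_distrib]
    have h2 : ∑ i, (g i * (ζ i).re - g i * (ν i).re) = 1 / 2 * 0 := by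
      rw [← h1, Finset.mul_sum]
      refine Finset.sum_congr rfl fun i _ => ?_
      simp only [hgdef]
      ring
    rw [h2, mul_zero]
  rcases eq_smul_or_rePair_lt hg hu (htop ▸ LieSubmodule.mem_top x) hx.ne_zero hx.cartan_lie with
    ⟨c, rfl⟩ | hlt
  · have hc0 : c ≠ 0 := by
      rintro rfl
      exact hx.ne_zero (zero_smul _ _)
    have huN : u ∈ N := by
      have := N.smul_mem c⁻¹ hxN
      rwa [smul_smul, inv_mul_cancel₀ hc0, one_smul] at this
    rw [eq_top_iff, ← htop, LieSubmodule.lieSpan_le, Set.singleton_subset_iff]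
    exact huN
  · exact absurd hpair hlt.ne

theorem LieSubmodule_isHighestWeightVector_iff {N : LieSubmodule ℂ (Alg l) M} {ζ : Fin l → ℂ}
    {x : N} : IsHighestWeightVector ζ x ↔ IsHighestWeightVector ζ x.1 := by
  rw [isHighestWeightVector_iff, isHighestWeightVector_iff]
  simp only [mem_weightSub, ne_eq, Subtype.ext_iff, LieSubmodule.coe_bracket,
    ZeroMemClass.coe_zero, SetLike.val_smul]

theorem isIrreducibleOfHighestWeight_lieSpan [Module.Finite ℂ M] {ζ : Fin l → ℂ} {u : M}
    (hu : IsHighestWeightVector ζ u) :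
    IsIrreducibleOfHighestWeight (LieSubmodule.lieSpan ℂ (Alg l) {u}) ζ := by
  have humem : u ∈ LieSubmodule.lieSpan ℂ (Alg l) {u} := LieSubmodule.subset_lieSpan rfl
  have hu' : IsHighestWeightVector ζ
      (⟨u, humem⟩ : LieSubmodule.lieSpan ℂ (Alg l) {u}) :=
    LieSubmodule_isHighestWeightVector_iff.2 hu
  have hfin : Module.Finite ℂ (LieSubmodule.lieSpan ℂ (Alg l) {u}) :=
    inferInstanceAs (Module.Finite ℂ
      ((LieSubmodule.lieSpan ℂ (Alg l) {u}) : Submodule ℂ M))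
  refine ⟨hfin, isIrreducible_of_lieSpan_eq_top hu' ?_, _, hu'⟩
  rw [eq_top_iff]
  rintro ⟨x, hx⟩ -
  have hle : LieSubmodule.lieSpan ℂ (Alg l) {u} ≤ (LieSubmodule.lieSpan ℂ (Alg l)
      {(⟨u, humem⟩ : LieSubmodule.lieSpan ℂ (Alg l) {u})}).map
        (LieSubmodule.lieSpan ℂ (Alg l) {u}).incl := by
    rw [LieSubmodule.lieSpan_le, Set.singleton_subset_iff]
    exact ⟨⟨u, humem⟩, LieSubmodule.subset_lieSpan rfl, rfl⟩
  obtain ⟨y, hy, hyx⟩ := hle hx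
  have : y = ⟨x, hx⟩ := Subtype.ext hyx
  exact this ▸ hy

variable {M' : Type*} [AddCommGroup M'] [Module ℂ M'] [LieRingModule (Alg l) M']
  [LieModule ℂ (Alg l) M']

theorem isHighestWeightVector_map {ζ : Fin l → ℂ} {x : M} (hx : IsHighestWeightVector ζ x)
    (f : M →ₗ⁅ℂ, Alg l⁆ M') (hf : f x ≠ 0) : IsHighestWeightVector ζ (f x) := by
  refine ⟨hf, fun a => ?_, fun α hα y hy => ?_⟩
  · rw [← LieModuleHom.map_lie, hx.cartan_lie, map_smul]
  · rw [← LieModuleHom.map_lie, hx.root_lie α hα y hy, map_zero]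

theorem bijective_of_isIrreducible [LieModule.IsIrreducible ℂ (Alg l) M]
    [LieModule.IsIrreducible ℂ (Alg l) M'] (f : M →ₗ⁅ℂ, Alg l⁆ M') {x : M} (hx : f x ≠ 0) :
    Function.Bijective f := by
  constructor
  · rw [← LieModuleHom.ker_eq_bot]
    refine (IsSimpleOrder.eq_bot_or_eq_top f.ker).resolve_right fun h => hx ?_
    have : x ∈ f.ker := h ▸ LieSubmodule.mem_top x
    exact this
  · rw [← LieModuleHom.range_eq_top]
    refine (IsSimpleOrder.eq_bot_or_eq_top f.range).resolve_left fun h => hx ?_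
    have : f x ∈ f.range := (LieModuleHom.mem_range f _).2 ⟨x, rfl⟩
    rw [h] at this
    exact this

/-- The diagonal action on a product of two modules. -/
local instance prodLieRingModule : LieRingModule (Alg l) (M × M') where
  bracket A m := (⁅A, m.1⁆, ⁅A, m.2⁆)
  add_lie A B m := by simp
  lie_add A m m' := by simp
  leibniz_lie A B m := by simp

local instance prodLieModule : LieModule ℂ (Alg l) (M × M') where
  smul_lie c A m := Prod.ext (smul_lie c A m.1) (smul_lie c A m.2)
  lie_smul c A m := Prod.ext (lie_smul c A m.1) (lie_smul c A m.2)

omit [Module ℂ M] [LieModule ℂ (Alg l) M] [Module ℂ M'] [LieModule ℂ (Alg l) M'] in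
theorem prod_lie (A : Alg l) (m : M × M') : ⁅A, m⁆ = (⁅A, m.1⁆, ⁅A, m.2⁆) := rfl

/-- The pair (u, u') is a highest weight vector of the product, so it generates an irreducible
submodule. By Schur's lemma both projections are bijective on it, and it is the graph of the
isomorphism. -/
theorem exists_bijective_of_isIrreducibleOfHighestWeight {ζ : Fin l → ℂ}
    (h : IsIrreducibleOfHighestWeight M ζ) (h' : IsIrreducibleOfHighestWeight M' ζ) :
    ∃ f : M →ₗ⁅ℂ, Alg l⁆ M', Function.Bijective f := by
  have := h.finite
  have := h'.finite
  have := h.irreducible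
  have := h'.irreducible
  obtain ⟨u, hu⟩ := h.exists_highestWeightVector
  obtain ⟨u', hu'⟩ := h'.exists_highestWeightVector
  have huu : IsHighestWeightVector ζ (u, u') := by
    refine ⟨fun h0 => hu.ne_zero (congrArg Prod.fst h0), fun a => ?_, fun α hα y hy => ?_⟩
    · rw [prod_lie, hu.cartan_lie, hu'.cartan_lie]
      rfl
    · rw [prod_lie, hu.root_lie α hα y hy, hu'.root_lie α hα y hy]
      rfl
  set H := LieSubmodule.lieSpan ℂ (Alg l) {(u, u')} with hH
  have hmem : (u, u') ∈ H := LieSubmodule.subset_lieSpan rfl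
  have := (isIrreducibleOfHighestWeight_lieSpan huu).irreducible
  let p : H →ₗ⁅ℂ, Alg l⁆ M :=
    { LinearMap.fst ℂ M M' ∘ₗ (H : Submodule ℂ (M × M')).subtype with
      map_lie' := rfl }
  let p' : H →ₗ⁅ℂ, Alg l⁆ M' :=
    { LinearMap.snd ℂ M M' ∘ₗ (H : Submodule ℂ (M × M')).subtype with
      map_lie' := rfl }
  have hp : Function.Bijective p :=
    bijective_of_isIrreducible p (x := ⟨(u, u'), hmem⟩) hu.ne_zero
  have hp' : Function.Bijective p' :=
    bijective_of_isIrreducible p' (x := ⟨(u, u'), hmem⟩) hu'.ne_zero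
  let e : H ≃ₗ⁅ℂ, Alg l⁆ M :=
    { LinearEquiv.ofBijective (p : H →ₗ[ℂ] M) hp with map_lie' := p.map_lie' }
  exact ⟨p'.comp (e.symm : M →ₗ⁅ℂ, Alg l⁆ H), hp'.comp e.symm.toLinearEquiv.bijective⟩

end HighestWeight

end TypeB

namespace TypeB

open Matrix

/-! ### Sign vectors and their flips -/

section Signs

variable {l : ℕ}

/-- Change the `i`-th sign. -/
def flip (i : Fin l) (ε : Fin l → ℤˣ) : Fin l → ℤˣ := Function.update ε i (-ε i)

/-- The product of the signs before the `i`-th one. -/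
def signBefore (i : Fin l) (ε : Fin l → ℤˣ) : ℤˣ := ∏ j, if j < i then ε j else 1

theorem flip_apply_self (i : Fin l) (ε : Fin l → ℤˣ) : flip i ε i = -ε i := by
  simp [flip]

theorem flip_apply_of_ne {i j : Fin l} (h : j ≠ i) (ε : Fin l → ℤˣ) : flip i ε j = ε j := by
  simp [flip, h]

theorem flip_flip (i : Fin l) (ε : Fin l → ℤˣ) : flip i (flip i ε) = ε := by
  ext j
  by_cases h : j = i
  · subst h; rw [flip_apply_self, flip_apply_self, neg_neg]
  · rw [flip_apply_of_ne h, flip_apply_of_ne h]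

theorem flip_comm (i j : Fin l) (ε : Fin l → ℤˣ) : flip i (flip j ε) = flip j (flip i ε) := by
  by_cases hij : i = j
  · rw [hij]
  ext k
  by_cases h : k = i
  · subst h
    rw [flip_apply_self, flip_apply_of_ne hij, flip_apply_of_ne hij, flip_apply_self]
  · rw [flip_apply_of_ne h]
    by_cases h' : k = j
    · subst h'
      rw [flip_apply_self, flip_apply_self, flip_apply_of_ne h]
    · rw [flip_apply_of_ne h', flip_apply_of_ne h', flip_apply_of_ne h]

theorem prod_flip (i : Fin l) (ε : Fin l → ℤˣ) : ∏ j, flip i ε j = -∏ j, ε j := by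
  rw [← Finset.mul_prod_erase _ _ (Finset.mem_univ i), flip_apply_self,
    ← Finset.mul_prod_erase _ ε (Finset.mem_univ i), neg_mul]
  congr 2
  exact Finset.prod_congr rfl fun j hj => flip_apply_of_ne (Finset.ne_of_mem_erase hj) ε

theorem signBefore_flip_of_lt {i j : Fin l} (h : i < j) (ε : Fin l → ℤˣ) :
    signBefore j (flip i ε) = -signBefore j ε := by
  rw [signBefore, signBefore, ← Finset.mul_prod_erase _ _ (Finset.mem_univ i), if_pos h,
    flip_apply_self, ← Finset.mul_prod_erase _ (fun k => if k < j then ε k else 1)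
      (Finset.mem_univ i), if_pos h, neg_mul]
  congr 2
  exact Finset.prod_congr rfl fun k hk => by rw [flip_apply_of_ne (Finset.ne_of_mem_erase hk)]

theorem signBefore_flip_of_le {i j : Fin l} (h : j ≤ i) (ε : Fin l → ℤˣ) :
    signBefore j (flip i ε) = signBefore j ε := by
  refine Finset.prod_congr rfl fun k _ => ?_
  split_ifs with hk
  · rw [flip_apply_of_ne (hk.trans_le h).ne]
  · rfl

theorem units_mul_self_complex (u : ℤˣ) : ((u : ℤ) : ℂ) * ((u : ℤ) : ℂ) = 1 := by
  rcases Int.units_eq_one_or u with rfl | rfl <;> simp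

end Signs

/-! ### The spin module through Clifford operators -/

/-- The space of the spin module: functions on the set of signs. -/
def Spin (l : ℕ) : Type := (Fin l → ℤˣ) → ℂ

namespace Spin

variable {l : ℕ}

noncomputable instance : AddCommGroup (Spin l) := inferInstanceAs (AddCommGroup ((Fin l → ℤˣ) → ℂ))
noncomputable instance : Module ℂ (Spin l) := inferInstanceAs (Module ℂ ((Fin l → ℤˣ) → ℂ))
instance : Module.Finite ℂ (Spin l) := inferInstanceAs (Module.Finite ℂ ((Fin l → ℤˣ) → ℂ))

@[ext] theorem ext {s t : Spin l} (h : ∀ ε, s ε = t ε) : s = t := funext h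
@[simp] theorem add_apply (s t : Spin l) (ε : Fin l → ℤˣ) : (s + t) ε = s ε + t ε := rfl
@[simp] theorem zero_apply (ε : Fin l → ℤˣ) : (0 : Spin l) ε = 0 := rfl
@[simp] theorem neg_apply (s : Spin l) (ε : Fin l → ℤˣ) : (-s) ε = -s ε := rfl
@[simp] theorem sub_apply (s t : Spin l) (ε : Fin l → ℤˣ) : (s - t) ε = s ε - t ε := rfl
@[simp] theorem smul_apply (c : ℂ) (s : Spin l) (ε : Fin l → ℤˣ) : (c • s) ε = c * s ε := rfl

variable (l) in
/-- The evaluation functionals. -/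
noncomputable def coord (ε : Fin l → ℤˣ) : Spin l →ₗ[ℂ] ℂ := LinearMap.proj ε

@[simp] theorem coord_apply (ε : Fin l → ℤˣ) (s : Spin l) : coord l ε s = s ε := rfl

theorem sum_apply {ι : Type*} (t : Finset ι) (f : ι → Spin l) (ε : Fin l → ℤˣ) :
    (∑ i ∈ t, f i) ε = ∑ i ∈ t, f i ε := map_sum (coord l ε) f t

/-- The basis vectors. -/
noncomputable def delta (ε : Fin l → ℤˣ) : Spin l := fun ε' => if ε' = ε then 1 else 0

theorem delta_apply (ε ε' : Fin l → ℤˣ) : delta ε ε' = if ε' = ε then 1 else 0 := rfl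

theorem eq_sum_delta (s : Spin l) : s = ∑ ε, s ε • delta ε := by
  ext ε
  rw [sum_apply, Finset.sum_eq_single ε]
  · simp [delta_apply]
  · intro ε' _ h
    simp [delta_apply, h.symm]
  · simp

theorem delta_ne_zero (ε : Fin l → ℤˣ) : delta ε ≠ 0 := by
  intro h
  have := congrArg (fun s : Spin l => s ε) h
  simp [delta_apply] at this

/-- The fermionic operators: `shift 1 i` creates and `shift (-1) i` annihilates the sign `1` in
position `i`. -/
noncomputable def shift (σ : ℤˣ) (i : Fin l) : Module.End ℂ (Spin l) where
  toFun s := fun ε => if ε i = σ then ((signBefore i ε : ℤ) : ℂ) * s (flip i ε) else 0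
  map_add' s t := by
    ext ε
    change (if ε i = σ then _ * (s + t) _ else 0) = (if ε i = σ then _ else 0) +
      (if ε i = σ then _ else 0)
    rw [add_apply]
    split_ifs <;> ring
  map_smul' c s := by
    ext ε
    change (if ε i = σ then _ * (c • s) _ else 0) = c * (if ε i = σ then _ else 0)
    rw [smul_apply]
    split_ifs <;> ring

theorem shift_apply (σ : ℤˣ) (i : Fin l) (s : Spin l) (ε : Fin l → ℤˣ) :
    shift σ i s ε = if ε i = σ then ((signBefore i ε : ℤ) : ℂ) * s (flip i ε) else 0 := rfl

/-- The parity operator. -/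
noncomputable def parity (l : ℕ) : Module.End ℂ (Spin l) where
  toFun s := fun ε => (((∏ j, ε j : ℤˣ) : ℤ) : ℂ) * s ε
  map_add' s t := by
    ext ε
    exact mul_add _ _ _
  map_smul' c s := by
    ext ε
    exact mul_left_comm _ _ _

theorem parity_apply (s : Spin l) (ε : Fin l → ℤˣ) :
    parity l s ε = (((∏ j, ε j : ℤˣ) : ℤ) : ℂ) * s ε := rfl

theorem parity_mul_parity : parity l * parity l = 1 := by
  ext s ε
  rw [Module.End.mul_apply, parity_apply, parity_apply, ← mul_assoc, units_mul_self_complex, one_mul]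
  rfl

theorem parity_mul_shift (σ : ℤˣ) (i : Fin l) :
    parity l * shift σ i = -(shift σ i * parity l) := by
  ext s ε
  rw [LinearMap.neg_apply, neg_apply, Module.End.mul_apply, Module.End.mul_apply, parity_apply,
    shift_apply, shift_apply, parity_apply, prod_flip]
  split_ifs
  · push_cast
    ring
  · simp

theorem shift_mul_shift_self_apply (σ τ : ℤˣ) (i : Fin l) (s : Spin l) (ε : Fin l → ℤˣ) :
    (shift σ i * shift τ i) s ε = if ε i = σ ∧ τ = -σ then s ε else 0 := by
  rw [Module.End.mul_apply, shift_apply, shift_apply, flip_apply_self, flip_flip,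
    signBefore_flip_of_le le_rfl, mul_ite, ← mul_assoc, units_mul_self_complex]
  split_ifs with h1 h2 h3 <;> simp_all

theorem shift_anticomm_self (σ τ : ℤˣ) (i : Fin l) :
    shift σ i * shift τ i + shift τ i * shift σ i = if τ = -σ then 1 else 0 := by
  ext s ε
  rw [LinearMap.add_apply, add_apply, shift_mul_shift_self_apply, shift_mul_shift_self_apply]
  rcases Int.units_eq_one_or σ with rfl | rfl <;> rcases Int.units_eq_one_or τ with rfl | rfl <;>
    rcases Int.units_eq_one_or (ε i) with h | h <;> simp [h]

/-- The Jordan–Wigner sign: flipping the earlier position reverses `signBefore` at the later one,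
while flipping the later position leaves the earlier sign unchanged. -/
theorem shift_mul_shift {i j : Fin l} (hij : i ≠ j) (σ τ : ℤˣ) :
    shift σ i * shift τ j = -(shift τ j * shift σ i) := by
  ext s ε
  rw [LinearMap.neg_apply, neg_apply, Module.End.mul_apply, Module.End.mul_apply, shift_apply,
    shift_apply, shift_apply, shift_apply, flip_apply_of_ne hij.symm, flip_apply_of_ne hij,
    flip_comm i j]
  by_cases h1 : ε i = σ <;> by_cases h2 : ε j = τ <;> simp only [h1, h2, if_true, if_false]
  · rcases lt_or_gt_of_ne hij with h | h
    · rw [signBefore_flip_of_lt h, signBefore_flip_of_le h.le]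
      push_cast
      ring
    · rw [signBefore_flip_of_lt h, signBefore_flip_of_le h.le]
      push_cast
      ring
  all_goals simp

theorem shift_delta (σ : ℤˣ) (i : Fin l) (ε : Fin l → ℤˣ) :
    shift σ i (delta ε) =
      (if ε i = -σ then ((signBefore i ε : ℤ) : ℂ) else 0) • delta (flip i ε) := by
  ext ε'
  rw [shift_apply, smul_apply, delta_apply, delta_apply]
  by_cases h : ε' = flip i ε
  · subst h
    rw [flip_flip, flip_apply_self, signBefore_flip_of_le le_rfl]
    simp [neg_eq_iff_eq_neg]
  · have : flip i ε' ≠ ε := fun h' => h (by rw [← h', flip_flip])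
    simp [h, this]

/-- The gamma operators. -/
noncomputable def gamma : Idx l → Module.End ℂ (Spin l) :=
  Sum.elim (fun _ => parity l) (Sum.elim (shift 1) (shift (-1)))

/-- The gamma operators of the dual basis. -/
noncomputable def gammaDual : Idx l → Module.End ℂ (Spin l) :=
  Sum.elim (fun _ => (1 / 2 : ℂ) • parity l) (Sum.elim (shift (-1)) (shift 1))

/-- These are the Clifford relations of the form. The parity operator anticommutes with all shifts
and squares to 1, which accounts for the Gram entry 2. -/
theorem gamma_anticomm (p q : Idx l) : gamma p * gamma q + gamma q * gamma p = gram l p q • 1 := by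
  have hu : ∀ σ : ℤˣ, σ ≠ -σ := by decide
  rcases p with p | p | p <;> rcases q with q | q | q <;>
    simp only [gamma, Sum.elim_inl, Sum.elim_inr, gram, LieAlgebra.Orthogonal.JB,
      LieAlgebra.Orthogonal.JD, fromBlocks_apply₁₁, fromBlocks_apply₁₂, fromBlocks_apply₂₁,
      fromBlocks_apply₂₂, Matrix.zero_apply, zero_smul, parity_mul_shift, neg_add_cancel,
      add_neg_cancel, parity_mul_parity]
  · rw [← two_smul ℂ]
    simp
  all_goals
    by_cases h : p = q
    · subst h
      rw [shift_anticomm_self]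
      simp [hu]
    · rw [shift_mul_shift h]
      simp [h]

theorem gamma_eq_sum (p : Idx l) : gamma p = ∑ q, gram l p q • gammaDual q := by
  rcases p with p | p | p <;>
    simp [gamma, gammaDual, gram, LieAlgebra.Orthogonal.JB, LieAlgebra.Orthogonal.JD,
      Matrix.one_apply]

theorem gammaDual_eq_sum (p : Idx l) : gammaDual p = ∑ q, gramInv l p q • gamma q := by
  rcases p with p | p | p <;>
    simp [gamma, gammaDual, gramInv, LieAlgebra.Orthogonal.JD, Matrix.one_apply]

theorem gamma_gammaDual_anticomm (p q : Idx l) :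
    gamma p * gammaDual q + gammaDual q * gamma p = if p = q then 1 else 0 := by
  have h : ∑ r, gramInv l q r * gram l p r = if p = q then 1 else 0 := by
    have := congrFun (congrFun (gramInv_mul_gram l) q) p
    rw [mul_apply, Matrix.one_apply] at this
    rw [eq_comm] at this
    simp only [eq_comm (a := q)] at this
    rw [this]
    refine Finset.sum_congr rfl fun r _ => ?_
    exact congrArg _ (congrFun (congrFun (JB_transpose l) r) p)
  rw [gammaDual_eq_sum, Finset.mul_sum, Finset.sum_mul, ← Finset.sum_add_distrib]
  simp only [mul_smul_comm, smul_mul_assoc, ← smul_add, gamma_anticomm, smul_smul]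
  rw [← Finset.sum_smul, h]
  split_ifs <;> simp

/-- The spin representation. -/
noncomputable def rep (A : Alg l) : Module.End ℂ (Spin l) :=
  (1 / 2 : ℂ) • ∑ p, ∑ q, A.1 p q • (gamma p * gammaDual q)

/-- The Clifford relations turn the commutator with γ_p γ^q into two terms; skew-adjointness of A
makes their sums equal, which absorbs the factor 1/2. -/
theorem rep_mul_gamma_sub (A : Alg l) (r : Idx l) :
    rep A * gamma r - gamma r * rep A = ∑ p, A.1 p r • gamma p := by
  have h1 : ∀ p q, gamma p * gammaDual q * gamma r - gamma r * (gamma p * gammaDual q) =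
      (if r = q then gamma p else 0) - gram l r p • gammaDual q := by
    intro p q
    have e1 := gamma_gammaDual_anticomm r q
    have e2 := gamma_anticomm r p
    have : gamma p * gammaDual q * gamma r - gamma r * (gamma p * gammaDual q) =
        gamma p * (gamma r * gammaDual q + gammaDual q * gamma r) -
          (gamma r * gamma p + gamma p * gamma r) * gammaDual q := by noncomm_ring
    rw [this, e1, e2, smul_mul_assoc, one_mul, mul_ite, mul_one, mul_zero]
  have h2 : ∑ p, ∑ q, A.1 p q • gram l r p • gammaDual q = -∑ p, A.1 p r • gamma p := by
    have h3 : ∀ q, ∑ p, gram l r p * A.1 p q = -∑ s, A.1 s r * gram l s q := by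
      intro q
      have := congrFun (congrFun (gram_mul A) r) q
      rw [Matrix.neg_apply, mul_apply, mul_apply] at this
      exact this
    rw [Finset.sum_comm]
    simp only [smul_smul, mul_comm (A.1 _ _), ← Finset.sum_smul, h3, gamma_eq_sum (l := l),
      neg_smul, Finset.sum_neg_distrib, Finset.smul_sum]
    rw [Finset.sum_comm]
    simp only [Finset.sum_smul]
  rw [rep, smul_mul_assoc, mul_smul_comm, ← smul_sub, Finset.sum_mul, Finset.mul_sum,
    ← Finset.sum_sub_distrib]
  simp only [Finset.sum_mul, Finset.mul_sum, ← Finset.sum_sub_distrib, smul_mul_assoc,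
    mul_smul_comm, ← smul_sub, h1]
  have h4 : ∑ p, ∑ q, A.1 p q • ((if r = q then gamma p else 0) - gram l r p • gammaDual q) =
      (2 : ℂ) • ∑ p, A.1 p r • gamma p := by
    simp only [smul_sub, Finset.sum_sub_distrib, h2, smul_ite, smul_zero, Finset.sum_ite_eq,
      Finset.mem_univ, if_true]
    rw [sub_neg_eq_add, two_smul]
  rw [h4, smul_smul, one_div, inv_mul_cancel₀ two_ne_zero, one_smul]

theorem rep_mul_gammaDual_sub (A : Alg l) (r : Idx l) :
    rep A * gammaDual r - gammaDual r * rep A = -∑ q, A.1 r q • gammaDual q := by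
  have h1 : rep A * gammaDual r - gammaDual r * rep A =
      ∑ s, gramInv l r s • ∑ p, A.1 p s • gamma p := by
    rw [gammaDual_eq_sum, Finset.mul_sum, Finset.sum_mul, ← Finset.sum_sub_distrib]
    refine Finset.sum_congr rfl fun s _ => ?_
    rw [← rep_mul_gamma_sub, smul_sub, mul_smul_comm, smul_mul_assoc]
  have h3 : ∀ p, ∑ s, gramInv l r s * A.1 p s = -∑ q, A.1 r q * gramInv l q p := by
    intro p
    have := congrFun (congrFun (mul_gramInv A) r) p
    rw [Matrix.neg_apply, mul_apply, mul_apply] at this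
    rw [this, neg_neg]
    rfl
  rw [h1]
  simp only [Finset.smul_sum, gammaDual_eq_sum (l := l)]
  rw [Finset.sum_comm]
  conv_rhs => rw [Finset.sum_comm]
  simp only [smul_smul, ← Finset.sum_smul, h3, neg_smul, Finset.sum_neg_distrib]

/-- Bracketing with `rep A` is a derivation that acts on the γ_r by A and on the γ^s by minus the
transpose, so on the products γ_r γ^s it reproduces the matrix commutator. -/
theorem rep_lie (A B : Alg l) : rep ⁅A, B⁆ = rep A * rep B - rep B * rep A := by
  have h1 : ∀ r s, rep A * (gamma r * gammaDual s) - (gamma r * gammaDual s) * rep A =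
      ∑ p, A.1 p r • (gamma p * gammaDual s) - ∑ q, A.1 s q • (gamma r * gammaDual q) := by
    intro r s
    have : rep A * (gamma r * gammaDual s) - (gamma r * gammaDual s) * rep A =
        (rep A * gamma r - gamma r * rep A) * gammaDual s +
          gamma r * (rep A * gammaDual s - gammaDual s * rep A) := by noncomm_ring
    rw [this, rep_mul_gamma_sub, rep_mul_gammaDual_sub, Finset.sum_mul, mul_neg, Finset.mul_sum,
      ← sub_eq_add_neg]
    simp only [smul_mul_assoc, mul_smul_comm]
  have h2 : rep A * rep B - rep B * rep A = (1 / 2 : ℂ) • ∑ r, ∑ s, B.1 r s •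
      (rep A * (gamma r * gammaDual s) - (gamma r * gammaDual s) * rep A) := by
    conv_lhs => rw [rep.eq_1 B]
    rw [mul_smul_comm, smul_mul_assoc, ← smul_sub, Finset.sum_mul, Finset.mul_sum,
      ← Finset.sum_sub_distrib]
    simp only [Finset.sum_mul, Finset.mul_sum, ← Finset.sum_sub_distrib, smul_mul_assoc,
      mul_smul_comm, ← smul_sub]
  rw [h2, rep]
  congr 1
  simp only [h1, smul_sub, Finset.smul_sum, Finset.sum_sub_distrib, smul_smul]
  have h3 : ∑ r, ∑ s, ∑ p, (B.1 r s * A.1 p r) • (gamma p * gammaDual s) =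
      ∑ p, ∑ q, (A.1 * B.1) p q • (gamma p * gammaDual q) := by
    have : ∀ p q, (A.1 * B.1) p q • (gamma p * gammaDual q) =
        ∑ r, (B.1 r q * A.1 p r) • (gamma p * gammaDual q) := by
      intro p q
      rw [mul_apply, Finset.sum_smul]
      simp only [mul_comm]
    simp only [this]
    rw [Finset.sum_comm]
    conv_rhs => rw [Finset.sum_comm]
    refine Finset.sum_congr rfl fun q _ => ?_
    rw [Finset.sum_comm]
  have h4 : ∑ r, ∑ s, ∑ q, (B.1 r s * A.1 s q) • (gamma r * gammaDual q) =
      ∑ p, ∑ q, (B.1 * A.1) p q • (gamma p * gammaDual q) := by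
    refine Finset.sum_congr rfl fun p _ => ?_
    rw [Finset.sum_comm]
    refine Finset.sum_congr rfl fun q _ => ?_
    rw [mul_apply, Finset.sum_smul]
  rw [h3, h4, ← Finset.sum_sub_distrib]
  refine Finset.sum_congr rfl fun p _ => ?_
  rw [← Finset.sum_sub_distrib]
  refine Finset.sum_congr rfl fun q _ => ?_
  rw [coe_lie, Matrix.sub_apply, sub_smul]

theorem rep_add (A B : Alg l) : rep (A + B) = rep A + rep B := by
  simp only [rep, ← smul_add, ← Finset.sum_add_distrib, ← add_smul]
  rfl

theorem rep_smul (c : ℂ) (A : Alg l) : rep (c • A) = c • rep A := by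
  rw [rep, rep, smul_comm c]
  congr 1
  rw [Finset.smul_sum]
  refine Finset.sum_congr rfl fun p _ => ?_
  rw [Finset.smul_sum]
  refine Finset.sum_congr rfl fun q _ => ?_
  rw [smul_smul]
  rfl

noncomputable instance : LieRingModule (Alg l) (Spin l) where
  bracket A s := rep A s
  add_lie A B s := by rw [rep_add]; rfl
  lie_add A s t := LinearMap.map_add (rep A) s t
  leibniz_lie A B s := by
    rw [rep_lie, LinearMap.sub_apply]
    simp

noncomputable instance : LieModule ℂ (Alg l) (Spin l) where
  smul_lie c A s := by
    change rep (c • A) s = c • rep A s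
    rw [rep_smul]
    rfl
  lie_smul c A s := LinearMap.map_smul (rep A) c s

theorem lie_eq (A : Alg l) (s : Spin l) : ⁅A, s⁆ = rep A s := rfl

theorem rep_gen (p q : Idx l) :
    rep (gen p q) = (1 / 2 : ℂ) • (gamma p * gammaDual q - gammaDual q * gamma p) := by
  have h : ∑ r, ∑ s, (gramInv l r q * gram l p s) • (gamma r * gammaDual s) =
      gammaDual q * gamma p := by
    have hs : ∀ r, gramInv l r q = gramInv l q r := fun r =>
      congrFun (congrFun (gramInv_transpose l) q) r
    rw [gammaDual_eq_sum, gamma_eq_sum, Finset.sum_mul]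
    simp only [Finset.mul_sum, smul_mul_assoc, mul_smul_comm, smul_smul, hs, mul_comm]
  rw [rep]
  congr 1
  simp only [gen_apply, sub_smul, Finset.sum_sub_distrib, h]
  congr 1
  rw [Finset.sum_eq_single p, Finset.sum_eq_single q]
  · simp
  · intro s _ hs
    simp [hs.symm]
  · simp
  · intro r _ hr
    refine Finset.sum_eq_zero fun s _ => ?_
    simp [hr.symm]
  · simp

theorem lie_cartan_apply (a : Fin l → ℂ) (s : Spin l) (ε : Fin l → ℤˣ) :
    (⁅cartan a, s⁆ : Spin l) ε = (spinWeight ε ⬝ᵥ a) * s ε := by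
  have h1 : rep (cartan a) = (1 / 2 : ℂ) • ∑ i, (a i • (shift 1 i * shift (-1) i)
      - a i • (shift (-1) i * shift 1 i)) := by
    rw [rep, cartan_val]
    congr 1
    simp only [diagonal_apply, ite_smul, zero_smul, Finset.sum_ite_eq, Finset.mem_univ, if_true]
    simp [gamma, gammaDual, Finset.sum_neg_distrib, ← sub_eq_add_neg]
  rw [lie_eq, h1, LinearMap.smul_apply, smul_apply, LinearMap.sum_apply, sum_apply, dotProduct,
    Finset.sum_mul, Finset.mul_sum]
  refine Finset.sum_congr rfl fun i _ => ?_
  rw [LinearMap.sub_apply, sub_apply, LinearMap.smul_apply, LinearMap.smul_apply, smul_apply,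
    smul_apply, shift_mul_shift_self_apply, shift_mul_shift_self_apply, spinWeight]
  rcases Int.units_eq_one_or (ε i) with h | h
  · simp [h]
    ring
  · simp [h]
    ring

theorem delta_mem_weightSub (ε : Fin l → ℤˣ) : delta ε ∈ weightSub (Spin l) (spinWeight ε) := by
  intro a
  ext ε'
  rw [lie_cartan_apply, smul_apply, delta_apply]
  split_ifs with h
  · rw [h]
  · simp

theorem eq_spinWeight_of_apply_ne_zero {ζ : Fin l → ℂ} {s : Spin l} (hs : s ∈ weightSub (Spin l) ζ)
    {ε : Fin l → ℤˣ} (h : s ε ≠ 0) : ζ = spinWeight ε := by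
  ext i
  have := congrArg (fun t : Spin l => t ε) (hs (Pi.single i 1))
  simp only [lie_cartan_apply, smul_apply, dotProduct_single_one] at this
  exact (mul_right_cancel₀ h this).symm

theorem spinWeight_injective : Function.Injective (spinWeight (l := l)) := by
  intro ε η h
  funext i
  have := congrFun h i
  simp only [spinWeight] at this
  have h2 : ((ε i : ℤ) : ℂ) = ((η i : ℤ) : ℂ) := by linear_combination 2 * this
  exact Units.ext (by exact_mod_cast h2)

theorem rePair_spinWeight_le {g : Fin l → ℝ} (hg : IsRegularDominant g) (ε : Fin l → ℤˣ) :
    rePair g (spinWeight ε) ≤ rePair g (spinWeight 1) := by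
  refine Finset.sum_le_sum fun i _ => ?_
  have hi : 0 < g i := by
    have := hg (Pi.single i 1) (Or.inl ⟨i, rfl⟩)
    rwa [rePair_single] at this
  refine mul_le_mul_of_nonneg_left ?_ hi.le
  rcases Int.units_eq_one_or (ε i) with h | h
  · simp [spinWeight, h]
  · simp only [spinWeight, h, Pi.one_apply]
    norm_num

theorem rePair_of_gen_lie_delta_ne_zero {g : Fin l → ℝ} (hg : IsRegularDominant g) {p q : Idx l}
    (hpq : ht q < ht p) {ε ε' : Fin l → ℤˣ} (h : (⁅gen p q, delta ε'⁆ : Spin l) ε ≠ 0) :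
    rePair g (spinWeight ε') < rePair g (spinWeight ε) := by
  have h0 : gen p q ≠ 0 := by
    intro h0
    rw [h0, zero_lie] at h
    exact h rfl
  rw [← eq_spinWeight_of_apply_ne_zero (gen_lie_mem_weightSub (delta_mem_weightSub ε') p q) h,
    rePair_add]
  linarith [rePair_wt_sub_pos hg hpq h0]

/-- A raising operator would reach a basis vector with a larger value of g, and no sign vector
exceeds the constant 1. -/
theorem isHighestWeightVector_delta_one :
    IsHighestWeightVector (spinWeight (l := l) 1) (delta (l := l) 1) := by
  obtain ⟨g, hg⟩ := exists_isRegularDominant l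
  refine isHighestWeightVector_iff.2 ⟨delta_ne_zero 1, delta_mem_weightSub 1, fun p q hpq => ?_⟩
  ext ε
  by_contra h
  exact absurd (rePair_of_gen_lie_delta_ne_zero hg hpq h) (rePair_spinWeight_le hg ε).not_gt

theorem lie_gen_delta_flip {i : Fin l} {ε : Fin l → ℤˣ} (h : ε i = 1) :
    ∃ c : ℂ, c ≠ 0 ∧ ⁅gen (.inl ()) (.inr (.inl i)), delta ε⁆ = c • delta (flip i ε) := by
  have h1 : rep (gen (.inl ()) (.inr (.inl i))) = -(shift (-1) i * parity l) := by
    rw [rep_gen]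
    simp only [gamma, gammaDual, Sum.elim_inl, Sum.elim_inr, parity_mul_shift]
    rw [← neg_add', ← two_smul ℂ, ← smul_neg, smul_smul]
    norm_num
  have h2 : parity l (delta ε) = (((∏ j, ε j : ℤˣ) : ℤ) : ℂ) • delta ε := by
    ext ε'
    rw [parity_apply, smul_apply, delta_apply]
    split_ifs with h'
    · rw [h']
    · simp
  refine ⟨-((((∏ j, ε j : ℤˣ) : ℤ) : ℂ) * ((signBefore i ε : ℤ) : ℂ)), ?_, ?_⟩
  · simp [Finset.prod_eq_zero_iff]
  · rw [lie_eq, h1, LinearMap.neg_apply, Module.End.mul_apply, h2, map_smul, shift_delta,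
      if_pos (by rw [h, neg_neg]), smul_smul, neg_smul]

/-- The negative short root vectors flip one sign from 1 to -1 with a nonzero coefficient, so every
basis vector is reached from the top one. -/
theorem delta_mem_lieSpan (ε : Fin l → ℤˣ) :
    delta ε ∈ LieSubmodule.lieSpan ℂ (Alg l) {delta (l := l) 1} := by
  induction hn : (Finset.univ.filter fun i => ε i = -1).card generalizing ε with
  | zero =>
    have : ε = 1 := by
      funext i
      rw [Finset.card_eq_zero, Finset.filter_eq_empty_iff] at hn
      exact (Int.units_eq_one_or (ε i)).resolve_right (hn (Finset.mem_univ i))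
    rw [this]
    exact LieSubmodule.subset_lieSpan rfl
  | succ n ih =>
    obtain ⟨i, hi⟩ := Finset.card_pos.1 (by rw [hn]; exact n.succ_pos)
    have hi' := (Finset.mem_filter.1 hi).2
    have h1 : flip i ε i = 1 := by rw [flip_apply_self, hi', neg_neg]
    have h2 : (Finset.univ.filter fun j => flip i ε j = -1) =
        (Finset.univ.filter fun j => ε j = -1).erase i := by
      ext j
      by_cases hj : j = i
      · subst hj
        simp [h1]
      · simp [hj, flip_apply_of_ne hj]
    have h3 := ih (flip i ε) (by rw [h2, Finset.card_erase_of_mem hi, hn]; rfl)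
    obtain ⟨c, hc, h4⟩ := lie_gen_delta_flip h1
    rw [flip_flip] at h4
    have h5 := (LieSubmodule.lieSpan ℂ (Alg l) {delta (l := l) 1}).lie_mem
      (x := gen (.inl ()) (.inr (.inl i))) h3
    rw [h4] at h5
    have h6 := (LieSubmodule.lieSpan ℂ (Alg l) {delta (l := l) 1}).smul_mem c⁻¹ h5
    rwa [smul_smul, inv_mul_cancel₀ hc, one_smul] at h6

theorem lieSpan_delta_one : LieSubmodule.lieSpan ℂ (Alg l) {delta (l := l) 1} = ⊤ := by
  rw [eq_top_iff]
  intro s _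
  rw [eq_sum_delta s]
  exact sum_mem fun ε _ => SMulMemClass.smul_mem _ (delta_mem_lieSpan ε)

theorem isIrreducibleOfHighestWeight : IsIrreducibleOfHighestWeight (Spin l) (spinWeight (l := l) 1) :=
  ⟨inferInstance, isIrreducible_of_lieSpan_eq_top isHighestWeightVector_delta_one lieSpan_delta_one,
    _, isHighestWeightVector_delta_one⟩

theorem spinWeight_one_eq (hl : 0 < l) :
    spinWeight 1 = fundamentalWeight (⟨l - 1, by omega⟩ : Fin l) := by
  ext i
  simp [spinWeight, fundamentalWeight, Nat.sub_add_cancel (show 1 ≤ l from hl)]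

end Spin

end TypeB

namespace TypeB

open Matrix

/-! ### M as a difference of Casimir operators -/

section TensorCasimir

variable {l : ℕ} {V W : Type*} [AddCommGroup V] [Module ℂ V] [LieRingModule (Alg l) V]
  [LieModule ℂ (Alg l) V] [AddCommGroup W] [Module ℂ W] [LieRingModule (Alg l) W]
  [LieModule ℂ (Alg l) W]

/-- The cross terms of the coproduct are two equal copies of the sum of gen p q ⊗ gen q p, which is
4(2l-1) M. -/
theorem casimir_tensor (t : V ⊗[ℂ] W) :
    casimir l (V ⊗[ℂ] W) t = TensorProduct.map (casimir l V) LinearMap.id t +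
      TensorProduct.map LinearMap.id (casimir l W) t +
      (8 * (2 * l - 1) : ℂ) • tensorCasimir ℂ (Alg l) V W t := by
  have h8 : (8 * (2 * l - 1) : ℂ) = 2 * (4 * (2 * l - 1)) := by ring
  rw [h8, mul_smul, ← LinearMap.smul_apply, tensorCasimir_eq]
  induction t with
  | zero => simp
  | add x y hx hy =>
    simp only [map_add, hx, hy, smul_add]
    abel
  | tmul v w =>
    have h : ∀ p q : Idx l, ⁅gen p q, ⁅gen q p, v ⊗ₜ[ℂ] w⁆⁆ =
        ⁅gen p q, ⁅gen q p, v⁆⁆ ⊗ₜ[ℂ] w + v ⊗ₜ[ℂ] ⁅gen p q, ⁅gen q p, w⁆⁆ +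
        (⁅gen p q, v⁆ ⊗ₜ[ℂ] ⁅gen q p, w⁆ + ⁅gen q p, v⁆ ⊗ₜ[ℂ] ⁅gen p q, w⁆) := by
      intro p q
      simp only [TensorProduct.LieModule.lie_tmul_right, lie_add]
      abel
    have hswap : ∑ p : Idx l, ∑ q : Idx l, ⁅gen q p, v⁆ ⊗ₜ[ℂ] ⁅gen p q, w⁆ =
        ∑ p : Idx l, ∑ q : Idx l, ⁅gen p q, v⁆ ⊗ₜ[ℂ] ⁅gen q p, w⁆ := Finset.sum_comm
    simp only [casimir_apply, h, Finset.sum_add_distrib, hswap, LinearMap.sum_apply,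
      TensorProduct.map_tmul, LieModule.toEnd_apply_apply, LinearMap.id_apply,
      TensorProduct.sum_tmul, TensorProduct.tmul_sum, two_smul]

theorem casimir_eq_smul_of_isIrreducibleOfHighestWeight {ζ : Fin l → ℂ}
    (h : IsIrreducibleOfHighestWeight V ζ) : casimir l V = casimirScalar ζ • LinearMap.id := by
  have := h.irreducible
  obtain ⟨u, hu⟩ := h.exists_highestWeightVector
  have htop : casimirEigen l V (casimirScalar ζ) = ⊤ := by
    refine (IsSimpleOrder.eq_bot_or_eq_top _).resolve_left fun hbot => hu.ne_zero ?_
    have := hu.mem_casimirEigen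
    rw [hbot] at this
    exact this
  ext v
  exact mem_casimirEigen.1 (htop ▸ LieSubmodule.mem_top v)

theorem tensorCasimir_apply_of_mem_casimirEigen {ω ν : Fin l → ℂ}
    (hV : IsIrreducibleOfHighestWeight V ω) (hW : IsIrreducibleOfHighestWeight W ν) {c : ℂ}
    {t : V ⊗[ℂ] W} (ht : t ∈ casimirEigen l (V ⊗[ℂ] W) c) :
    tensorCasimir ℂ (Alg l) V W t =
      ((c - casimirScalar ω - casimirScalar ν) / (8 * (2 * l - 1))) • t := by
  have h0 : (8 * (2 * l - 1) : ℂ) ≠ 0 := by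
    have : (2 * l - 1 : ℂ) = ((2 * l - 1 : ℤ) : ℂ) := by push_cast; ring
    rw [this]
    refine mul_ne_zero (by norm_num) ?_
    rw [Int.cast_ne_zero]
    omega
  have h := casimir_tensor (l := l) t
  rw [mem_casimirEigen.1 ht, casimir_eq_smul_of_isIrreducibleOfHighestWeight hV,
    casimir_eq_smul_of_isIrreducibleOfHighestWeight hW, TensorProduct.map_smul_left,
    TensorProduct.map_smul_right, TensorProduct.map_id, LinearMap.smul_apply,
    LinearMap.smul_apply, LinearMap.id_apply] at h
  rw [div_eq_inv_mul, mul_smul, sub_smul, sub_smul, h, add_sub_right_comm, add_sub_cancel_left,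
    add_sub_cancel_left, smul_smul, inv_mul_cancel₀ h0, one_smul]

end TensorCasimir

/-! ### Highest weight vectors in Spin ⊗ W -/

namespace Spin

variable {l : ℕ} {W : Type*} [AddCommGroup W] [Module ℂ W]

/-- The coefficient of `delta ε` of a tensor. -/
noncomputable def coeff (W : Type*) [AddCommGroup W] [Module ℂ W] (ε : Fin l → ℤˣ) :
    Spin l ⊗[ℂ] W →ₗ[ℂ] W :=
  TensorProduct.lid ℂ W ∘ₗ LinearMap.rTensor W (coord l ε)

@[simp] theorem coeff_tmul (ε : Fin l → ℤˣ) (s : Spin l) (w : W) :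
    coeff W ε (s ⊗ₜ w) = s ε • w := by
  simp [coeff]

theorem eq_sum_coeff (x : Spin l ⊗[ℂ] W) : x = ∑ ε, delta ε ⊗ₜ coeff W ε x := by
  induction x with
  | zero => simp
  | add x y hx hy =>
    conv_lhs => rw [hx, hy]
    simp only [map_add, TensorProduct.tmul_add, Finset.sum_add_distrib]
  | tmul s w =>
    conv_lhs => rw [eq_sum_delta s]
    simp only [coeff_tmul, TensorProduct.sum_tmul, TensorProduct.smul_tmul]

variable [LieRingModule (Alg l) W] [LieModule ℂ (Alg l) W]

theorem coeff_lie (A : Alg l) (x : Spin l ⊗[ℂ] W) (ε : Fin l → ℤˣ) :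
    coeff W ε ⁅A, x⁆ = ⁅A, coeff W ε x⁆ +
      ∑ ε', (⁅A, delta ε'⁆ : Spin l) ε • coeff W ε' x := by
  induction x with
  | zero => simp
  | add x y hx hy =>
    simp only [lie_add, map_add, hx, hy, smul_add, Finset.sum_add_distrib]
    abel
  | tmul s w =>
    have h : (⁅A, s⁆ : Spin l) ε = ∑ ε', s ε' * (⁅A, delta ε'⁆ : Spin l) ε := by
      conv_lhs => rw [eq_sum_delta s]
      rw [lie_sum, sum_apply]
      simp only [lie_smul, smul_apply]
    simp only [TensorProduct.LieModule.lie_tmul_right, map_add, coeff_tmul, h, lie_smul,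
      Finset.sum_smul, smul_smul, mul_comm]
    rw [add_comm]

/-- Among the nonzero coefficients, take the one with ε lowest for g. Raising operators reach δ_ε
only from lower basis vectors, whose coefficients vanish, so the coefficient at ε is itself a
highest weight vector of W. -/
theorem exists_leading_coeff [LieModule.IsIrreducible ℂ (Alg l) W] {ν ζ : Fin l → ℂ} {u : W}
    (hu : IsHighestWeightVector ν u) {x : Spin l ⊗[ℂ] W} (hx : IsHighestWeightVector ζ x) :
    ∃ ε, ζ = ν + spinWeight ε ∧ ∃ c : ℂ, c ≠ 0 ∧ coeff W ε x = c • u := by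
  classical
  obtain ⟨g, hg⟩ := exists_isRegularDominant l
  obtain ⟨hx0, hxw, hxr⟩ := isHighestWeightVector_iff.1 hx
  have hne : (Finset.univ.filter fun ε : Fin l → ℤˣ => coeff W ε x ≠ 0).Nonempty := by
    by_contra hcon
    rw [Finset.not_nonempty_iff_eq_empty, Finset.filter_eq_empty_iff] at hcon
    apply hx0
    rw [eq_sum_coeff x]
    refine Finset.sum_eq_zero fun ε _ => ?_
    rw [not_not.1 (hcon (Finset.mem_univ ε)), TensorProduct.tmul_zero]
  obtain ⟨ε, hε, hmin⟩ := Finset.exists_min_image _ (fun ε => rePair g (spinWeight ε)) hne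
  have hε0 : coeff W ε x ≠ 0 := (Finset.mem_filter.1 hε).2
  have hhw : IsHighestWeightVector (ζ - spinWeight ε) (coeff W ε x) := by
    refine isHighestWeightVector_iff.2 ⟨hε0, fun a => ?_, fun p q hpq => ?_⟩
    · have h := coeff_lie (cartan a) x ε
      rw [hxw a, map_smul, Finset.sum_eq_single ε] at h
      · rw [lie_cartan_apply, delta_apply, if_pos rfl, mul_one] at h
        rw [sub_dotProduct, sub_smul, h, add_sub_cancel_right]
      · intro ε' _ h'
        rw [lie_cartan_apply, delta_apply, if_neg h'.symm, mul_zero, zero_smul]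
      · simp
    · have h := coeff_lie (gen p q) x ε
      rw [hxr p q hpq, map_zero, Finset.sum_eq_zero, add_zero] at h
      · exact h.symm
      · intro ε' _
        by_cases h1 : (⁅gen p q, delta ε'⁆ : Spin l) ε = 0
        · rw [h1, zero_smul]
        · have h2 := rePair_of_gen_lie_delta_ne_zero hg hpq h1
          by_cases h3 : coeff W ε' x = 0
          · rw [h3, smul_zero]
          · exact absurd (hmin ε' (Finset.mem_filter.2 ⟨Finset.mem_univ _, h3⟩)) h2.not_ge
  obtain ⟨h1, c, hc⟩ := highestWeight_eq_and_eq_smul hu hhw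
  refine ⟨ε, by rw [← h1, sub_add_cancel], c, ?_, hc⟩
  rintro rfl
  exact hε0 (by rw [hc, zero_smul])

/-- The weight determines the leading ε. A combination cancelling the two leading coefficients
would, if nonzero, again need a nonzero coefficient at that same ε. -/
theorem eq_smul_of_isHighestWeightVector [LieModule.IsIrreducible ℂ (Alg l) W] {ν ζ : Fin l → ℂ}
    {u : W} (hu : IsHighestWeightVector ν u) {x y : Spin l ⊗[ℂ] W}
    (hx : IsHighestWeightVector ζ x) (hy : IsHighestWeightVector ζ y) : ∃ c : ℂ, y = c • x := by
  obtain ⟨ε, h1, c, hc, hcx⟩ := exists_leading_coeff hu hx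
  obtain ⟨ε', h1', c', -, hcy⟩ := exists_leading_coeff hu hy
  obtain rfl : ε = ε' := spinWeight_injective (add_left_cancel (h1.symm.trans h1'))
  refine ⟨c' / c, ?_⟩
  by_contra hne
  have hz : IsHighestWeightVector ζ (y - (c' / c) • x) := by
    refine ⟨sub_ne_zero.2 hne, fun a => ?_, fun α hα A hA => ?_⟩
    · rw [lie_sub, lie_smul, hx.cartan_lie, hy.cartan_lie, smul_sub, smul_comm (c' / c)]
    · rw [lie_sub, lie_smul, hx.root_lie α hα A hA, hy.root_lie α hα A hA, smul_zero, sub_zero]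
  obtain ⟨ε', h2, d, hd, hdz⟩ := exists_leading_coeff hu hz
  obtain rfl : ε = ε' := spinWeight_injective (add_left_cancel (h1.symm.trans h2))
  rw [map_sub, map_smul, hcx, hcy, smul_smul, div_mul_cancel₀ _ hc, sub_self] at hdz
  exact (smul_ne_zero hd hu.ne_zero) hdz.symm

/-- The part quadratic in ε is constant because every coordinate has square 1/4, which makes the
scalar affine in ε with linear part 4(ν + ρ, ε). -/
theorem casimirScalar_add_spinWeight (ν : Fin l → ℂ) (ε : Fin l → ℤˣ) :
    casimirScalar (ν + spinWeight ε) =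
      ∑ i, (2 * ν i * (ν i + 2 * (l - i.val - 1 / 2)) + 1 / 2) +
      4 * ∑ i, (ν i + (l - i.val - 1 / 2)) * spinWeight ε i := by
  rw [casimirScalar, Finset.mul_sum, ← Finset.sum_add_distrib]
  refine Finset.sum_congr rfl fun i _ => ?_
  have h : spinWeight ε i * spinWeight ε i = 1 / 4 := by
    have := units_mul_self_complex (ε i)
    simp only [spinWeight]
    linear_combination this / 4
  simp only [Pi.add_apply]
  linear_combination 2 * h

/-- The form B obstructs surjectivity of the Casimir operator minus its expected scalar on the
weight space ν + ε; the kernel vector this yields cannot be raised, for lack of a larger weight with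
the same Casimir scalar. -/
theorem exists_isHighestWeightVector_of_pairing [Module.Finite ℂ W]
    [LieModule.IsIrreducible ℂ (Alg l) W] {ν : Fin l → ℂ} {u : W}
    (hu : IsHighestWeightVector ν u) (ε : Fin l → ℤˣ) (b : Spin l →ₗ[ℂ] W →ₗ[ℂ] ℂ)
    (hb : ∀ p q : Idx l, ht p < ht q → ∀ s w, b ⁅gen p q, s⁆ w + b s ⁅gen p q, w⁆ = 0)
    (hε : b (delta ε) u ≠ 0) :
    ∃ x : Spin l ⊗[ℂ] W, IsHighestWeightVector (ν + spinWeight ε) x := by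
  have hνd := hu.isRealDominant
  set ζ := ν + spinWeight ε with hζ
  set M := Spin l ⊗[ℂ] W with hM
  set B : M →ₗ[ℂ] ℂ := TensorProduct.lift b with hB
  have hBlow : ∀ p q : Idx l, ht p < ht q → ∀ t : M, B ⁅gen p q, t⁆ = 0 := by
    intro p q hpq t
    induction t using TensorProduct.induction_on with
    | zero => simp
    | add x y hx hy => rw [lie_add, map_add, hx, hy, add_zero]
    | tmul s w =>
      rw [TensorProduct.LieModule.lie_tmul_right, map_add]
      exact hb p q hpq s w
  -- In normal order all non-scalar terms end in a lowering operator, and B kills those.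
  have hBcas : ∀ t ∈ weightSub M ζ, B (casimir l M t) = casimirScalar ζ • B t := by
    intro t ht'
    rw [casimir_of_mem_weightSub ht', map_add, map_smul, map_sum, Finset.sum_eq_zero, add_zero]
    intro p _
    rw [map_sum]
    refine Finset.sum_eq_zero fun q _ => ?_
    split_ifs with h
    · rw [map_smul, hBlow q p h, smul_zero]
    · exact map_zero B
  have hst : ∀ t ∈ weightSub M ζ, (casimir l M - casimirScalar ζ • 1) t ∈ weightSub M ζ := by
    intro t ht' a
    rw [LinearMap.sub_apply, LinearMap.smul_apply, Module.End.one_apply, lie_sub, lie_smul,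
      ← casimir_lie, ht' a, map_smul, smul_sub, smul_comm (casimirScalar ζ)]
  have hx0 : (delta ε ⊗ₜ u : M) ∈ weightSub M ζ := by
    intro a
    rw [TensorProduct.LieModule.lie_tmul_right, delta_mem_weightSub ε a, hu.cartan_lie, hζ,
      add_dotProduct, add_smul, TensorProduct.tmul_smul, ← TensorProduct.smul_tmul', add_comm]
  let T : Module.End ℂ (weightSub M ζ) := (casimir l M - casimirScalar ζ • 1).restrict hst
  -- The tensor δ_ε ⊗ u is outside the range of T, because B vanishes on the range; in finite
  -- dimension T then has a kernel.
  have hTker : ∃ t : weightSub M ζ, t ≠ 0 ∧ T t = 0 := by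
    by_contra! hcon
    have hinj : Function.Injective T := by
      rw [← LinearMap.ker_eq_bot, LinearMap.ker_eq_bot']
      intro t ht'
      by_contra h
      exact hcon t h ht'
    obtain ⟨t, ht'⟩ := LinearMap.surjective_of_injective hinj ⟨_, hx0⟩
    apply hε
    have h1 : (casimir l M - casimirScalar ζ • 1) t.1 = delta ε ⊗ₜ u := congrArg Subtype.val ht'
    have h2 : B (delta ε ⊗ₜ u) = b (delta ε) u := rfl
    rw [← h2, ← h1, LinearMap.sub_apply, map_sub, hBcas t.1 t.2, LinearMap.smul_apply, map_smul,
      Module.End.one_apply, sub_self]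
  obtain ⟨⟨m, hm⟩, hm0, hTm⟩ := hTker
  replace hm0 : m ≠ 0 := fun h => hm0 (Subtype.ext h)
  have hcas : m ∈ casimirEigen l M (casimirScalar ζ) := by
    rw [mem_casimirEigen]
    have : (casimir l M - casimirScalar ζ • 1) m = 0 := congrArg Subtype.val hTm
    rw [LinearMap.sub_apply, sub_eq_zero] at this
    exact this
  -- This is ν + ρ: Casimir scalars of the weights ν + ε' are compared through the same g that
  -- raising operators increase.
  set g : Fin l → ℝ := fun i => (ν i).re + (l - i.val - 1 / 2) with hgdef
  have hρ : ∀ i : Fin l, (i.val : ℝ) + 1 ≤ l := fun i => by exact_mod_cast i.isLt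
  have hg : IsRegularDominant g := by
    refine isRegularDominant_of_lt (fun i => ?_) (fun i j hij => ?_)
    · have := hρ i
      have := hνd.nonneg i
      simp only [hgdef]
      linarith
    · have h1 := hνd.antitone i j hij
      have h3 : (i.val : ℝ) < j.val := by exact_mod_cast hij
      simp only [hgdef]
      linarith
  refine ⟨m, isHighestWeightVector_iff.2 ⟨hm0, hm, fun p q hpq => ?_⟩⟩
  by_contra hne
  have h0 : gen p q ≠ 0 := by
    intro h
    rw [h, zero_lie] at hne
    exact hne rfl
  obtain ⟨ζ', x, hxN, hx, hle⟩ := exists_highestWeightVector_ge hg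
    (casimirEigen l M (casimirScalar ζ) : Submodule ℂ M)
    (fun p q _ t ht' => (casimirEigen l M (casimirScalar ζ)).lie_mem ht')
    ((casimirEigen l M (casimirScalar ζ)).lie_mem hcas) hne (gen_lie_mem_weightSub hm p q)
  have hlt : rePair g ζ < rePair g ζ' := by
    rw [rePair_add] at hle
    linarith [rePair_wt_sub_pos hg hpq h0]
  obtain ⟨ε', rfl, -⟩ := exists_leading_coeff hu hx
  have hc : casimirScalar (ν + spinWeight ε') = casimirScalar ζ := by
    have h1 := mem_casimirEigen.1 hx.mem_casimirEigen
    have h2 := (mem_casimirEigen (M := M)).1 hxN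
    exact smul_left_injective ℂ hx.ne_zero (h1.symm.trans h2)
  have hpair : ∀ η : Fin l → ℤˣ,
      (∑ i, (ν i + (l - i.val - 1 / 2)) * spinWeight η i).re = rePair g (spinWeight η) := by
    intro η
    rw [Complex.re_sum, rePair]
    refine Finset.sum_congr rfl fun i _ => ?_
    have h1 : (spinWeight η i).im = 0 := by
      rcases Int.units_eq_one_or (η i) with h | h <;> simp [spinWeight, h]
    rw [Complex.mul_re, h1, mul_zero, sub_zero]
    simp [hgdef]
  rw [hζ, casimirScalar_add_spinWeight, casimirScalar_add_spinWeight] at hc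
  have hc' := congrArg Complex.re (mul_left_cancel₀ (by norm_num : (4 : ℂ) ≠ 0)
    (add_left_cancel hc))
  rw [hpair, hpair] at hc'
  rw [hζ, rePair_add, rePair_add, hc'] at hlt
  exact lt_irrefl _ hlt

end Spin

end TypeB

/-! ### Products of creation and annihilation operators -/

namespace TypeB

open Matrix

variable {l : ℕ}

theorem ht_bar (p : Idx l) : ht (bar p) = -ht p := by
  rcases p with p | p | p <;> simp

theorem bar_bar (p : Idx l) : bar (bar p) = p := by
  rcases p with p | p | p <;> rfl

theorem ht_sub_eq_of_gen_apply_ne_zero {p q r s : Idx l} (h : (gen p q).1 r s ≠ 0) :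
    ht r - ht s = ht p - ht q := by
  rw [gen_apply] at h
  by_cases h1 : p = r ∧ q = s
  · rw [h1.1, h1.2]
  · rw [if_neg h1, zero_sub, neg_ne_zero, mul_ne_zero_iff] at h
    have h2 : q = bar r := by_contra fun h' => h.1 (gramInv_eq_zero h')
    have h3 : s = bar p := by_contra fun h' => h.2 (gram_eq_zero h')
    rw [h2, h3, ht_bar, ht_bar]
    ring

theorem weightOf_add (a b : Fin l → ℕ) : weightOf (a + b) = weightOf a + weightOf b := by
  simp only [weightOf, Pi.add_apply, Nat.cast_add, add_smul, Finset.sum_add_distrib]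

theorem weightOf_single (i : Fin l) : weightOf (Pi.single i 1) = fundamentalWeight i := by
  rw [weightOf, Finset.sum_eq_single i]
  · simp
  · intro j _ hj
    simp [hj]
  · simp

namespace Spin

/-- The signs `ε` with the first `k` of them replaced by `σ`. -/
def setFirst (k : ℕ) (σ : ℤˣ) (ε : Fin l → ℤˣ) : Fin l → ℤˣ :=
  fun m => if m.val < k then σ else ε m

/-- The product of the first `k` creation operators. -/
noncomputable def createFirst : ℕ → Module.End ℂ (Spin l)
  | 0 => 1
  | k + 1 => createFirst k * if h : k < l then shift 1 ⟨k, h⟩ else 0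

/-- The product of the first `k` annihilation operators, in the opposite order. -/
noncomputable def annihilateFirst : ℕ → Module.End ℂ (Spin l)
  | 0 => 1
  | k + 1 => (if h : k < l then shift (-1) ⟨k, h⟩ else 0) * annihilateFirst k

theorem createFirst_succ {k : ℕ} (h : k < l) :
    createFirst (l := l) (k + 1) = createFirst k * shift 1 ⟨k, h⟩ := by
  rw [createFirst, dif_pos h]

theorem annihilateFirst_succ {k : ℕ} (h : k < l) :
    annihilateFirst (l := l) (k + 1) = shift (-1) ⟨k, h⟩ * annihilateFirst k := by
  rw [annihilateFirst, dif_pos h]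

theorem shift_mul_self (σ : ℤˣ) (i : Fin l) : shift σ i * shift σ i = 0 := by
  ext s ε
  rw [shift_mul_shift_self_apply, if_neg]
  · rfl
  · rintro ⟨-, h⟩
    exact absurd h (by rcases Int.units_eq_one_or σ with rfl | rfl <;> decide)

theorem createFirst_mul_shift {k : ℕ} (hk : k ≤ l) {j : Fin l} (hj : j.val < k) :
    createFirst k * shift 1 j = 0 := by
  induction k with
  | zero => exact absurd hj (Nat.not_lt_zero _)
  | succ k ih =>
    rw [createFirst_succ hk, mul_assoc]
    by_cases h : j = ⟨k, hk⟩
    · rw [h, shift_mul_self, mul_zero]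
    · have hne : j.val ≠ k := fun h' => h (Fin.ext h')
      rw [shift_mul_shift (Ne.symm h), mul_neg, ← mul_assoc, ih (by omega) (by omega), zero_mul,
        neg_zero]

theorem shift_mul_annihilateFirst {k : ℕ} (hk : k ≤ l) {j : Fin l} (hj : j.val < k) :
    shift (-1) j * annihilateFirst k = 0 := by
  induction k with
  | zero => exact absurd hj (Nat.not_lt_zero _)
  | succ k ih =>
    rw [annihilateFirst_succ hk, ← mul_assoc]
    by_cases h : j = ⟨k, hk⟩
    · rw [h, shift_mul_self, zero_mul]
    · have hne : j.val ≠ k := fun h' => h (Fin.ext h')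
      rw [shift_mul_shift h, neg_mul, mul_assoc, ih (by omega) (by omega), mul_zero, neg_zero]

/-- Bracketing a lowering operator with the annihilator at position k gives only annihilators at
earlier positions, which are killed by the product already formed. -/
theorem rep_mul_annihilateFirst {k : ℕ} (hk : k ≤ l) {p q : Idx l} (hpq : ht p < ht q) :
    rep (gen p q) * annihilateFirst k = annihilateFirst k * rep (gen p q) := by
  induction k with
  | zero => rw [annihilateFirst, mul_one, one_mul]
  | succ k ih =>
    have h1 := rep_mul_gamma_sub (gen p q) (.inr (.inr ⟨k, hk⟩))
    have h2 : (∑ r, (gen p q).1 r (.inr (.inr ⟨k, hk⟩)) • gamma r) * annihilateFirst k = 0 := by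
      rw [Finset.sum_mul]
      refine Finset.sum_eq_zero fun r _ => ?_
      by_cases h : (gen p q).1 r (.inr (.inr ⟨k, hk⟩)) = 0
      · rw [h, zero_smul, zero_mul]
      · have h3 := ht_sub_eq_of_gen_apply_ne_zero h
        rw [smul_mul_assoc]
        rcases r with r | r | r
        · simp only [ht_zero, ht_neg] at h3
          omega
        · have := r.isLt
          simp only [ht_pos, ht_neg] at h3
          omega
        · simp only [ht_neg] at h3
          have h4 : gamma (.inr (.inr r)) * annihilateFirst k = 0 :=
            shift_mul_annihilateFirst (Nat.le_of_succ_le hk) (by omega)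
          rw [h4, smul_zero]
    rw [← h1, sub_mul, sub_eq_zero, mul_assoc, mul_assoc, ih (Nat.le_of_succ_le hk)] at h2
    rw [annihilateFirst_succ hk]
    exact h2.trans (mul_assoc _ _ _).symm

/-- Dually, a raising operator turns the creator at k into creators at earlier positions, killed by
the product on their left. Thus `createFirst k` is primitive in End(Spin), of weight the sum of the
first k coordinates. -/
theorem rep_mul_createFirst {k : ℕ} (hk : k ≤ l) {p q : Idx l} (hpq : ht q < ht p) :
    rep (gen p q) * createFirst k = createFirst k * rep (gen p q) := by
  induction k with
  | zero => rw [createFirst, mul_one, one_mul]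
  | succ k ih =>
    have h1 := rep_mul_gamma_sub (gen p q) (.inr (.inl ⟨k, hk⟩))
    have h2 : createFirst k * (∑ r, (gen p q).1 r (.inr (.inl ⟨k, hk⟩)) • gamma r) = 0 := by
      rw [Finset.mul_sum]
      refine Finset.sum_eq_zero fun r _ => ?_
      by_cases h : (gen p q).1 r (.inr (.inl ⟨k, hk⟩)) = 0
      · rw [h, zero_smul, mul_zero]
      · have h3 := ht_sub_eq_of_gen_apply_ne_zero h
        rw [mul_smul_comm]
        rcases r with r | r | r
        · simp only [ht_zero, ht_pos] at h3
          omega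
        · simp only [ht_pos] at h3
          have h4 : createFirst k * gamma (.inr (.inl r)) = 0 :=
            createFirst_mul_shift (Nat.le_of_succ_le hk) (by omega)
          rw [h4, smul_zero]
        · have := r.isLt
          simp only [ht_pos, ht_neg] at h3
          omega
    rw [← h1, mul_sub, sub_eq_zero, ← mul_assoc, ← ih (Nat.le_of_succ_le hk)] at h2
    rw [createFirst_succ hk]
    exact (mul_assoc _ _ _).symm.trans (h2.trans (mul_assoc _ _ _).symm)

theorem rep_cartan_mul_createFirst {k : ℕ} (hk : k ≤ l) (a : Fin l → ℂ) :
    rep (cartan a) * createFirst k - createFirst k * rep (cartan a) =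
      (∑ m : Fin l, if m.val < k then a m else 0) • createFirst k := by
  induction k with
  | zero => simp [createFirst]
  | succ k ih =>
    have h1 := rep_mul_gamma_sub (cartan a) (.inr (.inl ⟨k, hk⟩))
    have h2 : ∑ r, (cartan a).1 r (.inr (.inl ⟨k, hk⟩)) • gamma r = a ⟨k, hk⟩ • shift 1 ⟨k, hk⟩ := by
      rw [cartan_val, Finset.sum_eq_single (.inr (.inl ⟨k, hk⟩))]
      · simp [gamma]
      · intro r _ hr
        rw [diagonal_apply_ne _ hr, zero_smul]
      · simp
    have h3 : (∑ m : Fin l, if m.val < k + 1 then a m else 0) =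
        (∑ m : Fin l, if m.val < k then a m else 0) + a ⟨k, hk⟩ := by
      have : a ⟨k, hk⟩ = ∑ m : Fin l, if m = ⟨k, hk⟩ then a m else 0 := by simp
      rw [this, ← Finset.sum_add_distrib]
      refine Finset.sum_congr rfl fun m _ => ?_
      by_cases hm : m = ⟨k, hk⟩
      · subst hm
        simp
      · have : m.val ≠ k := fun h => hm (Fin.ext h)
        rw [if_neg hm, add_zero]
        congr 1
        exact propext ⟨fun h => by omega, fun h => by omega⟩
    have h4 : rep (cartan a) * (createFirst k * shift 1 ⟨k, hk⟩) -
        createFirst k * shift 1 ⟨k, hk⟩ * rep (cartan a) =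
        (rep (cartan a) * createFirst k - createFirst k * rep (cartan a)) * shift 1 ⟨k, hk⟩ +
          createFirst k * (rep (cartan a) * shift 1 ⟨k, hk⟩ - shift 1 ⟨k, hk⟩ * rep (cartan a)) := by
      noncomm_ring
    have h5 : rep (cartan a) * shift 1 ⟨k, hk⟩ - shift 1 ⟨k, hk⟩ * rep (cartan a) =
        a ⟨k, hk⟩ • shift 1 ⟨k, hk⟩ := h1.trans h2
    rw [createFirst_succ hk, h4, ih (Nat.le_of_succ_le hk), h5, h3, smul_mul_assoc, mul_smul_comm,
      add_smul]

theorem setFirst_zero (σ : ℤˣ) (ε : Fin l → ℤˣ) : setFirst 0 σ ε = ε := by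
  funext m
  simp [setFirst]

theorem setFirst_succ {k : ℕ} (hk : k < l) {σ : ℤˣ} {ε : Fin l → ℤˣ} (h : ε ⟨k, hk⟩ = -σ) :
    setFirst (k + 1) σ ε = flip ⟨k, hk⟩ (setFirst k σ ε) := by
  funext m
  by_cases hm : m = ⟨k, hk⟩
  · subst hm
    rw [flip_apply_self]
    simp [setFirst, h]
  · have : m.val ≠ k := fun h => hm (Fin.ext h)
    rw [flip_apply_of_ne hm, setFirst, setFirst]
    congr 1
    exact propext ⟨fun h => by omega, fun h => by omega⟩

theorem setFirst_flip {k : ℕ} (hk : k < l) {σ : ℤˣ} {ε : Fin l → ℤˣ} :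
    setFirst k σ (flip ⟨k, hk⟩ ε) = flip ⟨k, hk⟩ (setFirst k σ ε) := by
  funext m
  by_cases hm : m = ⟨k, hk⟩
  · subst hm
    simp [setFirst, flip_apply_self]
  · rw [flip_apply_of_ne hm, setFirst, setFirst, flip_apply_of_ne hm]

theorem annihilateFirst_delta {k : ℕ} (hk : k ≤ l) {ε : Fin l → ℤˣ}
    (hε : ∀ m : Fin l, m.val < k → ε m = 1) :
    ∃ c : ℂ, c ≠ 0 ∧ annihilateFirst k (delta ε) = c • delta (setFirst k (-1) ε) := by
  induction k with
  | zero => exact ⟨1, one_ne_zero, by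
      rw [annihilateFirst, Module.End.one_apply, one_smul, setFirst_zero]⟩
  | succ k ih =>
    obtain ⟨c, hc, h⟩ := ih (Nat.le_of_succ_le hk) fun m hm => hε m (by omega)
    have h1 : ε ⟨k, hk⟩ = - -1 := (hε ⟨k, hk⟩ (Nat.lt_succ_self k)).trans (neg_neg 1).symm
    have h2 : setFirst k (-1) ε ⟨k, hk⟩ = - -1 := by rw [← h1]; simp [setFirst]
    rw [annihilateFirst_succ hk, Module.End.mul_apply, h, map_smul, shift_delta, if_pos h2,
      smul_smul, ← setFirst_succ hk h1]
    exact ⟨_, mul_ne_zero hc (by simp), rfl⟩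

theorem createFirst_delta {k : ℕ} (hk : k ≤ l) {ε : Fin l → ℤˣ}
    (hε : ∀ m : Fin l, m.val < k → ε m = -1) :
    ∃ c : ℂ, c ≠ 0 ∧ createFirst k (delta ε) = c • delta (setFirst k 1 ε) := by
  induction k generalizing ε with
  | zero => exact ⟨1, one_ne_zero, by
      rw [createFirst, Module.End.one_apply, one_smul, setFirst_zero]⟩
  | succ k ih =>
    have h1 : ε ⟨k, hk⟩ = -1 := hε ⟨k, hk⟩ (Nat.lt_succ_self k)
    obtain ⟨c, hc, h⟩ := ih (Nat.le_of_succ_le hk) (ε := flip ⟨k, hk⟩ ε) fun m hm => by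
      rw [flip_apply_of_ne (fun h => by rw [h] at hm; exact lt_irrefl _ hm)]
      exact hε m (by omega)
    rw [createFirst_succ hk, Module.End.mul_apply, shift_delta, if_pos h1, map_smul, h, smul_smul,
      setFirst_flip hk, ← setFirst_succ hk h1]
    exact ⟨_, mul_ne_zero (by simp) hc, rfl⟩

theorem createFirst_mul_annihilateFirst_apply {k : ℕ} (hk : k ≤ l) (s : Spin l) (ε : Fin l → ℤˣ) :
    (createFirst k * annihilateFirst k : Module.End ℂ (Spin l)) s ε =
      if ∀ m : Fin l, m.val < k → ε m = 1 then s ε else 0 := by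
  induction k generalizing s with
  | zero => simp [createFirst, annihilateFirst]
  | succ k ih =>
    set D : Module.End ℂ (Spin l) := shift 1 ⟨k, hk⟩ * shift (-1) ⟨k, hk⟩ with hD
    have hcomm : ∀ m ≤ k, D * annihilateFirst m = annihilateFirst m * D := by
      intro m hm
      induction m with
      | zero => rw [annihilateFirst, mul_one, one_mul]
      | succ m ihm =>
        have hml : m < l := by omega
        have hne : (⟨k, hk⟩ : Fin l) ≠ ⟨m, hml⟩ := fun h => by
          have := congrArg Fin.val h
          simp only at this
          omega
        have h1 : D * shift (-1) ⟨m, hml⟩ = shift (-1) ⟨m, hml⟩ * D := by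
          rw [hD, mul_assoc, shift_mul_shift hne, mul_neg, ← mul_assoc, shift_mul_shift hne, neg_mul,
            neg_neg, mul_assoc]
        rw [annihilateFirst_succ hml, ← mul_assoc, h1, mul_assoc, ihm (by omega), mul_assoc]
    have h1 : createFirst (k + 1) * annihilateFirst (l := l) (k + 1) =
        createFirst k * annihilateFirst k * D := by
      rw [createFirst_succ hk, annihilateFirst_succ hk, mul_assoc, ← mul_assoc (shift 1 _), ← hD,
        hcomm k le_rfl, mul_assoc]
    have h3 : (∀ m : Fin l, m.val < k + 1 → ε m = 1) ↔
        (∀ m : Fin l, m.val < k → ε m = 1) ∧ ε ⟨k, hk⟩ = 1 := by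
      refine ⟨fun h => ⟨fun m hm => h m (by omega), h ⟨k, hk⟩ (Nat.lt_succ_self k)⟩,
        fun h m hm => ?_⟩
      rcases Nat.lt_succ_iff_lt_or_eq.1 hm with h' | h'
      · exact h.1 m h'
      · have : m = ⟨k, hk⟩ := Fin.ext h'
        rw [this, h.2]
    rw [h1, Module.End.mul_apply, ih (Nat.le_of_succ_le hk), hD, shift_mul_shift_self_apply]
    simp only [h3, ite_and, and_true]

/-- The product is the projection onto the span of the basis vectors whose first k signs are 1, a
nonzero idempotent. -/
theorem trace_createFirst_mul_annihilateFirst_ne_zero {k : ℕ} (hk : k ≤ l) :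
    LinearMap.trace ℂ (Spin l) (createFirst k * annihilateFirst k) ≠ 0 := by
  have hidem : IsIdempotentElem (createFirst k * annihilateFirst (l := l) k) := by
    ext s ε
    rw [Module.End.mul_apply, createFirst_mul_annihilateFirst_apply hk,
      createFirst_mul_annihilateFirst_apply hk]
    split_ifs <;> rfl
  intro h
  rw [LinearMap.IsIdempotentElem.trace_eq_zero_iff hidem] at h
  have := createFirst_mul_annihilateFirst_apply hk (delta (l := l) 1) 1
  rw [h, delta_apply, if_pos rfl, if_pos fun _ _ => Pi.one_apply _] at this
  exact zero_ne_one this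

theorem gen_lie_apply_one {p q : Idx l} (hpq : ht p < ht q) (s : Spin l) :
    (⁅gen p q, s⁆ : Spin l) 1 = 0 := by
  have h : ∀ ε, (⁅gen p q, delta ε⁆ : Spin l) 1 = 0 := by
    intro ε
    by_contra h
    obtain ⟨g, hg⟩ := exists_isRegularDominant l
    have h0 : p ≠ bar q := by
      rintro rfl
      have hq : bar q ≠ .inl () := by
        rintro h'
        rw [h', ← bar_bar q, h', bar_zero] at hpq
        exact lt_irrefl _ hpq
      have h1 := gen_bar (bar q) hq
      rw [bar_bar] at h1
      rw [h1, zero_lie] at h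
      exact h rfl
    have h1 := hg _ (wt_sub_mem_positiveRoots hpq h0)
    have h2 := rePair_spinWeight_le hg ε
    rw [← eq_spinWeight_of_apply_ne_zero
      (gen_lie_mem_weightSub (delta_mem_weightSub ε) p q) h, ← neg_sub (wt q), rePair_add,
      rePair_neg] at h2
    linarith
  conv_lhs => rw [eq_sum_delta s]
  rw [lie_sum, sum_apply]
  exact Finset.sum_eq_zero fun ε _ => by rw [lie_smul, smul_apply, h, mul_zero]

theorem gen_lie_apply_neg_one {p q : Idx l} (hpq : ht q < ht p) (s : Spin l) :
    (⁅gen p q, s⁆ : Spin l) (-1) = 0 := by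
  have h : ∀ ε, (⁅gen p q, delta ε⁆ : Spin l) (-1) = 0 := by
    intro ε
    by_contra h
    obtain ⟨g, hg⟩ := exists_isRegularDominant l
    have h1 := rePair_of_gen_lie_delta_ne_zero hg hpq h
    have h2 := rePair_spinWeight_le hg (-ε)
    have h3 : ∀ η : Fin l → ℤˣ, rePair g (spinWeight (-η)) = -rePair g (spinWeight η) := by
      intro η
      rw [← rePair_neg]
      congr 1
      ext i
      simp [spinWeight, neg_div]
    rw [h3] at h1 h2
    linarith
  conv_lhs => rw [eq_sum_delta s]
  rw [lie_sum, sum_apply]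
  exact Finset.sum_eq_zero fun ε _ => by rw [lie_smul, smul_apply, h, mul_zero]

end Spin

end TypeB

/-! ### Pairings with the spin module -/

namespace TypeB

open Matrix

variable {l : ℕ}

/-- A finite-dimensional module with a primitive vector of weight `ν` that pairs nontrivially with
`delta ε` under a bilinear form invariant under the lowering operators. -/
def HasPairing (ν : Fin l → ℂ) (ε : Fin l → ℤˣ) : Prop :=
  ∃ (X : Type) (_ : AddCommGroup X) (_ : Module ℂ X) (_ : LieRingModule (Alg l) X)
    (_ : LieModule ℂ (Alg l) X) (_ : Module.Finite ℂ X) (u : X) (b : Spin l →ₗ[ℂ] X →ₗ[ℂ] ℂ),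
    u ∈ weightSub X ν ∧ (∀ p q : Idx l, ht q < ht p → ⁅gen p q, u⁆ = 0) ∧
    (∀ p q : Idx l, ht p < ht q → ∀ s x, b ⁅gen p q, s⁆ x + b s ⁅gen p q, x⁆ = 0) ∧
    b (Spin.delta ε) u ≠ 0

theorem hasPairing_zero_one : HasPairing (0 : Fin l → ℂ) 1 := by
  refine ⟨TrivialLieModule ℂ (Alg l) ℂ, inferInstance, inferInstance, inferInstance, inferInstance,
    Module.Finite.equiv (TrivialLieModule.equiv ℂ (Alg l) ℂ).symm,
    (TrivialLieModule.equiv ℂ (Alg l) ℂ).symm 1,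
    (LinearMap.mul ℂ ℂ).compl₁₂ (Spin.coord l 1)
      (TrivialLieModule.equiv ℂ (Alg l) ℂ : TrivialLieModule ℂ (Alg l) ℂ →ₗ[ℂ] ℂ), ?_, ?_, ?_, ?_⟩
  · intro a
    rw [trivial_lie_zero, zero_dotProduct, zero_smul]
  · intro p q _
    exact trivial_lie_zero _ _ _ _
  · intro p q hpq s x
    rw [trivial_lie_zero (Alg l) (TrivialLieModule ℂ (Alg l) ℂ), map_zero, add_zero]
    simp [Spin.gen_lie_apply_one hpq]
  · simp [Spin.delta_apply]

/-- The new form on Spin × (Y ⊗ X) sends (s, z ⊗ x) to b(f(s, z), x). The map f need only respect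
lowering operators, which leaves room to use annihilators. -/
theorem HasPairing.add {Y : Type} [AddCommGroup Y] [Module ℂ Y] [LieRingModule (Alg l) Y]
    [LieModule ℂ (Alg l) Y] [Module.Finite ℂ Y] {ω ν : Fin l → ℂ} {ε ε' : Fin l → ℤˣ} {y : Y}
    (hy : y ∈ weightSub Y ω) (hyr : ∀ p q : Idx l, ht q < ht p → ⁅gen p q, y⁆ = 0)
    (f : Spin l →ₗ[ℂ] Y →ₗ[ℂ] Spin l)
    (hf : ∀ p q : Idx l, ht p < ht q → ∀ s z,
      f ⁅gen p q, s⁆ z + f s ⁅gen p q, z⁆ = ⁅gen p q, f s z⁆)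
    (hfε : ∃ c : ℂ, c ≠ 0 ∧ f (Spin.delta ε) y = c • Spin.delta ε') (h : HasPairing ν ε') :
    HasPairing (ω + ν) ε := by
  obtain ⟨X, _, _, _, _, _, u, b, hu, hur, hb, hbε⟩ := h
  obtain ⟨c, hc, hfc⟩ := hfε
  refine ⟨Y ⊗[ℂ] X, inferInstance, inferInstance, inferInstance, inferInstance, inferInstance,
    y ⊗ₜ u, (TensorProduct.lift.equiv (RingHom.id ℂ) Y X ℂ).toLinearMap ∘ₗ
      LinearMap.llcomp ℂ Y (Spin l) (X →ₗ[ℂ] ℂ) b ∘ₗ f,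
    ?_, ?_, ?_, ?_⟩
  · intro a
    rw [TensorProduct.LieModule.lie_tmul_right, hy a, hu a, add_dotProduct, add_smul,
      TensorProduct.tmul_smul, ← TensorProduct.smul_tmul']
  · intro p q hpq
    rw [TensorProduct.LieModule.lie_tmul_right, hyr p q hpq, hur p q hpq, TensorProduct.zero_tmul,
      TensorProduct.tmul_zero, add_zero]
  · intro p q hpq s t
    induction t using TensorProduct.induction_on with
    | zero => simp
    | add t t' h h' =>
      rw [lie_add, map_add, map_add, add_add_add_comm, h, h', add_zero]
    | tmul z x =>
      rw [TensorProduct.LieModule.lie_tmul_right, map_add]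
      change b (f ⁅gen p q, s⁆ z) x + (b (f s ⁅gen p q, z⁆) x + b (f s z) ⁅gen p q, x⁆) = 0
      rw [← add_assoc, ← LinearMap.add_apply, ← map_add, hf p q hpq, hb p q hpq]
  · change b (f (Spin.delta ε) y) u ≠ 0
    rw [hfc, map_smul, LinearMap.smul_apply]
    exact smul_ne_zero hc hbε

open Spin in
theorem createFirst_mem_weightSub {j : Fin l} (hj : j.val + 1 < l) :
    createFirst (j.val + 1) ∈ weightSub (Spin l →ₗ[ℂ] Spin l) (fundamentalWeight j) := by
  intro a
  have h1 : fundamentalWeight j ⬝ᵥ a = ∑ m : Fin l, if m.val < j.val + 1 then a m else 0 := by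
    refine Finset.sum_congr rfl fun m _ => ?_
    rw [fundamentalWeight, if_neg hj.ne, ite_mul, one_mul, zero_mul]
    congr 1
    exact propext (by rw [Fin.le_def]; omega)
  rw [h1, ← rep_cartan_mul_createFirst hj.le]
  rfl

open Spin in
theorem gen_lie_createFirst {k : ℕ} (hk : k ≤ l) {p q : Idx l} (hpq : ht q < ht p) :
    ⁅gen p q, (createFirst k : Spin l →ₗ[ℂ] Spin l)⁆ = 0 :=
  sub_eq_zero.2 (rep_mul_createFirst hk hpq)

-- Increasing ν costs nothing: take f(s, T) = φ(T) s with φ invariant under lowering and nonzero on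
-- the primitive vector. For the last weight φ is evaluation at the top sign vector; for the others
-- it is the trace against `annihilateFirst`.
open Spin in
theorem HasPairing.add_fundamentalWeight {ν : Fin l → ℂ} {ε : Fin l → ℤˣ} (h : HasPairing ν ε)
    (j : Fin l) : HasPairing (fundamentalWeight j + ν) ε := by
  by_cases hj : j.val + 1 < l
  · have hF : ∀ {p q : Idx l}, ht p < ht q → rep (gen p q) * annihilateFirst (j.val + 1) =
        annihilateFirst (j.val + 1) * rep (gen p q) := rep_mul_annihilateFirst hj.le
    let φ : (Spin l →ₗ[ℂ] Spin l) →ₗ[ℂ] ℂ :=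
      LinearMap.trace ℂ (Spin l) ∘ₗ LinearMap.mulRight ℂ (annihilateFirst (l := l) (j.val + 1))
    have hφ : ∀ p q : Idx l, ht p < ht q → ∀ T, φ ⁅gen p q, T⁆ = 0 := by
      intro p q hpq T
      change LinearMap.trace ℂ (Spin l)
        ((rep (gen p q) * T - T * rep (gen p q)) * annihilateFirst (j.val + 1)) = 0
      rw [sub_mul, map_sub, mul_assoc T, hF hpq, mul_assoc, LinearMap.trace_mul_comm, mul_assoc,
        sub_self]
    refine h.add (createFirst_mem_weightSub hj) (fun p q hpq => gen_lie_createFirst hj.le hpq)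
      (LinearMap.lsmul ℂ (Spin l) ∘ₗ φ).flip (fun p q hpq s T => ?_)
      ⟨_, trace_createFirst_mul_annihilateFirst_ne_zero hj.le, rfl⟩
    change φ T • ⁅gen p q, s⁆ + φ ⁅gen p q, T⁆ • s = ⁅gen p q, φ T • s⁆
    rw [hφ p q hpq, zero_smul, add_zero, lie_smul]
  · have hj' : fundamentalWeight j = spinWeight 1 := by
      have := j.isLt
      have h1 : j.val + 1 = l := by omega
      rw [spinWeight_one_eq (by omega)]
      congr 1
      exact Fin.ext (by simp only; omega)
    rw [hj']
    refine h.add (delta_mem_weightSub 1)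
      (isHighestWeightVector_iff.1 isHighestWeightVector_delta_one).2.2
      (LinearMap.lsmul ℂ (Spin l) ∘ₗ coord l 1).flip (fun p q hpq s t => ?_)
      ⟨1, one_ne_zero, ?_⟩
    · change t 1 • ⁅gen p q, s⁆ + (⁅gen p q, t⁆ : Spin l) 1 • s = ⁅gen p q, t 1 • s⁆
      rw [gen_lie_apply_one hpq, zero_smul, add_zero, lie_smul]
    · change delta (l := l) 1 1 • delta ε = (1 : ℂ) • delta ε
      rw [delta_apply, if_pos rfl]

theorem HasPairing.add_weightOf {ν : Fin l → ℂ} {ε : Fin l → ℤˣ} (h : HasPairing ν ε)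
    (a : Fin l → ℕ) : HasPairing (weightOf a + ν) ε := by
  have h1 : ∀ (n : ℕ) (i : Fin l) (ν : Fin l → ℂ), HasPairing ν ε →
      HasPairing ((n : ℂ) • fundamentalWeight i + ν) ε := by
    intro n i ν hν
    induction n with
    | zero => simpa using hν
    | succ n ih =>
      have := ih.add_fundamentalWeight i
      rw [Nat.cast_succ, add_smul, one_smul, add_comm (_ • _), add_assoc]
      exact this
  have h2 : ∀ s : Finset (Fin l),
      HasPairing (∑ i ∈ s, (a i : ℂ) • fundamentalWeight i + ν) ε := by
    intro s
    induction s using Finset.induction_on with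
    | empty => simpa using h
    | insert i s hi ih =>
      rw [Finset.sum_insert hi, add_assoc]
      exact h1 _ _ _ ih
  exact h2 Finset.univ

-- In the dual of Spin, evaluation at the lowest sign vector has the highest weight. The form is
-- ξ(annihilateFirst i s), which carries i plus signs followed by minus signs to the lowest vector.
open Spin in
theorem hasPairing_spinWeight_one {i : ℕ} (hi : i ≤ l) :
    HasPairing (spinWeight (l := l) 1) (setFirst i 1 (-1)) := by
  refine ⟨Spin l →ₗ[ℂ] ℂ, inferInstance, inferInstance, Module.Dual.instLieRingModule,
    Module.Dual.instLieModule, inferInstance, coord l (-1),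
    LinearMap.flip (LinearMap.lcomp ℂ ℂ (annihilateFirst i)), ?_, ?_, ?_, ?_⟩
  · intro a
    ext s
    rw [Module.Dual.lie_apply, coord_apply, lie_cartan_apply, LinearMap.smul_apply, coord_apply,
      smul_eq_mul, ← neg_mul, ← neg_dotProduct]
    congr 2
    ext m
    simp [spinWeight, neg_div]
  · intro p q hpq
    ext s
    rw [Module.Dual.lie_apply, coord_apply, gen_lie_apply_neg_one hpq, neg_zero]
    rfl
  · intro p q hpq s ξ
    change ξ (annihilateFirst i (rep (gen p q) s)) - ξ (rep (gen p q) (annihilateFirst i s)) = 0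
    rw [← Module.End.mul_apply, ← Module.End.mul_apply, rep_mul_annihilateFirst hi hpq, sub_self]
  · obtain ⟨c, hc, h⟩ := annihilateFirst_delta hi (ε := setFirst i 1 (-1)) fun m hm => by
      simp [setFirst, hm]
    change annihilateFirst i (delta (setFirst i 1 (-1))) (-1) ≠ 0
    have h1 : setFirst i (-1) (setFirst i 1 (-1 : Fin l → ℤˣ)) = -1 := by
      funext m
      simp [setFirst]
    rw [h, h1, smul_apply, delta_apply, if_pos rfl, mul_one]
    exact hc

-- With f(s, T) = T(annihilateFirst i s), the initial plus signs are first made minus; then T =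
-- `createFirst (j + 1)` makes all signs up to j plus. One fundamental weight thus removes a whole
-- block of minus signs.
open Spin in
theorem HasPairing.add_fundamentalWeight_of_block {ν : Fin l → ℂ} {ε : Fin l → ℤˣ} {i : ℕ}
    {j : Fin l} (hj : j.val + 1 < l) (hij : i ≤ j.val) (hi : ∀ m : Fin l, m.val < i → ε m = 1)
    (hε : ∀ m : Fin l, i ≤ m.val → m ≤ j → ε m = -1)
    (h : HasPairing ν (setFirst (j.val + 1) 1 ε)) : HasPairing (fundamentalWeight j + ν) ε := by
  have hil : i ≤ l := by omega
  refine h.add (createFirst_mem_weightSub hj) (fun p q hpq => gen_lie_createFirst hj.le hpq)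
    (LinearMap.id.flip ∘ₗ annihilateFirst i) (fun p q hpq s T => ?_) ?_
  · change T (annihilateFirst i (rep (gen p q) s)) +
      (rep (gen p q) (T (annihilateFirst i s)) - T (rep (gen p q) (annihilateFirst i s))) =
      rep (gen p q) (T (annihilateFirst i s))
    rw [← Module.End.mul_apply (annihilateFirst i), ← Module.End.mul_apply (rep (gen p q))
      (annihilateFirst i), rep_mul_annihilateFirst hil hpq]
    abel
  · obtain ⟨c, hc, h1⟩ := annihilateFirst_delta hil hi
    obtain ⟨c', hc', h2⟩ := createFirst_delta hj.le (ε := setFirst i (-1) ε) fun m hm => by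
      by_cases hm' : m.val < i
      · simp [setFirst, hm']
      · rw [setFirst, if_neg hm']
        exact hε m (by omega) (by rw [Fin.le_def]; omega)
    have h3 : setFirst (j.val + 1) 1 (setFirst i (-1) ε) = setFirst (j.val + 1) 1 ε := by
      funext m
      simp only [setFirst]
      split_ifs
      · rfl
      · omega
      · rfl
    refine ⟨c * c', mul_ne_zero hc hc', ?_⟩
    change createFirst (j.val + 1) (annihilateFirst i (delta ε)) = _
    rw [h1, map_smul, h2, smul_smul, h3]

/-- Induction on the number of minus signs: the first block, at positions i to j, is removed at the
price of one fundamental weight at j. The hypothesis asks for one such weight at the end of every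
block, and it passes to the shortened sign vector. -/
theorem hasPairing_weightOf (a : Fin l → ℕ) (ε : Fin l → ℤˣ)
    (h : ∀ j : Fin l, ε j = -1 → (∀ hj : j.val + 1 < l, ε ⟨j.val + 1, hj⟩ = 1) → 0 < a j) :
    HasPairing (weightOf a) ε := by
  induction hn : (Finset.univ.filter fun i => ε i = -1).card using Nat.strong_induction_on
    generalizing a ε with
  | _ n ih =>
  by_cases h1 : ε = 1
  · have := (hasPairing_zero_one (l := l)).add_weightOf a
    rwa [add_zero, ← h1] at this
  have h2 : ∃ i : ℕ, ∃ hi : i < l, ε ⟨i, hi⟩ = -1 := by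
    by_contra! hcon
    exact h1 (funext fun i => (Int.units_eq_one_or (ε i)).resolve_right (hcon i.val i.isLt))
  classical
  obtain ⟨i, ⟨hi, hεi⟩, himin⟩ : ∃ i : ℕ, (∃ hi : i < l, ε ⟨i, hi⟩ = -1) ∧
      ∀ m < i, ¬ ∃ hm : m < l, ε ⟨m, hm⟩ = -1 :=
    ⟨Nat.find h2, Nat.find_spec h2, fun m hm => Nat.find_min h2 hm⟩
  have h3 : ∃ j : ℕ, i ≤ j ∧ j < l ∧ ∀ hj : j + 1 < l, ε ⟨j + 1, hj⟩ = 1 :=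
    ⟨l - 1, by omega, by omega, fun hj => by omega⟩
  obtain ⟨j, ⟨hij, hj, hεj⟩, hjmin⟩ : ∃ j : ℕ,
      (i ≤ j ∧ j < l ∧ ∀ hj : j + 1 < l, ε ⟨j + 1, hj⟩ = 1) ∧
      ∀ m < j, ¬ (i ≤ m ∧ m < l ∧ ∀ hm : m + 1 < l, ε ⟨m + 1, hm⟩ = 1) :=
    ⟨Nat.find h3, Nat.find_spec h3, fun m hm => Nat.find_min h3 hm⟩
  have hpre : ∀ m : Fin l, m.val < i → ε m = 1 := fun m hm =>
    (Int.units_eq_one_or (ε m)).resolve_right fun h' => himin m.val hm ⟨m.isLt, h'⟩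
  have hblock : ∀ m : ℕ, i ≤ m → m ≤ j → ∀ hm : m < l, ε ⟨m, hm⟩ = -1 := by
    intro m him
    induction m, him using Nat.le_induction with
    | base => exact fun _ _ => hεi
    | succ m him ihm =>
      intro hmj hml
      refine (Int.units_eq_one_or _).resolve_left fun h' => ?_
      exact hjmin m (by omega) ⟨him, by omega, fun _ => h'⟩
  have haj : 0 < a ⟨j, hj⟩ := h ⟨j, hj⟩ (hblock j hij le_rfl hj) hεj
  set a' : Fin l → ℕ := a - Pi.single ⟨j, hj⟩ 1 with ha'
  have haa : a = Pi.single ⟨j, hj⟩ 1 + a' := by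
    funext m
    by_cases hm : m = ⟨j, hj⟩
    · subst hm
      simp [ha']
      omega
    · simp [ha', hm]
  have hw : weightOf a = fundamentalWeight ⟨j, hj⟩ + weightOf a' := by
    conv_lhs => rw [haa]
    rw [weightOf_add, weightOf_single]
  rw [hw]
  by_cases hjl : j + 1 < l
  · refine HasPairing.add_fundamentalWeight_of_block (i := i) hjl hij hpre
      (fun m him hmj => hblock m.val him hmj m.isLt) ?_
    refine ih _ ?_ a' (Spin.setFirst (j + 1) 1 ε) ?_ rfl
    · rw [← hn]
      refine Finset.card_lt_card (Finset.ssubset_iff_of_subset ?_ |>.2 ⟨⟨i, hi⟩, ?_, ?_⟩)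
      · intro m hm
        rw [Finset.mem_filter] at hm ⊢
        refine ⟨hm.1, ?_⟩
        have h4 := hm.2
        rw [Spin.setFirst] at h4
        split_ifs at h4 with h5
        · exact absurd h4 (by decide)
        · exact h4
      · simp [hεi]
      · have : i < j + 1 := by omega
        intro h'
        have h4 := (Finset.mem_filter.1 h').2
        rw [Spin.setFirst, if_pos this] at h4
        exact absurd h4 (by decide)
    · intro m hm hm1
      rw [Spin.setFirst] at hm
      split_ifs at hm with h5
      · exact absurd hm (by decide)
      · have h6 : m ≠ ⟨j, hj⟩ := by
          rintro rfl
          simp at h5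
        have h7 : a' m = a m := by simp [ha', h6]
        rw [h7]
        refine h m hm fun hml => ?_
        have h8 := hm1 hml
        rw [Spin.setFirst, if_neg (by simp only; omega)] at h8
        exact h8
  -- The first block reaches the last position, so it is the only one, and the dual spin module
  -- handles it.
  · have h4 : ε = Spin.setFirst i 1 (-1) := by
      funext m
      rw [Spin.setFirst]
      split_ifs with hm
      · exact hpre m hm
      · exact hblock m.val (by omega) (by omega) m.isLt
    have h5 : fundamentalWeight ⟨j, hj⟩ = spinWeight 1 := by
      rw [Spin.spinWeight_one_eq (by omega)]
      congr 1
      exact Fin.ext (by simp only; omega)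
    rw [h5, add_comm, h4]
    exact (hasPairing_spinWeight_one hi.le).add_weightOf a'

end TypeB

namespace TypeB

open Matrix

/-! ### Dominance in coordinates -/

section Coordinates

variable {l : ℕ}

theorem weightOf_sub_weightOf_succ (a : Fin l → ℕ) {j : ℕ} (hj : j + 1 < l) :
    weightOf a ⟨j, by omega⟩ - weightOf a ⟨j + 1, hj⟩ = a ⟨j, by omega⟩ := by
  have h : ∀ i : Fin l, (fundamentalWeight i ⟨j, by omega⟩ : ℂ) - fundamentalWeight i ⟨j + 1, hj⟩ =
      if i = ⟨j, by omega⟩ then 1 else 0 := by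
    intro i
    simp only [fundamentalWeight, Fin.le_def, Fin.ext_iff]
    split_ifs <;> first | omega | simp
  simp only [weightOf, Finset.sum_apply, Pi.smul_apply, ← Finset.sum_sub_distrib, ← smul_sub, h]
  simp

theorem two_mul_weightOf_last (a : Fin l) (b : Fin l → ℕ) (ha : a.val + 1 = l) :
    2 * weightOf b a = b a := by
  have h : ∀ i : Fin l, 2 * ((b i : ℂ) • fundamentalWeight i a) = if i = a then (b i : ℂ) else 0 := by
    intro i
    simp only [fundamentalWeight, Fin.le_def, Fin.ext_iff, smul_eq_mul]
    split_ifs <;> first | omega | ring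
  simp only [weightOf, Finset.sum_apply, Pi.smul_apply, Finset.mul_sum, h]
  simp

/-- Where a block of minus signs ends, adding ε lowers the coefficient of the fundamental weight by
exactly one, and the result must still be nonnegative. -/
theorem pos_of_isDominantIntegral {a : Fin l → ℕ} {ε : Fin l → ℤˣ}
    (h : IsDominantIntegral (weightOf a + spinWeight ε)) (j : Fin l) (hj : ε j = -1)
    (hj' : ∀ hj : j.val + 1 < l, ε ⟨j.val + 1, hj⟩ = 1) : 0 < a j := by
  obtain ⟨b, hb⟩ := h
  suffices (a j : ℂ) = (b j + 1 : ℕ) by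
    rw [Nat.cast_inj.1 this]
    exact Nat.succ_pos _
  push_cast
  by_cases hl : j.val + 1 < l
  · have h1 := congrFun hb j
    have h2 := congrFun hb ⟨j.val + 1, hl⟩
    have h3 := weightOf_sub_weightOf_succ a hl
    have h4 := weightOf_sub_weightOf_succ b hl
    simp only [Pi.add_apply, spinWeight, hj, hj' hl, Fin.eta] at h1 h2 h3 h4
    push_cast at h1 h2
    linear_combination h1 - h2 - h3 + h4
  · have hl' : j.val + 1 = l := by have := j.isLt; omega
    have h1 := congrFun hb j
    have h3 := two_mul_weightOf_last j a hl'
    have h4 := two_mul_weightOf_last j b hl'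
    simp only [Pi.add_apply, spinWeight, hj] at h1
    push_cast at h1
    linear_combination 2 * h1 - h3 + h4

end Coordinates

/-! ### Components of the tensor product and their eigenvalues -/

section Components

variable {l : ℕ} {V W : Type} [AddCommGroup V] [Module ℂ V] [LieRingModule (Alg l) V]
  [LieModule ℂ (Alg l) V] [AddCommGroup W] [Module ℂ W] [LieRingModule (Alg l) W]
  [LieModule ℂ (Alg l) W]

/-- The pairing argument runs in the model Spin ⊗ H, with H generated by the primitive vector of the
pairing; uniqueness of irreducible modules then transports the result to V ⊗ W. -/
theorem exists_isHighestWeightVector_tensor {a : Fin l → ℕ} {ε : Fin l → ℤˣ}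
    (hV : IsIrreducibleOfHighestWeight V (spinWeight (l := l) 1))
    (hW : IsIrreducibleOfHighestWeight W (weightOf a))
    (h : ∀ j : Fin l, ε j = -1 → (∀ hj : j.val + 1 < l, ε ⟨j.val + 1, hj⟩ = 1) → 0 < a j) :
    ∃ x : V ⊗[ℂ] W, IsHighestWeightVector (weightOf a + spinWeight ε) x := by
  obtain ⟨X, _, _, _, _, _, u, b, hu, hur, hb, hbε⟩ := hasPairing_weightOf a ε h
  have hu0 : u ≠ 0 := by
    rintro rfl
    exact hbε (map_zero _)
  have hhw : IsHighestWeightVector (weightOf a) u := isHighestWeightVector_iff.2 ⟨hu0, hu, hur⟩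
  set H := LieSubmodule.lieSpan ℂ (Alg l) {u} with hH
  have hHirr : IsIrreducibleOfHighestWeight H (weightOf a) := isIrreducibleOfHighestWeight_lieSpan hhw
  have := hHirr.irreducible
  have := hHirr.finite
  have huH : u ∈ H := LieSubmodule.subset_lieSpan rfl
  obtain ⟨x, hx⟩ := Spin.exists_isHighestWeightVector_of_pairing (W := H) (u := ⟨u, huH⟩)
    (LieSubmodule_isHighestWeightVector_iff.2 hhw) ε (b.compl₂ (H : Submodule ℂ X).subtype)
    (fun p q hpq s w => hb p q hpq s w.1) hbε
  obtain ⟨f, hf⟩ := exists_bijective_of_isIrreducibleOfHighestWeight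
    (Spin.isIrreducibleOfHighestWeight (l := l)) hV
  obtain ⟨g, hg⟩ := exists_bijective_of_isIrreducibleOfHighestWeight hHirr hW
  refine ⟨TensorProduct.LieModule.map f g x, isHighestWeightVector_map hx _ fun h0 => hx.ne_zero ?_⟩
  have hinj : Function.Injective (TensorProduct.map (f : Spin l →ₗ[ℂ] V) (g : H →ₗ[ℂ] W)) :=
    TensorProduct.map_injective_of_flat_flat _ _ hf.1 hg.1
  exact hinj (h0.trans (map_zero _).symm)

theorem le_of_isIrreducible {M : Type*} [AddCommGroup M] [Module ℂ M] [LieRingModule (Alg l) M]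
    [LieModule ℂ (Alg l) M] {N N' : LieSubmodule ℂ (Alg l) M}
    (hN : LieModule.IsIrreducible ℂ (Alg l) N) {x : M} (hx0 : x ≠ 0) (hx : x ∈ N) (hx' : x ∈ N') :
    N ≤ N' := by
  have htop : N'.comap N.incl = ⊤ := by
    refine (IsSimpleOrder.eq_bot_or_eq_top _).resolve_left fun hbot => hx0 ?_
    have : (⟨x, hx⟩ : N) ∈ N'.comap N.incl := hx'
    rw [hbot, LieSubmodule.mem_bot] at this
    exact congrArg Subtype.val this
  intro y hy
  have : (⟨y, hy⟩ : N) ∈ N'.comap N.incl := htop ▸ LieSubmodule.mem_top _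
  exact this

/-- Only the last three coordinates differ, and there ρ is (5/2, 3/2, 1/2). Equality amounts to a_p
- a_r/2 + 1/2 = 0. -/
theorem casimirScalar_eq_of_eq {a : Fin l → ℕ} {p q r : Fin l} (hp : p.val + 3 = l)
    (hq : q.val + 2 = l) (hr : r.val + 1 = l) (ha : a r = 2 * a p + 1) {ε η : Fin l → ℤˣ}
    (hεη : ∀ i < p, ε i = η i) (hε₁ : ε p = 1) (hε₂ : ε q = -1) (hε₃ : ε r = -1)
    (hη₁ : η p = -1) (hη₂ : η q = 1) (hη₃ : η r = 1) :
    casimirScalar (weightOf a + spinWeight ε) = casimirScalar (weightOf a + spinWeight η) := by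
  obtain ⟨k, hk⟩ := p
  obtain rfl : k + 3 = l := hp
  have hk₁ : k + 1 < k + 3 := by omega
  have hk₂ : k + 2 < k + 3 := by omega
  obtain rfl : q = ⟨k + 1, hk₁⟩ := Fin.ext (by simp only; omega)
  obtain rfl : r = ⟨k + 2, hk₂⟩ := Fin.ext (by simp only; omega)
  rw [Spin.casimirScalar_add_spinWeight, Spin.casimirScalar_add_spinWeight]
  congr 2
  rw [Fin.sum_univ_castSucc, Fin.sum_univ_castSucc, Fin.sum_univ_castSucc]
  rw [Fin.sum_univ_castSucc, Fin.sum_univ_castSucc, Fin.sum_univ_castSucc]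
  have e1 : (Fin.last k).castSucc.castSucc = (⟨k, by omega⟩ : Fin (k + 3)) := rfl
  have e2 : (Fin.last (k + 1)).castSucc = (⟨k + 1, by omega⟩ : Fin (k + 3)) := rfl
  have e3 : Fin.last (k + 2) = (⟨k + 2, by omega⟩ : Fin (k + 3)) := rfl
  have e4 : ∀ i : Fin k, spinWeight ε i.castSucc.castSucc.castSucc =
      spinWeight η i.castSucc.castSucc.castSucc := by
    intro i
    rw [spinWeight, spinWeight, hεη _ (Fin.lt_def.2 i.isLt)]
  have h4 := weightOf_sub_weightOf_succ a (j := k) (by omega)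
  have h5 := two_mul_weightOf_last (⟨k + 2, by omega⟩ : Fin (k + 3)) a rfl
  have h6 : (a ⟨k + 2, by omega⟩ : ℂ) = 2 * a ⟨k, by omega⟩ + 1 := by exact_mod_cast ha
  simp only [e1, e2, e3, e4]
  simp only [spinWeight, hε₁, hε₂, hε₃, hη₁, hη₂, hη₃]
  push_cast
  linear_combination h4 - h5 / 2 - h6 / 2

theorem exists_components {a : Fin l → ℕ} {p q r : Fin l} (hp : p.val + 3 = l)
    (hq : q.val + 2 = l) (hr : r.val + 1 = l) (ha : a r = 2 * a p + 1) {ε η : Fin l → ℤˣ}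
    (hεη : ∀ i < p, ε i = η i) (hε₁ : ε p = 1) (hε₂ : ε q = -1) (hε₃ : ε r = -1)
    (hη₁ : η p = -1) (hη₂ : η q = 1) (hη₃ : η r = 1)
    (hε : ∀ j : Fin l, ε j = -1 → (∀ hj : j.val + 1 < l, ε ⟨j.val + 1, hj⟩ = 1) → 0 < a j)
    (hη : ∀ j : Fin l, η j = -1 → (∀ hj : j.val + 1 < l, η ⟨j.val + 1, hj⟩ = 1) → 0 < a j)
    (hV : IsIrreducibleOfHighestWeight V (spinWeight (l := l) 1))
    (hW : IsIrreducibleOfHighestWeight W (weightOf a)) :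
    ∃ (N₁ N₂ : LieSubmodule ℂ (Alg l) (V ⊗[ℂ] W)) (c : ℂ),
      N₁ ≠ N₂ ∧ IsIrreducibleOfHighestWeight N₁ (weightOf a + spinWeight ε) ∧
      IsIrreducibleOfHighestWeight N₂ (weightOf a + spinWeight η) ∧
      (∀ t ∈ N₁, tensorCasimir ℂ (Alg l) V W t = c • t) ∧
      (∀ t ∈ N₂, tensorCasimir ℂ (Alg l) V W t = c • t) := by
  have := hV.finite
  have := hW.finite
  obtain ⟨x, hx⟩ := exists_isHighestWeightVector_tensor hV hW hε
  obtain ⟨y, hy⟩ := exists_isHighestWeightVector_tensor hV hW hη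
  have hN₁ := isIrreducibleOfHighestWeight_lieSpan hx
  have hN₂ := isIrreducibleOfHighestWeight_lieSpan hy
  have hle : ∀ {ζ : Fin l → ℂ} {z : V ⊗[ℂ] W}, IsHighestWeightVector ζ z →
      LieSubmodule.lieSpan ℂ (Alg l) {z} ≤ casimirEigen l (V ⊗[ℂ] W) (casimirScalar ζ) := by
    intro ζ z hz
    rw [LieSubmodule.lieSpan_le, Set.singleton_subset_iff]
    exact hz.mem_casimirEigen
  have hc := casimirScalar_eq_of_eq hp hq hr ha hεη hε₁ hε₂ hε₃ hη₁ hη₂ hη₃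
  refine ⟨_, _, _, fun heq => ?_, hN₁, hN₂,
    fun t ht => tensorCasimir_apply_of_mem_casimirEigen hV hW (hle hx ht),
    fun t ht => tensorCasimir_apply_of_mem_casimirEigen hV hW (hc ▸ hle hy ht)⟩
  -- If the two submodules agreed, one irreducible module would have two highest weights, which
  -- differ at position p.
  have hxm : x ∈ LieSubmodule.lieSpan ℂ (Alg l) {x} := LieSubmodule.subset_lieSpan rfl
  have hym : y ∈ LieSubmodule.lieSpan ℂ (Alg l) {x} := heq ▸ LieSubmodule.subset_lieSpan rfl
  have := hN₁.irreducible
  have h1 := (highestWeight_eq_and_eq_smul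
    (LieSubmodule_isHighestWeightVector_iff (x := ⟨x, hxm⟩).2 hx)
    (LieSubmodule_isHighestWeightVector_iff (x := ⟨y, hym⟩).2 hy)).1
  have h2 := Spin.spinWeight_injective (add_left_cancel h1)
  rw [h2, hε₁] at hη₁
  exact absurd hη₁ (by decide)

/-- An eigenvalue determines the sign vector of a highest weight vector in the component;
multiplicity one then determines the component. -/
theorem hasDistinctEigenvalues_of_two {a : Fin 2 → ℕ} {V W : Type} [AddCommGroup V] [Module ℂ V]
    [LieRingModule (Alg 2) V] [LieModule ℂ (Alg 2) V] [AddCommGroup W] [Module ℂ W]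
    [LieRingModule (Alg 2) W] [LieModule ℂ (Alg 2) W]
    (hV : IsIrreducibleOfHighestWeight V (spinWeight (l := 2) 1))
    (hW : IsIrreducibleOfHighestWeight W (weightOf a)) :
    HasDistinctEigenvalues ℂ (Alg 2) V W := by
  have := hV.finite
  have := hW.finite
  have := hW.irreducible
  obtain ⟨u, hu⟩ := hW.exists_highestWeightVector
  obtain ⟨f, hf⟩ := exists_bijective_of_isIrreducibleOfHighestWeight hV
    (Spin.isIrreducibleOfHighestWeight (l := 2))
  have hinj : Function.Injective
      (TensorProduct.LieModule.map f (LieModuleHom.id : W →ₗ⁅ℂ, Alg 2⁆ W)) :=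
    TensorProduct.map_injective_of_flat_flat (f : V →ₗ[ℂ] Spin 2) (LinearMap.id : W →ₗ[ℂ] W) hf.1
      Function.injective_id
  have hmap : ∀ {ζ : Fin 2 → ℂ} {x : V ⊗[ℂ] W}, IsHighestWeightVector ζ x →
      IsHighestWeightVector ζ (TensorProduct.LieModule.map f LieModuleHom.id x) := fun hx =>
    isHighestWeightVector_map hx _ fun h0 => hx.ne_zero (hinj (h0.trans (map_zero _).symm))
  have hex : ∀ N : {N : LieSubmodule ℂ (Alg 2) (V ⊗[ℂ] W) // LieModule.IsIrreducible ℂ (Alg 2) N},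
      ∃ (ε : Fin 2 → ℤˣ) (x : V ⊗[ℂ] W),
        x ∈ N.1 ∧ IsHighestWeightVector (weightOf a + spinWeight ε) x := by
    intro N
    have hN := N.2
    have hbot : N.1 ≠ ⊥ := (LieSubmodule.nontrivial_iff_ne_bot ℂ (Alg 2) _).1
      (LieModule.nontrivial_of_isIrreducible ℂ (Alg 2) _)
    obtain ⟨ζ, x, hxN, hx⟩ := exists_highestWeightVector N.1 hbot
    obtain ⟨ε, rfl, -⟩ := Spin.exists_leading_coeff hu (hmap hx)
    exact ⟨ε, x, hxN, hx⟩
  choose ε x hxN hx using hex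
  refine ⟨fun N => (casimirScalar (weightOf a + spinWeight (ε N)) - casimirScalar (spinWeight 1) -
    casimirScalar (weightOf a)) / (8 * (2 * (2 : ℕ) - 1)), fun N t ht =>
      tensorCasimir_apply_of_mem_casimirEigen hV hW
        (le_of_isIrreducible N.2 (hx N).ne_zero (hxN N) (hx N).mem_casimirEigen ht),
    fun N N' h => ?_⟩
  have h1 : casimirScalar (weightOf a + spinWeight (ε N)) =
      casimirScalar (weightOf a + spinWeight (ε N')) := by
    have h0 : (8 * (2 * (2 : ℕ) - 1) : ℂ) ≠ 0 := by norm_num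
    simpa using (div_left_inj' h0).1 h
  have h2 : ε N = ε N' := by
    rw [Spin.casimirScalar_add_spinWeight, Spin.casimirScalar_add_spinWeight] at h1
    have h3 := mul_left_cancel₀ (by norm_num : (4 : ℂ) ≠ 0) (add_left_cancel h1)
    have h4 : weightOf a 0 - weightOf a 1 = a 0 := weightOf_sub_weightOf_succ a one_lt_two
    have h5 : 2 * weightOf a 1 = a 1 := two_mul_weightOf_last 1 a rfl
    rw [Fin.sum_univ_two, Fin.sum_univ_two] at h3
    -- The coefficients are the coordinates of 2(ν + ρ), with ρ = (3/2, 1/2).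
    have h6 : ((2 * a 0 + a 1 + 3 : ℤ) : ℂ) * (((ε N 0 : ℤ) - (ε N' 0 : ℤ) : ℤ) : ℂ) +
        ((a 1 + 1 : ℤ) : ℂ) * (((ε N 1 : ℤ) - (ε N' 1 : ℤ) : ℤ) : ℂ) = 0 := by
      simp only [spinWeight, Fin.val_zero, Fin.val_one] at h3
      push_cast at h3 ⊢
      rw [← h4, ← h5]
      linear_combination 4 * h3
    have h7 : (2 * a 0 + a 1 + 3 : ℤ) * ((ε N 0 : ℤ) - (ε N' 0 : ℤ)) +
        (a 1 + 1 : ℤ) * ((ε N 1 : ℤ) - (ε N' 1 : ℤ)) = 0 := by exact_mod_cast h6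
    -- The differences of signs are 0 or ±2, and the first coefficient strictly exceeds the second,
    -- which is positive; so no cancellation is possible.
    have h8 : ε N 0 = ε N' 0 ∧ ε N 1 = ε N' 1 := by
      rcases Int.units_eq_one_or (ε N 0) with e1 | e1 <;>
      rcases Int.units_eq_one_or (ε N' 0) with e2 | e2 <;>
      rcases Int.units_eq_one_or (ε N 1) with e3 | e3 <;>
      rcases Int.units_eq_one_or (ε N' 1) with e4 | e4 <;>
      simp only [e1, e2, e3, e4, Units.val_one, Units.val_neg] at h7 <;>
      first
        | omega
        | exact ⟨e1.trans e2.symm, e3.trans e4.symm⟩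
    funext i
    fin_cases i
    · exact h8.1
    · exact h8.2
  have hx' := hx N'
  rw [← h2] at hx'
  obtain ⟨c, hc⟩ := Spin.eq_smul_of_isHighestWeightVector hu (hmap (hx N)) (hmap hx')
  rw [← map_smul] at hc
  have hmem : x N' ∈ N.1 := by
    rw [hinj hc]
    exact N.1.smul_mem c (hxN N)
  exact Subtype.ext (le_antisymm
    (le_of_isIrreducible N.2 hx'.ne_zero hmem (hxN N'))
    (le_of_isIrreducible N'.2 hx'.ne_zero (hxN N') hmem))

theorem exists_not_hasDistinctEigenvalues (h3 : 3 ≤ l) :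
    ∃ (a : Fin l → ℕ) (W : Type) (_ : AddCommGroup W) (_ : Module ℂ W)
      (_ : LieRingModule (Alg l) W) (_ : LieModule ℂ (Alg l) W),
      IsIrreducibleOfHighestWeight W (weightOf a) ∧
        ¬HasDistinctEigenvalues ℂ (Alg l) (Spin l) W := by
  obtain ⟨k, rfl⟩ : ∃ k, l = k + 3 := ⟨l - 3, by omega⟩
  -- The weight ω_{l-2} + 3 ω_l satisfies a_l = 2a_{l-2} + 1, and both coefficients are positive, as
  -- needed where the minus blocks of η and ε end.
  set a : Fin (k + 3) → ℕ := fun i => if i.val = k + 2 then 3 else if i.val = k then 1 else 0 with ha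
  -- For ε = 1 there is no condition on a; the pairing is used only to obtain a module with a
  -- primitive vector of weight ν.
  obtain ⟨X, _, _, _, _, _, u, b, hu, hur, -, hb1⟩ := hasPairing_weightOf a 1 fun j hj =>
    absurd hj (by rw [Pi.one_apply]; decide)
  have hu0 : u ≠ 0 := by
    rintro rfl
    exact hb1 (map_zero _)
  have hW := isIrreducibleOfHighestWeight_lieSpan
    (isHighestWeightVector_iff.2 ⟨hu0, hu, hur⟩)
  refine ⟨a, LieSubmodule.lieSpan ℂ (Alg (k + 3)) {u}, inferInstance, inferInstance, inferInstance,
    inferInstance, hW, ?_⟩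
  rintro ⟨c, hc, hcinj⟩
  obtain ⟨N₁, N₂, d, hne, hN₁, hN₂, h1, h2⟩ := exists_components (a := a)
    (p := ⟨k, by omega⟩) (q := ⟨k + 1, by omega⟩) (r := ⟨k + 2, by omega⟩) rfl rfl rfl
    (ε := fun i => if i.val ≤ k then 1 else -1) (η := fun i => if i.val = k then -1 else 1)
    (by simp [ha])
    (fun i hi => by
      have hi' : i.val < k := hi
      simp only [if_pos hi'.le, if_neg hi'.ne])
    (by simp) (by simp) (by simp) (by simp) (by simp) (by simp)
    (fun j hj hj' => by
      simp only [ha]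
      split_ifs at hj with hj1
      · exact absurd hj (by decide)
      · by_cases h : j.val + 1 < k + 3
        · have h' := hj' h
          simp only at h'
          rw [if_neg (by omega)] at h'
          exact absurd h' (by decide)
        · rw [if_pos (by omega)]
          norm_num)
    (fun j hj hj' => by
      simp only [ha]
      split_ifs at hj with hj1
      · rw [if_neg (by omega), if_pos hj1]
        norm_num
      · exact absurd hj (by decide))
    Spin.isIrreducibleOfHighestWeight hW
  have key : ∀ (N : LieSubmodule ℂ (Alg (k + 3)) _) (hN : LieModule.IsIrreducible ℂ (Alg (k + 3)) N),
      (∀ t ∈ N, tensorCasimir ℂ (Alg (k + 3)) (Spin (k + 3)) (LieSubmodule.lieSpan ℂ (Alg (k + 3)) {u}) t = d • t) →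
      c ⟨N, hN⟩ = d := by
    intro N hN hd
    have hbot : N ≠ ⊥ := (LieSubmodule.nontrivial_iff_ne_bot ℂ (Alg (k + 3)) _).1
      (LieModule.nontrivial_of_isIrreducible ℂ (Alg (k + 3)) _)
    obtain ⟨t, htN, ht0⟩ : ∃ t ∈ N, t ≠ 0 := by
      by_contra! hcon
      exact hbot ((LieSubmodule.eq_bot_iff N).2 hcon)
    exact smul_left_injective ℂ ht0 ((hc ⟨N, hN⟩ t htN).symm.trans (hd t htN))
  exact hne (congrArg Subtype.val (hcinj ((key N₁ hN₁.irreducible h1).trans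
    (key N₂ hN₂.irreducible h2).symm)))

end Components

end TypeB

/-- The `B_l` spin module and the eigenvalues of `M_{ω_l, ν}(C)`. -/
theorem proposition5p5 (l : ℕ) (hl : 2 ≤ l) :
    ((∀ (a : Fin l → ℕ)
        (V : Type) [AddCommGroup V] [Module ℂ V] [LieRingModule (TypeB.Alg l) V]
        [LieModule ℂ (TypeB.Alg l) V]
        (W : Type) [AddCommGroup W] [Module ℂ W] [LieRingModule (TypeB.Alg l) W]
        [LieModule ℂ (TypeB.Alg l) W],
        TypeB.IsIrreducibleOfHighestWeight V
          (TypeB.fundamentalWeight (⟨l - 1, by omega⟩ : Fin l)) →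
        TypeB.IsIrreducibleOfHighestWeight W (TypeB.weightOf a) →
        HasDistinctEigenvalues ℂ (TypeB.Alg l) V W) ↔ l = 2) ∧
    (∀ (h3 : 3 ≤ l) (a : Fin l → ℕ),
      a ⟨l - 1, by omega⟩ = 2 * a ⟨l - 3, by omega⟩ + 1 →
      ∀ ε η : Fin l → ℤˣ,
        (∀ i : Fin l, i.val < l - 3 → ε i = η i) →
        ε ⟨l - 3, by omega⟩ = 1 → ε ⟨l - 2, by omega⟩ = -1 → ε ⟨l - 1, by omega⟩ = -1 →
        η ⟨l - 3, by omega⟩ = -1 → η ⟨l - 2, by omega⟩ = 1 → η ⟨l - 1, by omega⟩ = 1 →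
        TypeB.IsDominantIntegral (TypeB.weightOf a + TypeB.spinWeight ε) →
        TypeB.IsDominantIntegral (TypeB.weightOf a + TypeB.spinWeight η) →
        ∀ (V : Type) [AddCommGroup V] [Module ℂ V] [LieRingModule (TypeB.Alg l) V]
          [LieModule ℂ (TypeB.Alg l) V]
          (W : Type) [AddCommGroup W] [Module ℂ W] [LieRingModule (TypeB.Alg l) W]
          [LieModule ℂ (TypeB.Alg l) W],
          TypeB.IsIrreducibleOfHighestWeight V
            (TypeB.fundamentalWeight (⟨l - 1, by omega⟩ : Fin l)) →
          TypeB.IsIrreducibleOfHighestWeight W (TypeB.weightOf a) →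
          ∃ (N₁ N₂ : LieSubmodule ℂ (TypeB.Alg l) (V ⊗[ℂ] W)) (c : ℂ),
            N₁ ≠ N₂ ∧
            TypeB.IsIrreducibleOfHighestWeight N₁
              (TypeB.weightOf a + TypeB.spinWeight ε) ∧
            TypeB.IsIrreducibleOfHighestWeight N₂
              (TypeB.weightOf a + TypeB.spinWeight η) ∧
            (∀ t ∈ N₁, tensorCasimir ℂ (TypeB.Alg l) V W t = c • t) ∧
            (∀ t ∈ N₂, tensorCasimir ℂ (TypeB.Alg l) V W t = c • t)) := by
  have hω : TypeB.fundamentalWeight (⟨l - 1, by omega⟩ : Fin l) = TypeB.spinWeight 1 :=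
    (TypeB.Spin.spinWeight_one_eq (by omega)).symm
  rw [hω]
  refine ⟨⟨fun h => ?_, ?_⟩, ?_⟩
  · by_contra hne
    obtain ⟨a, W, _, _, _, _, hW, hnot⟩ :=
      TypeB.exists_not_hasDistinctEigenvalues (l := l) (by omega)
    exact hnot (h a (TypeB.Spin l) W TypeB.Spin.isIrreducibleOfHighestWeight hW)
  · rintro rfl a V _ _ _ _ W _ _ _ _ hV hW
    exact TypeB.hasDistinctEigenvalues_of_two hV hW
  · intro h3 a ha ε η hεη hε₁ hε₂ hε₃ hη₁ hη₂ hη₃ hε hη V _ _ _ _ W _ _ _ _ hV hW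
    rw [hω] at hV
    exact TypeB.exists_components (by simp only; omega) (by simp only; omega) (by simp only; omega)
      ha hεη hε₁ hε₂ hε₃ hη₁ hη₂ hη₃
      (TypeB.pos_of_isDominantIntegral hε) (TypeB.pos_of_isDominantIntegral hη) hV hW
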